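/- Let $\Bbbk$ be an algebraically closed field of characteristic zero and let $X$ be a surface obtained from $\mathbb P^2_{\Bbbk}$ by a chain of $s\le 8$ blow-ups of closed points (each centre is an arbitrary closed point of the surface obtained so far, so infinitely near points are allowed). Let $K_X\in\operatorname{Pic}(X)$ be the canonical class and $(D,E)\mapsto D\cdot E$ the intersection form on $\operatorname{Pic}(X)$. A class $R\in\operatorname{Pic}(X)$ is a $(-2)$-class if $R^2+R\cdot K_X=-2$ (that is, $\chi(-R)=0$) and $R^2=-2$. The Weyl group $W(X)$ is the group of automorphisms of $\operatorname{Pic}(X)$ generated by the reflections $D\mapsto D+(D\cdot R)R$ in the $(-2)$-classes $R$. A toric system on $X$ is a sequence $A=(A_1,\dots,A_n)$ in $\operatorname{Pic}(X)$ of length $n=\operatorname{rank}K_0(X)=\operatorname{rank}\operatorname{Pic}(X)+2$ such that, with indices modulo $n$, $A_i\cdot A_{i+1}=1$ for all $i$, $A_i\cdot A_j=0$ if $j\ne i,i\pm1$, and $A_1+\dots+A_n=-K_X$. Write $A^2=(A_1^2,\dots,A_n^2)$. A sequence of integers is admissible if it can be obtained from a sequence $(0,c,0,-c)$ or $(c,0,-c,0)$,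 $c\in\mathbb Z$, by finitely many (possibly no) elementary augmentations, that is, operations sending $(a_1,\dots,a_n)$ to one of $(-1,a_1-1,a_2,\dots,a_{n-1},a_n-1)$; $(a_1,\dots,a_{m-2},a_{m-1}-1,-1,a_m-1,a_{m+1},\dots,a_n)$ with $2\le m\le n$; $(a_1-1,a_2,\dots,a_{n-1},a_n-1,-1)$. Let $a$ be an admissible sequence and let $TS_a(X)$ be the set of toric systems $A$ on $X$ with $A^2=a$. Then $W(X)$, acting by $w(A)=(w(A_1),\dots,w(A_n))$, maps $TS_a(X)$ to itself; the action on $TS_a(X)$ is free (if $w(A)=A$ for some $A\in TS_a(X)$, then $w=1$) and transitive (for all $A,B\in TS_a(X)$ there is $w\in W(X)$ with $w(A)=B$). The set $TS_a(X)$ may be empty. -/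

import Mathlib

open AlgebraicGeometry CategoryTheory Polynomial
open scoped KaehlerDifferential

universe u

noncomputable section

namespace RationalSurface

/-! ### Blow-ups of the projective plane -/

/-- The degree `n` part `Iⁿ tⁿ` of the Rees algebra `⨁ Iⁿ tⁿ`. -/
def reesGrading {R : Type u} [CommRing R] (I : Ideal R) (n : ℕ) : Submodule R (reesAlgebra I) :=
  (LinearMap.range (monomial n : R →ₗ[R] R[X])).comap (reesAlgebra I).val.toLinearMap

theorem mem_reesGrading {R : Type u} [CommRing R] {I : Ideal R} {n : ℕ} {f : reesAlgebra I} :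
    f ∈ reesGrading I n ↔ ∃ r : R, monomial n r = (f : R[X]) := Iff.rfl

/-- The homogeneous component of degree `n` of an element of the Rees algebra. -/
def reesComponent {R : Type u} [CommRing R] (I : Ideal R) (n : ℕ) :
    reesAlgebra I →+ reesGrading I n where
  toFun f := ⟨⟨monomial n ((f : R[X]).coeff n), reesAlgebra.monomial_mem.mpr (f.2 n)⟩, _, rfl⟩
  map_zero' := by ext : 2; simp
  map_add' f g := by ext : 2; simp

instance reesGradedMonoid {R : Type u} [CommRing R] (I : Ideal R) :
    SetLike.GradedMonoid (reesGrading I) where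
  one_mem := ⟨1, by simp⟩
  mul_mem := by
    rintro i j f g ⟨r, hr⟩ ⟨s, hs⟩
    exact ⟨r * s, by
      rw [← monomial_mul_monomial, hr, hs]
      simp⟩

theorem reesComponent_of_mem {R : Type u} [CommRing R] {I : Ideal R} {i : ℕ} {f : reesAlgebra I}
    (hf : f ∈ reesGrading I i) (j : ℕ) :
    ((reesComponent I j f : reesAlgebra I) : R[X]) = if i = j then (f : R[X]) else 0 := by
  obtain ⟨r, hr⟩ := mem_reesGrading.mp hf
  change monomial j ((f : R[X]).coeff j) = _
  rw [← hr, coeff_monomial]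
  split_ifs with h
  · rw [h]
  · simp

/-- The decomposition of an element of the Rees algebra into its homogeneous components. -/
def reesDecompose {R : Type u} [CommRing R] (I : Ideal R) (f : reesAlgebra I) :
    DirectSum ℕ (fun i => reesGrading I i) :=
  DirectSum.mk (fun i => reesGrading I i) (f : R[X]).support (fun i => reesComponent I i f)

theorem reesDecompose_apply {R : Type u} [CommRing R] {I : Ideal R} (f : reesAlgebra I) (j : ℕ) :
    reesDecompose I f j = reesComponent I j f := by
  by_cases h : j ∈ (f : R[X]).support
  · exact DirectSum.mk_apply_of_mem h
  · refine (DirectSum.mk_apply_of_notMem h).trans (Subtype.ext (Subtype.ext ?_))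
    change (0 : R[X]) = monomial j ((f : R[X]).coeff j)
    rw [notMem_support_iff.mp h, map_zero]

instance reesGradedAlgebra {R : Type u} [CommRing R] (I : Ideal R) :
    GradedAlgebra (reesGrading I) where
  decompose' := reesDecompose I
  left_inv f := by
    classical
    apply Subtype.ext
    have h : (DirectSum.coeAddMonoidHom (reesGrading I)) (reesDecompose I f) =
        ∑ i ∈ (f : R[X]).support, (reesComponent I i f : reesAlgebra I) := by
      rw [DirectSum.coeAddMonoidHom_eq_dfinsuppSum, DFinsupp.sum]
      simp only [reesDecompose_apply]
      refine Finset.sum_subset (fun i hi => ?_) (fun i _ hi => ?_)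
      · by_contra hn
        rw [DFinsupp.mem_support_toFun, reesDecompose_apply] at hi
        refine hi (Subtype.ext (Subtype.ext ?_))
        change monomial i ((f : R[X]).coeff i) = 0
        rw [notMem_support_iff.mp hn, map_zero]
      · rw [DFinsupp.notMem_support_iff, reesDecompose_apply] at hi
        rw [hi]
        rfl
    rw [h, AddSubmonoidClass.coe_finsetSum]
    exact ((f : R[X]).as_sum_support).symm
  right_inv x := by
    induction x using DirectSum.induction_on with
    | zero =>
      rw [map_zero]
      refine DFinsupp.ext fun j => ?_
      rw [reesDecompose_apply, map_zero]
      rfl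
    | of i x =>
      rw [DirectSum.coeAddMonoidHom_of]
      refine DFinsupp.ext fun j => ?_
      rw [reesDecompose_apply]
      apply Subtype.ext
      apply Subtype.ext
      rw [reesComponent_of_mem x.2]
      split_ifs with h
      · subst h
        rw [DirectSum.of_eq_same]
      · rw [DirectSum.of_eq_of_ne _ _ _ (Ne.symm h)]
        rfl
    | add x y hx hy =>
      rw [map_add]
      refine DFinsupp.ext fun j => ?_
      rw [reesDecompose_apply, map_add, ← reesDecompose_apply, ← reesDecompose_apply, hx, hy]
      rfl

/-- The structure morphism `Proj A ⟶ Spec R` of a graded `R`-algebra `A`. -/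
def projStructure {R A : Type u} [CommRing R] [CommRing A] [Algebra R A]
    (𝒜 : ℕ → Submodule R A) [GradedAlgebra 𝒜] : Proj 𝒜 ⟶ Spec (.of R) :=
  Proj.toSpecZero 𝒜 ≫ Spec.map (CommRingCat.ofHom (algebraMap R (𝒜 0)))

section

attribute [local instance] MvPolynomial.gradedAlgebra

/-- The projective plane `Proj k[x₀, x₁, x₂]`. -/
def projectivePlane (k : Type u) [Field k] : Scheme.{u} :=
  Proj (MvPolynomial.homogeneousSubmodule (Fin 3) k)

/-- The structure morphism `ℙ² ⟶ Spec k`. -/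
def projectivePlaneStructure (k : Type u) [Field k] : projectivePlane k ⟶ Spec (.of k) :=
  projStructure (MvPolynomial.homogeneousSubmodule (Fin 3) k)

end

/-- The ideal of the sections over `U` that vanish at `p`
(the unit ideal if `p` does not lie in `U`). -/
def pointIdeal {X : Scheme.{u}} (p : X) (U : X.Opens) : Ideal Γ(X, U) :=
  ⨅ h : p ∈ U, (IsLocalRing.maximalIdeal (X.presheaf.stalk p)).comap (X.presheaf.germ U p h).hom

/-- `π` is the blow-up of the point `p`: over every affine open `U`, with `I` the ideal of `p`
in `Γ(X, U)`, it is isomorphic to `Proj (⨁ Iⁿ) ⟶ U`. -/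
def IsBlowUpAt {X' X : Scheme.{u}} (π : X' ⟶ X) (p : X) : Prop :=
  ∀ (U : X.Opens) (hU : IsAffineOpen U),
    ∃ e : (π ⁻¹ᵁ U).toScheme ≅ Proj (reesGrading (pointIdeal p U)),
      e.hom ≫ projStructure (reesGrading (pointIdeal p U)) = (π ∣_ U) ≫ hU.isoSpec.hom

/-- `IsIteratedBlowUp k s X f`: the `k`-scheme `f : X ⟶ Spec k` is obtained from `ℙ²` by a chain
of `s` blow-ups of closed points, each centre being an arbitrary closed point of the surface
constructed so far. -/
inductive IsIteratedBlowUp (k : Type u) [Field k] :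
    ℕ → ∀ X : Scheme.{u}, (X ⟶ Spec (.of k)) → Prop
  | plane {X : Scheme.{u}} (e : X ≅ projectivePlane k) :
      IsIteratedBlowUp k 0 X (e.hom ≫ projectivePlaneStructure k)
  | blowUp {s : ℕ} {X X' : Scheme.{u}} {f : X ⟶ Spec (.of k)} (hX : IsIteratedBlowUp k s X f)
      (p : X) (hp : IsClosed ({p} : Set X)) (π : X' ⟶ X) (hπ : IsBlowUpAt π p) :
      IsIteratedBlowUp k (s + 1) X' (π ≫ f)

/-! ### Divisor classes -/

/-- Prime divisors of `X`, given by their generic points. -/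
abbrev PrimeDivisor (X : Scheme.{u}) : Type u := {x : X // Order.coheight x = 1}

/-- Divisors on `X`. -/
abbrev Divisor (X : Scheme.{u}) : Type u := PrimeDivisor X →₀ ℤ

section

variable (X : Scheme.{u}) [IsIntegral X] [IsLocallyNoetherian X]

/-- The group of principal divisors. -/
def principalDivisors : AddSubgroup (Divisor X) where
  carrier := {D | ∃ g : X.functionField, g ≠ 0 ∧ ∀ x : PrimeDivisor X, D x = Scheme.ord g x.1}
  zero_mem' := by
    refine ⟨1, one_ne_zero, fun x => ?_⟩
    have h := Scheme.ord_mul (x := x.1) (one_ne_zero (α := X.functionField)) one_ne_zero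
    rw [mul_one] at h
    rw [Finsupp.zero_apply]
    linarith
  add_mem' := by
    rintro D E ⟨g, hg, hD⟩ ⟨h, hh, hE⟩
    exact ⟨g * h, mul_ne_zero hg hh, fun x => by
      rw [Finsupp.add_apply, hD, hE, Scheme.ord_mul hg hh]⟩
  neg_mem' := by
    rintro D ⟨g, hg, hD⟩
    refine ⟨g⁻¹, inv_ne_zero hg, fun x => ?_⟩
    have h1 := Scheme.ord_mul (x := x.1) (one_ne_zero (α := X.functionField)) one_ne_zero
    have h2 := Scheme.ord_mul (x := x.1) hg (inv_ne_zero hg)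
    rw [mul_one] at h1
    rw [mul_inv_cancel₀ hg] at h2
    rw [Finsupp.neg_apply, hD]
    linarith

/-- The group of divisors modulo linear equivalence; on a smooth surface, all of whose local rings
are factorial, this is the Picard group. -/
abbrev Pic : Type u := Divisor X ⧸ principalDivisors X

end

section

variable {X : Scheme.{u}} [IsIntegral X] [IsLocallyNoetherian X]

/-- The class of a divisor. -/
abbrev Pic.mk (D : Divisor X) : Pic X := QuotientAddGroup.mk D

/-- The class of a prime divisor. -/
abbrev Pic.ofPrime (C : PrimeDivisor X) : Pic X := Pic.mk (Finsupp.single C 1)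

end

/-! ### The intersection form -/

/-- The ideal, in the local ring at `y`, of the integral closed subscheme with generic point `x`
(the unit ideal if `y` does not lie on it). -/
def idealAt {X : Scheme.{u}} (x y : X) : Ideal (X.presheaf.stalk y) :=
  ⨅ h : x ⤳ y,
    (IsLocalRing.maximalIdeal (X.presheaf.stalk x)).comap (X.presheaf.stalkSpecializes h).hom

/-- The local intersection multiplicity at `y` of the curves `C` and `C'`: the length of
`𝒪_{X,y} / (I_C + I_{C'})`. -/
def localIntersection {X : Scheme.{u}} (C C' : PrimeDivisor X) (y : X) : ℕ :=
  (Module.length (X.presheaf.stalk y)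
    (X.presheaf.stalk y ⧸ (idealAt C.1 y ⊔ idealAt C'.1 y))).toNat

/-- A symmetric bilinear form on divisor classes that counts the points of intersection of any two
distinct curves with their multiplicities. On a smooth projective surface there is exactly one. -/
def IsIntersectionForm {X : Scheme.{u}} [IsIntegral X] [IsLocallyNoetherian X]
    (B : Pic X →+ Pic X →+ ℤ) : Prop :=
  (∀ D E : Pic X, B D E = B E D) ∧
    ∀ C C' : PrimeDivisor X, C ≠ C' →
      B (Pic.ofPrime C) (Pic.ofPrime C') = ((∑ᶠ y : X, localIntersection C C' y : ℕ) : ℤ)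

open Classical in
/-- The intersection form `(D, E) ↦ D · E` on `Pic X`. -/
def intersectionForm (X : Scheme.{u}) [IsIntegral X] [IsLocallyNoetherian X] :
    Pic X →+ Pic X →+ ℤ :=
  if h : ∃ B : Pic X →+ Pic X →+ ℤ, IsIntersectionForm B then h.choose else 0

/-! ### The canonical class -/

section

variable {k : Type u} [Field k] {X : Scheme.{u}}

/-- The `k`-algebra structure of a stalk of a `k`-scheme `f : X ⟶ Spec k`. -/
abbrev stalkAlgebra (f : X ⟶ Spec (.of k)) (x : X) : Algebra k (X.presheaf.stalk x) :=
  ((X.presheaf.germ ⊤ x trivial).hom.comp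
    (f.appTop.hom.comp (Scheme.ΓSpecIso (.of k)).inv.hom)).toAlgebra

/-- `η = da ∧ db`, where `a, b ∈ R` are such that `da, db` is a basis of `Ω_{R/k}`. -/
def IsLocalTwoForm (k R K : Type u) [Field k] [CommRing R] [Field K] [Algebra k R] [Algebra k K]
    [Algebra R K] (η : ⋀[K]^2 (Ω[K⁄k])) : Prop :=
  ∃ a b : R,
    LinearIndependent R ![KaehlerDifferential.D k R a, KaehlerDifferential.D k R b] ∧
    Submodule.span R {KaehlerDifferential.D k R a, KaehlerDifferential.D k R b} = ⊤ ∧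
    η = exteriorPower.ιMulti K 2
      ![KaehlerDifferential.D k K (algebraMap R K a), KaehlerDifferential.D k K (algebraMap R K b)]

variable [IsIntegral X] [IsLocallyNoetherian X]

/-- `D` is the divisor of a nonzero rational `2`-form `ω`: for every prime divisor `C`, if
`ω = g · η` with `η` a generator of the regular `2`-forms at `C`, then `D` has
multiplicity `ord_C g` along `C`. -/
def IsCanonicalDivisor (f : X ⟶ Spec (.of k)) (D : Divisor X) : Prop :=
  letI : ∀ x : X, Algebra k (X.presheaf.stalk x) := stalkAlgebra f
  letI : Algebra k X.functionField := stalkAlgebra f (genericPoint X)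
  ∃ ω : ⋀[X.functionField]^2 (Ω[X.functionField⁄k]), ω ≠ 0 ∧
    ∀ C : PrimeDivisor X, ∃ (g : X.functionField) (η : ⋀[X.functionField]^2 (Ω[X.functionField⁄k])),
      IsLocalTwoForm k (X.presheaf.stalk C.1) X.functionField η ∧
      ω = g • η ∧ D C = Scheme.ord g C.1

open Classical in
/-- The canonical class `K_X`, the class of the divisor of any nonzero rational `2`-form. -/
def canonicalClass (f : X ⟶ Spec (.of k)) : Pic X :=
  if h : ∃ D : Divisor X, IsCanonicalDivisor f D then Pic.mk h.choose else 0

/-! ### Weyl group and toric systems -/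

/-- `D` is an `r`-class: `D² + D · K_X = -2` (that is, `χ(-D) = 0`) and `D² = r`. -/
def IsRClass (f : X ⟶ Spec (.of k)) (r : ℤ) (D : Pic X) : Prop :=
  intersectionForm X D D + intersectionForm X D (canonicalClass f) = -2 ∧
    intersectionForm X D D = r

/-- The Weyl group `W(X)`, generated by the orthogonal reflections `D ↦ D + (D · R) R` in the
`(-2)`-classes `R`. -/
def weylGroup (f : X ⟶ Spec (.of k)) : Subgroup (Pic X ≃ₗ[ℤ] Pic X) :=
  Subgroup.closure {w | ∃ R : Pic X, IsRClass f (-2) R ∧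
    ∀ D : Pic X, w D = D + intersectionForm X D R • R}

/-- Toric systems `(A₁, …, Aₙ)`, with indices modulo `n`. The length `n` is the rank of `K₀(X)`,
which is `rank Pic X + 2`. -/
structure IsToricSystem (f : X ⟶ Spec (.of k)) {n : ℕ} [NeZero n] (A : Fin n → Pic X) : Prop where
  length_eq : n = Module.finrank ℤ (Pic X) + 2
  adjacent : ∀ i, intersectionForm X (A i) (A (i + 1)) = 1
  not_adjacent : ∀ i j, j ≠ i → j ≠ i + 1 → j ≠ i - 1 → intersectionForm X (A i) (A j) = 0
  sum_eq : ∑ i, A i = -canonicalClass f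

/-- The set `TS_a(X)` of toric systems `A` with `A² = a`. -/
def toricSystems (f : X ⟶ Spec (.of k)) {n : ℕ} [NeZero n] (a : Fin n → ℤ) :
    Set (Fin n → Pic X) :=
  {A | IsToricSystem f A ∧ ∀ i, intersectionForm X (A i) (A i) = a i}

end

/-- Admissible sequences: those obtained from `(0, c, 0, -c)` or `(c, 0, -c, 0)` by
(any number of) elementary augmentations. -/
inductive IsAdmissible : List ℤ → Prop
  | base (c : ℤ) : IsAdmissible [0, c, 0, -c]
  | base' (c : ℤ) : IsAdmissible [c, 0, -c, 0]
  | augmFirst (x : ℤ) (l : List ℤ) (y : ℤ) (h : IsAdmissible (x :: l ++ [y])) :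
      IsAdmissible (-1 :: (x - 1) :: l ++ [y - 1])
  | augmMiddle (l : List ℤ) (x y : ℤ) (r : List ℤ) (h : IsAdmissible (l ++ x :: y :: r)) :
      IsAdmissible (l ++ (x - 1) :: (-1) :: (y - 1) :: r)
  | augmLast (x : ℤ) (l : List ℤ) (y : ℤ) (h : IsAdmissible (x :: l ++ [y])) :
      IsAdmissible ((x - 1) :: l ++ [y - 1, -1])

end RationalSurface

end

/-!
The geometry enters only through the divisor class group. On a surface `X` obtained from the plane
by `s` blow-ups of closed points, `Pic X` is torsion-free and generated by `s + 1` elements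
(`IsIteratedBlowUp.isNormalSurface`). The proof is by induction on the blow-ups and uses excision:
outside of the exceptional curve the blow-up is the surface without the centre, and no multiple of
the exceptional curve is the divisor of a function, since such a function would be a unit near the
centre (`IsNormalSurface.blowUp`). To continue the induction one keeps track of normality and of the
regularity of the closed points, in the form that the maximal ideal is generated by a regular
sequence; both are checked in the two charts `R[y/x]` and `R[x/y]` of the blow-up, where the
exceptional curve is given by a prime element and is an affine line over the residue field.

The rest is about lattices. Of the intersection form only the symmetry is needed, because a toric
system prescribes the form on its own span. Following an admissible sequence `a` down its elementary
augmentations, that is, contracting classes of square `-1`, every toric system `A` with `A² = a`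
acquires a standard basis, whose members are integral combinations of the `A i` with coefficients
that depend on `a` only (`IsAdmissible.hasPairedBases`): either classes `L, E 1, …, E r` as on the
plane blown up in `r` points, or the two rulings of a quadric. The number of members is the rank of
`Pic X`, and their Gram matrix is unimodular, so they form a basis of `Pic X` (`eq_sum_of_dual`).
As the coefficients of the `A i` in this basis again depend on `a` only, the action of the Weyl
group on the toric systems with `A² = a` is the action on these bases; in particular it is free.

Transitivity thus means that any two standard bases for the same canonical class are conjugate
(`IsExceptionalBasis.exists_reflectionGroup_map`), and this is Noether's argument for plane Cremona
transformations. Let `L', E'` be another basis, let `d = L' · L` be the degree of `L'` and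
`m j = L' · E j` its multiplicities. Then `∑ m j = 3 (d - 1)` and `∑ (m j)² = d² - 1`; as `r ≤ 8`,
the Cauchy–Schwarz inequality gives `d ≥ 1` and `m j ≥ 0`. If `d ≥ 2`, then the three largest
multiplicities add up to more than `d`, and the reflection in `L - E i - E j - E k` lowers the
degree. If `d = 1`, then `L' = L`, and the `E' j` are a permutation of the `E j`, which is a product
of reflections in the differences `E i - E j`.
-/

noncomputable section

namespace RationalSurface

/-! ### Regular pairs and the charts of a blow-up -/

/-- A regular sequence `x, y` of nonzero elements of a domain, in a form symmetric in `x`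
and `y`. -/
structure IsRegularPair {R : Type u} [CommRing R] (x y : R) : Prop where
  left_ne_zero : x ≠ 0
  right_ne_zero : y ≠ 0
  dvd : ∀ a b : R, a * x = b * y → y ∣ a

theorem IsRegularPair.symm {R : Type u} [CommRing R] [IsDomain R] {x y : R}
    (h : IsRegularPair x y) : IsRegularPair y x where
  left_ne_zero := h.right_ne_zero
  right_ne_zero := h.left_ne_zero
  dvd a b hab := by
    obtain ⟨c, rfl⟩ := h.dvd b a hab.symm
    exact ⟨c, mul_right_cancel₀ h.right_ne_zero (by linear_combination hab)⟩

theorem isRegularPair_of_prime {R : Type u} [CommRing R] [IsDomain R] {x y : R}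
    (hx : Prime x) (hy : ¬ x ∣ y) : IsRegularPair x y where
  left_ne_zero := hx.ne_zero
  right_ne_zero := by rintro rfl; exact hy (dvd_zero x)
  dvd a b hab := by
    obtain ⟨c, rfl⟩ := (hx.dvd_or_dvd (Dvd.intro_left a hab)).resolve_right hy
    exact ⟨c, mul_right_cancel₀ hx.ne_zero (by linear_combination hab)⟩

theorem IsRegularPair.dvd_of_dvd_mul_pow {R : Type u} [CommRing R] [IsDomain R] {x y : R}
    (h : IsRegularPair x y) (n : ℕ) {c : R} (hc : x ∣ c * y ^ n) : x ∣ c := by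
  induction n with
  | zero => simpa using hc
  | succ n ih =>
    obtain ⟨d, hd⟩ := hc
    exact ih (h.symm.dvd _ d (by linear_combination hd))

/-- A ring homomorphism `ι : R ⟶ S` that identifies `S` with the subring
`⋃ₙ Iⁿ / fⁿ` of the fraction field of `R`. -/
structure IsBlowUpChart {R S : Type u} [CommRing R] [CommRing S] (I : Ideal R) (f : R)
    (ι : R →+* S) : Prop where
  injective : Function.Injective ι
  exists_mul : ∀ z : S, ∃ (n : ℕ) (a : R), a ∈ I ^ n ∧ ι f ^ n * z = ι a
  exists_div : ∀ (n : ℕ) (a : R), a ∈ I ^ n → ∃ z : S, ι f ^ n * z = ι a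

section Chart

variable {R S : Type u} [CommRing R] [CommRing S] {f g : R} {ι : R →+* S} {T : S}

/-- Clearing denominators in `P(g/f)`, where `T` stands for `g/f`. -/
theorem exists_pow_mul_eval₂ (hT : ι f * T = ι g) (n : ℕ) :
    ∀ P : R[X], (∀ i, n < i → P.coeff i = 0) → ∃ q : R, ι f ^ n * P.eval₂ ι T = ι q := by
  induction n with
  | zero =>
    intro P hP
    refine ⟨P.coeff 0, ?_⟩
    have : P = C (P.coeff 0) := by
      ext i
      rcases Nat.eq_zero_or_pos i with rfl | hi
      · simp
      · rw [hP i hi, coeff_C_of_ne_zero hi.ne']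
    rw [this]
    simp
  | succ n ih =>
    intro P hP
    obtain ⟨q, hq⟩ := ih (P.erase (n + 1)) fun i hi => by
      rw [coeff_erase]
      split_ifs with hin
      · rfl
      · exact hP i (by omega)
    refine ⟨P.coeff (n + 1) * g ^ (n + 1) + f * q, ?_⟩
    conv_lhs => rw [← monomial_add_erase P (n + 1)]
    rw [eval₂_add, eval₂_monomial, map_add, map_mul, map_mul, ← hq, map_pow, ← hT]
    ring

/-- In a chart the locus `f = 0` is the fibre over the centre `f = g = 0`. -/
theorem IsBlowUpChart.mem_iff_comap_eq (hI : (Ideal.span {f, g}).IsMaximal)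
    (hT : ι f * T = ι g) (q : Ideal S) [q.IsPrime] :
    ι f ∈ q ↔ q.comap ι = Ideal.span {f, g} := by
  constructor
  · intro hq
    refine (hI.eq_of_le (Ideal.IsPrime.ne_top inferInstance) ?_).symm
    rw [Ideal.span_le]
    rintro x (rfl | rfl)
    · exact hq
    · change ι x ∈ q
      rw [← hT]
      exact Ideal.mul_mem_right _ _ hq
  · intro hq
    change f ∈ q.comap ι
    rw [hq]
    exact Ideal.subset_span (by simp)

variable [IsDomain R]

/-- The polynomials `P` with `P(g/f) = 0` have their coefficients in `(f, g)`: this is where the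
regularity of the sequence `f, g` enters. -/
theorem IsBlowUpChart.mem_map_C_of_eval₂_eq_zero (h : IsBlowUpChart (Ideal.span {f, g}) f ι)
    (hfg : IsRegularPair f g) (hT : ι f * T = ι g) {P : R[X]} (hP : P.eval₂ ι T = 0) :
    P ∈ (Ideal.span {f, g}).map (C : R →+* R[X]) := by
  have key : ∀ n, ∀ P : R[X], (∀ i, n ≤ i → P.coeff i = 0) → P.eval₂ ι T = 0 →
      P ∈ (Ideal.span {f, g}).map (C : R →+* R[X]) := by
    intro n
    induction n with
    | zero =>
      intro P hP _
      have : P = 0 := by ext i; simp [hP i]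
      rw [this]
      exact zero_mem _
    | succ n ih =>
      intro P hP hP0
      rcases n with _ | n
      · have hPc : P = C (P.coeff 0) := by
          ext i
          rcases Nat.eq_zero_or_pos i with rfl | hi
          · simp
          · rw [hP i hi, coeff_C_of_ne_zero hi.ne']
        rw [hPc, eval₂_C] at hP0
        rw [hPc, (map_eq_zero_iff ι h.injective).mp hP0, C_0]
        exact zero_mem _
      · obtain ⟨q, hq⟩ := exists_pow_mul_eval₂ hT n (P.erase (n + 1)) fun i hi => by
          rw [coeff_erase]
          split_ifs with hin
          · rfl
          · exact hP i (by omega)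
        have h1 : P.coeff (n + 1) * g ^ (n + 1) + f * q = 0 := by
          apply h.injective
          rw [← monomial_add_erase P (n + 1), eval₂_add, eval₂_monomial] at hP0
          rw [map_zero, map_add, map_mul, map_mul, ← hq, map_pow, ← hT]
          linear_combination (ι f) ^ (n + 1) * hP0
        obtain ⟨d, hd⟩ := hfg.dvd_of_dvd_mul_pow (n + 1) (c := P.coeff (n + 1))
          ⟨-q, by linear_combination h1⟩
        have hmem : monomial n d * (C f * X - C g) ∈
            (Ideal.span {f, g}).map (C : R →+* R[X]) := by
          refine Ideal.mul_mem_left _ _ (sub_mem (Ideal.mul_mem_right _ _ ?_) ?_) <;>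
          exact Ideal.mem_map_of_mem _ (Ideal.subset_span (by simp))
        have h2 : P - monomial n d * (C f * X - C g) ∈
            (Ideal.span {f, g}).map (C : R →+* R[X]) := by
          refine ih _ (fun i hi => ?_) ?_
          · rw [coeff_sub, mul_sub, ← mul_assoc, monomial_mul_C, monomial_mul_C,
              monomial_mul_X, coeff_sub, coeff_monomial, coeff_monomial]
            rcases eq_or_lt_of_le hi with rfl | hi
            · rw [if_pos rfl, if_neg (by omega), hd]
              ring
            · rw [hP i (by omega), if_neg (by omega), if_neg (by omega)]
              ring
          · rw [eval₂_sub, hP0, eval₂_mul, eval₂_sub, eval₂_mul, eval₂_C, eval₂_C, eval₂_X, hT]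
            ring
        simpa using add_mem h2 hmem
  exact key (P.natDegree + 1) P (fun i hi => coeff_eq_zero_of_natDegree_lt (by omega)) hP

variable [IsDomain S]

omit [IsDomain R] in
/-- The chart is generated over `R` by `T = g/f`. -/
theorem IsBlowUpChart.eval₂_surjective (h : IsBlowUpChart (Ideal.span {f, g}) f ι) (hf : f ≠ 0)
    (hT : ι f * T = ι g) : Function.Surjective (eval₂RingHom ι T) := by
  have key : ∀ n, ∀ a ∈ Ideal.span {f, g} ^ n, ∃ P : R[X], ι f ^ n * P.eval₂ ι T = ι a := by
    intro n
    induction n with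
    | zero => exact fun a _ => ⟨C a, by simp⟩
    | succ n ih =>
      intro a ha
      rw [pow_succ'] at ha
      refine Submodule.mul_induction_on ha (fun r hr s hs => ?_) ?_
      · obtain ⟨u, v, rfl⟩ := Ideal.mem_span_pair.mp hr
        obtain ⟨P, hP⟩ := ih s hs
        refine ⟨(C u + C v * X) * P, ?_⟩
        rw [eval₂_mul, map_mul, ← hP]
        simp only [eval₂_add, eval₂_mul, eval₂_C, eval₂_X, map_add, map_mul, ← hT]
        ring
      · rintro x y ⟨P, hP⟩ ⟨Q, hQ⟩
        exact ⟨P + Q, by rw [eval₂_add, map_add, mul_add, hP, hQ]⟩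
  intro z
  obtain ⟨n, a, ha, hz⟩ := h.exists_mul z
  obtain ⟨P, hP⟩ := key n a ha
  refine ⟨P, mul_left_cancel₀ (pow_ne_zero n ?_) (hP.trans hz.symm)⟩
  exact (map_ne_zero_iff ι h.injective).mpr hf

/-- The quotient of `R[g/f]` by `f` is the polynomial ring in `g/f` over `R / (f, g)`. -/
theorem IsBlowUpChart.dvd_eval₂_iff (h : IsBlowUpChart (Ideal.span {f, g}) f ι)
    (hfg : IsRegularPair f g) (hT : ι f * T = ι g) {P : R[X]} :
    ι f ∣ P.eval₂ ι T ↔ P ∈ (Ideal.span {f, g}).map (C : R →+* R[X]) := by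
  constructor
  · rintro ⟨z, hz⟩
    obtain ⟨Q, rfl⟩ := h.eval₂_surjective hfg.left_ne_zero hT z
    have h1 := h.mem_map_C_of_eval₂_eq_zero hfg hT (P := P - C f * Q) (by
      rw [eval₂_sub, eval₂_mul, eval₂_C, hz]
      simp)
    have h2 : C f * Q ∈ (Ideal.span {f, g}).map (C : R →+* R[X]) :=
      Ideal.mul_mem_right _ _ (Ideal.mem_map_of_mem _ (Ideal.subset_span (by simp)))
    simpa using add_mem h1 h2
  · intro hP
    have : (Ideal.span {f, g}).map (C : R →+* R[X]) ≤
        (Ideal.span {ι f}).comap (eval₂RingHom ι T) := by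
      rw [Ideal.map_le_iff_le_comap, Ideal.span_le]
      rintro x (rfl | rfl)
      · exact Ideal.mem_span_singleton.mpr (by simp)
      · exact Ideal.mem_span_singleton.mpr ⟨T, by simp [hT]⟩
    exact Ideal.mem_span_singleton.mp (this hP)

/-- In the chart `R[g/f]` the exceptional curve is cut out by the prime element `f`. -/
theorem IsBlowUpChart.prime (h : IsBlowUpChart (Ideal.span {f, g}) f ι)
    (hfg : IsRegularPair f g) (hI : (Ideal.span {f, g}).IsPrime) (hT : ι f * T = ι g) :
    Prime (ι f) := by
  have hp : ((Ideal.span {f, g}).map (C : R →+* R[X])).IsPrime :=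
    (Ideal.isPrime_map_C_iff_isPrime _).mpr hI
  refine ⟨(map_ne_zero_iff ι h.injective).mpr hfg.left_ne_zero, fun hu => ?_, fun a b hab => ?_⟩
  · refine hp.ne_top ((Ideal.eq_top_iff_one _).mpr ((h.dvd_eval₂_iff hfg hT).mp ?_))
    exact hu.dvd
  · obtain ⟨P, rfl⟩ := h.eval₂_surjective hfg.left_ne_zero hT a
    obtain ⟨Q, rfl⟩ := h.eval₂_surjective hfg.left_ne_zero hT b
    rw [← map_mul] at hab
    exact (hp.mem_or_mem ((h.dvd_eval₂_iff hfg hT).mp hab)).imp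
      (h.dvd_eval₂_iff hfg hT).mpr (h.dvd_eval₂_iff hfg hT).mpr

theorem IsBlowUpChart.not_dvd (h : IsBlowUpChart (Ideal.span {f, g}) f ι)
    (hfg : IsRegularPair f g) (hI : (Ideal.span {f, g}).IsPrime) (hT : ι f * T = ι g) :
    ¬ ι f ∣ T := by
  intro hd
  have : (X : R[X]).eval₂ ι T = T := eval₂_X ..
  rw [← this, h.dvd_eval₂_iff hfg hT, Ideal.mem_map_C_iff] at hd
  exact hI.ne_top ((Ideal.eq_top_iff_one _).mpr (by simpa using hd 1))

/-- The points of the exceptional curve in the chart `R[g/f]` are regular: since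
`R[g/f] / (f)` is a polynomial ring over the residue field, a maximal ideal through `f` is generated
by `f` and one more element. -/
theorem IsBlowUpChart.exists_regularPair (h : IsBlowUpChart (Ideal.span {f, g}) f ι)
    (hfg : IsRegularPair f g) (hI : (Ideal.span {f, g}).IsMaximal) (hT : ι f * T = ι g)
    (q : Ideal S) (hq : q.IsMaximal) (hfq : ι f ∈ q) :
    ∃ x y : S, q = Ideal.span {x, y} ∧ IsRegularPair x y := by
  have hsurj := h.eval₂_surjective hfg.left_ne_zero hT
  let : Field (R ⧸ Ideal.span {f, g}) := Ideal.Quotient.field _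
  let m : R[X] →+* (R ⧸ Ideal.span {f, g})[X] := mapRingHom (Ideal.Quotient.mk _)
  have hm : Function.Surjective m := map_surjective _ Ideal.Quotient.mk_surjective
  have hker : ∀ P, m P = 0 → ι f ∣ P.eval₂ ι T := by
    intro P hP
    rw [h.dvd_eval₂_iff hfg hT, Ideal.mem_map_C_iff]
    intro i
    rw [← Ideal.Quotient.eq_zero_iff_mem, ← coeff_map]
    change (m P).coeff i = 0
    rw [hP, coeff_zero]
  obtain ⟨w, hw⟩ := (IsPrincipalIdealRing.principal ((q.comap (eval₂RingHom ι T)).map m)).principal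
  obtain ⟨y, rfl⟩ := hm w
  have hyq : eval₂RingHom ι T y ∈ q := by
    have : m y ∈ (q.comap (eval₂RingHom ι T)).map m := by
      rw [hw]
      exact Submodule.mem_span_singleton_self _
    obtain ⟨P, hP, hPy⟩ := (Ideal.mem_map_iff_of_surjective m hm).mp this
    obtain ⟨z, hz⟩ := hker (y - P) (by rw [map_sub, hPy, sub_self])
    have h1 : eval₂RingHom ι T y = ι f * z + eval₂RingHom ι T P := by
      rw [← hz]
      simp
    rw [h1]
    exact add_mem (Ideal.mul_mem_right _ _ hfq) hP
  have hspan : q = Ideal.span {ι f, eval₂RingHom ι T y} := by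
    apply le_antisymm
    · intro z hz
      obtain ⟨P, rfl⟩ := hsurj z
      have : m P ∈ (q.comap (eval₂RingHom ι T)).map m := Ideal.mem_map_of_mem m hz
      rw [hw] at this
      obtain ⟨Q, hQ⟩ := Submodule.mem_span_singleton.mp this
      obtain ⟨Q, rfl⟩ := hm Q
      obtain ⟨z, hz⟩ := hker (P - Q * y) (by rw [map_sub, map_mul, ← hQ, smul_eq_mul, sub_self])
      refine Ideal.mem_span_pair.mpr ⟨z, eval₂RingHom ι T Q, ?_⟩
      rw [mul_comm z, ← hz]
      simp
    · rw [Ideal.span_le]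
      rintro x (rfl | rfl)
      · exact hfq
      · exact hyq
  refine ⟨ι f, eval₂RingHom ι T y, hspan, isRegularPair_of_prime (h.prime hfg hI.isPrime hT) ?_⟩
  intro hdvd
  have hq' : q = Ideal.span {ι f} := by
    rw [hspan]
    apply le_antisymm
    · rw [Ideal.span_le]
      rintro x (rfl | rfl)
      · exact Ideal.mem_span_singleton_self _
      · exact Ideal.mem_span_singleton.mpr hdvd
    · exact Ideal.span_mono (by simp)
  -- `(f)` is not maximal, as `g/f` is neither zero nor invertible modulo `f`
  have hTq : T ∉ q := by
    rw [hq', Ideal.mem_span_singleton]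
    exact h.not_dvd hfg hI.isPrime hT
  obtain ⟨z, i, hzq, hi⟩ := hq.exists_inv hTq
  obtain ⟨Q, rfl⟩ := hsurj z
  rw [hq', Ideal.mem_span_singleton] at hzq
  have h1 : ι f ∣ (1 - Q * X : R[X]).eval₂ ι T := by
    have : (1 - Q * X : R[X]).eval₂ ι T = i := by
      rw [eval₂_sub, eval₂_mul, eval₂_X, eval₂_one, ← coe_eval₂RingHom]
      linear_combination -hi
    rwa [this]
  rw [h.dvd_eval₂_iff hfg hT, Ideal.mem_map_C_iff] at h1
  exact hI.ne_top ((Ideal.eq_top_iff_one _).mpr (by simpa using h1 0))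

end Chart

/-! ### Normality -/

/-- A Nagata-type criterion: if `x` is prime in `S` and `S[1/x]` is a localization of the integrally
closed domain `R ⊆ S`, then `S` is integrally closed. -/
theorem isIntegrallyClosed_of_prime {R S : Type u} [CommRing R] [IsDomain R] [CommRing S]
    [IsDomain S] [IsIntegrallyClosed R] {ι : R →+* S} (hι : Function.Injective ι) {x : R}
    (hx : Prime (ι x)) (h : ∀ z : S, ∃ (n : ℕ) (a : R), ι x ^ n * z = ι a) :
    IsIntegrallyClosed S := by
  let M := Submonoid.powers (ι x)
  have hM : M ≤ nonZeroDivisors S := powers_le_nonZeroDivisors_of_noZeroDivisors hx.ne_zero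
  let Sx := Localization M
  have hSx : IsDomain Sx := IsLocalization.isDomain_localization hM
  have hinj : Function.Injective (algebraMap S Sx) := IsLocalization.injective Sx hM
  let : Algebra R Sx := ((algebraMap S Sx).comp ι).toAlgebra
  have hpow : ∀ n, ι x ^ n ∈ M := fun n => ⟨n, rfl⟩
  have hloc : IsLocalization (Submonoid.powers x) Sx := by
    refine ⟨?_, ?_, ?_⟩
    · rintro ⟨_, n, rfl⟩
      have := IsLocalization.map_units Sx ⟨_, hpow n⟩
      simpa [RingHom.algebraMap_toAlgebra] using this
    · intro w
      obtain ⟨⟨s, ⟨_, m, rfl⟩⟩, hs⟩ := IsLocalization.surj M w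
      obtain ⟨n, a, ha⟩ := h s
      refine ⟨(a, ⟨_, m + n, rfl⟩), ?_⟩
      change w * algebraMap S Sx (ι (x ^ (m + n))) = algebraMap S Sx (ι a)
      rw [← ha, map_mul (algebraMap S Sx), ← hs, map_pow ι, pow_add, map_mul (algebraMap S Sx)]
      ring
    · intro a b hab
      exact ⟨1, by rw [hι (hinj hab)]⟩
  have : IsIntegrallyClosed Sx := isIntegrallyClosed_of_isLocalization (R := R) Sx
    (Submonoid.powers x) (powers_le_nonZeroDivisors_of_noZeroDivisors (by
      rintro rfl; exact hx.ne_zero (map_zero ι)))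
  let K := FractionRing S
  let : Algebra Sx K :=
    IsLocalization.localizationAlgebraOfSubmonoidLe Sx K M (nonZeroDivisors S) hM
  have : IsScalarTower S Sx K :=
    IsLocalization.localization_isScalarTower_of_submonoid_le Sx K M (nonZeroDivisors S) hM
  have := IsFractionRing.isFractionRing_of_isDomain_of_isLocalization M Sx K
  rw [isIntegrallyClosed_iff K]
  intro z hz
  obtain ⟨w, hw⟩ := IsIntegrallyClosed.isIntegral_iff.mp (hz.tower_top (A := Sx))
  -- an element `s / xⁿ` with `x ∤ s` and `n > 0` is not integral, as its equation makes `x` divide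
  -- a power of `s`
  obtain ⟨⟨s, ⟨_, n, rfl⟩⟩, hs⟩ := IsLocalization.surj M w
  have hzs : z * algebraMap S K (ι x) ^ n = algebraMap S K s := by
    have := congrArg (algebraMap Sx K) hs
    rw [map_mul, hw, ← IsScalarTower.algebraMap_apply, ← IsScalarTower.algebraMap_apply] at this
    simpa using this
  clear hs hw w
  have hxK : algebraMap S K (ι x) ≠ 0 :=
    (map_ne_zero_iff _ (IsFractionRing.injective S K)).mpr hx.ne_zero
  induction n generalizing s with
  | zero => exact ⟨s, by simpa using hzs.symm⟩
  | succ n ih =>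
    have hdvd : ι x ∣ s := by
      obtain ⟨p, hp, hpz⟩ := hz
      have h1 : (p.scaleRoots (ι x ^ (n + 1))).eval s = 0 := by
        apply IsFractionRing.injective S K
        have := scaleRoots_eval₂_mul (p := p) (f := algebraMap S K) (r := z) (s := ι x ^ (n + 1))
        rw [hpz, mul_zero, map_pow, mul_comm, hzs] at this
        rw [map_zero, ← this, eval₂_at_apply]
      rw [eval_eq_sum_range, Finset.sum_range_succ, natDegree_scaleRoots,
        coeff_scaleRoots_natDegree, hp.leadingCoeff, one_mul] at h1
      have h2 : ι x ∣ ∑ i ∈ Finset.range p.natDegree,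
          (p.scaleRoots (ι x ^ (n + 1))).coeff i * s ^ i := by
        refine Finset.dvd_sum fun i hi => ?_
        rw [coeff_scaleRoots]
        refine Dvd.dvd.mul_right (Dvd.dvd.mul_left ?_ _) _
        exact dvd_pow (dvd_pow_self _ (by omega)) (by have := Finset.mem_range.mp hi; omega)
      exact hx.dvd_of_dvd_pow ((dvd_add_right h2).mp (h1 ▸ dvd_zero _))
    obtain ⟨t, rfl⟩ := hdvd
    refine ih t (mul_right_cancel₀ hxK ?_)
    rw [map_mul] at hzs
    linear_combination hzs

open IsLocalRing in
/-- A fraction of a Noetherian integrally closed domain that has no pole at the primes of height one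
is regular. -/
theorem exists_algebraMap_eq_of_height_one {R K : Type u} [CommRing R] [IsDomain R]
    [IsNoetherianRing R] [IsIntegrallyClosed R] [Field K] [Algebra R K] [IsFractionRing R K]
    (z : K) (hz : ∀ q : Ideal R, q.IsPrime → q.height = 1 →
      ∃ a s : R, s ∉ q ∧ z * algebraMap R K s = algebraMap R K a) :
    ∃ r : R, algebraMap R K r = z := by
  obtain ⟨a, b, hb, rfl⟩ := IsFractionRing.div_surjective (A := R) z
  have hb0 : b ≠ 0 := nonZeroDivisors.ne_zero hb
  have hbK : algebraMap R K b ≠ 0 := (map_ne_zero_iff _ (IsFractionRing.injective R K)).mpr hb0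
  by_contra! hne
  have ha : (Ideal.Quotient.mk (Ideal.span {b}) a) ≠ 0 := by
    intro h
    rw [Ideal.Quotient.eq_zero_iff_mem, Ideal.mem_span_singleton] at h
    obtain ⟨c, rfl⟩ := h
    exact hne c (by rw [map_mul]; field_simp)
  obtain ⟨P, hP, haP⟩ := exists_le_isAssociatedPrime_of_isNoetherianRing R _ ha
  obtain ⟨hPp, y, hy⟩ := Submodule.isAssociatedPrime_iff.mp hP
  obtain ⟨y, rfl⟩ := Ideal.Quotient.mk_surjective y
  have hmem : ∀ t, t ∈ P ↔ b ∣ t * y := by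
    intro t
    rw [hy, Submodule.mem_colon_singleton, Submodule.mem_bot, Algebra.smul_def,
      Ideal.Quotient.algebraMap_eq, ← map_mul, Ideal.Quotient.eq_zero_iff_mem,
      Ideal.mem_span_singleton]
  have hmem' : ∀ t, b ∣ t * a → t ∈ P := by
    intro t ht
    refine haP ?_
    rwa [Submodule.mem_colon_singleton, Submodule.mem_bot, Algebra.smul_def,
      Ideal.Quotient.algebraMap_eq, ← map_mul, Ideal.Quotient.eq_zero_iff_mem,
      Ideal.mem_span_singleton]
  have hyb : ¬ b ∣ y := fun h => hPp.ne_top ((Ideal.eq_top_iff_one _).mpr ((hmem 1).mpr (by simpa)))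
  have hbP : b ∈ P := (hmem b).mpr (dvd_mul_right _ _)
  -- `w = y / b` satisfies `w P ⊆ R` but `w ∉ R`, hence `w P ⊄ P`
  obtain ⟨p, hp, u, hu, hpu⟩ : ∃ p ∈ P, ∃ u, u ∉ P ∧ p * y = b * u := by
    by_contra! hcon
    have hint : IsIntegral R (algebraMap R K y / algebraMap R K b) := by
      refine isIntegral_of_smul_mem_submodule (R := R) (A := K) (M := K)
        (Submodule.map (Algebra.linearMap R K) P) ?_ ?_ _ ?_
      · intro h
        have : algebraMap R K b ∈ (Submodule.map (Algebra.linearMap R K) P) :=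
          Submodule.mem_map_of_mem hbP
        rw [h] at this
        exact hbK this
      · exact Submodule.FG.map _ (IsNoetherian.noetherian P)
      · rintro _ ⟨p, hp, rfl⟩
        obtain ⟨u, hu⟩ := (hmem p).mp hp
        refine ⟨u, by_contra fun h => hcon p hp u h hu, ?_⟩
        rw [Algebra.linearMap_apply, Algebra.linearMap_apply, smul_eq_mul, div_mul_eq_mul_div,
          eq_div_iff hbK, ← map_mul, ← map_mul, mul_comm u, ← hu, mul_comm]
    obtain ⟨r, hr⟩ := IsIntegrallyClosed.isIntegral_iff.mp hint
    refine hyb ⟨r, IsFractionRing.injective R K ?_⟩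
    rw [map_mul, hr]
    field_simp
  have hheight : P.height = 1 := by
    apply le_antisymm
    · refine Ideal.height_le_one_of_isPrincipal_of_mem_minimalPrimes (Ideal.span {p}) P
        ⟨⟨hPp, by simpa using hp⟩, fun Q ⟨hQ, hpQ⟩ hQP t ht => ?_⟩
      obtain ⟨v, hv⟩ := (hmem t).mp ht
      have : u * t = v * p := mul_left_cancel₀ hb0 (by linear_combination p * hv - t * hpu)
      refine (hQ.mem_or_mem (x := u) (y := t) ?_).resolve_left fun h => hu (hQP h)
      rw [this]
      exact Ideal.mul_mem_left _ _ (hpQ (Ideal.mem_span_singleton_self p))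
    · rw [Order.one_le_iff_ne_zero]
      intro h0
      rw [Ideal.height_eq_zero_iff_eq_bot] at h0
      rw [h0] at hbP
      exact hb0 hbP
  obtain ⟨c, s, hs, hcs⟩ := hz P hPp hheight
  refine hs (hmem' s ⟨c, IsFractionRing.injective R K ?_⟩)
  rw [map_mul, map_mul, ← hcs]
  field_simp

/-- If `(x, y)` had height one, it would be a minimal prime over `(x)`, so that `y` would be a
zero divisor modulo `x`. -/
theorem IsRegularPair.height_ne_one {R : Type u} [CommRing R] [IsDomain R] [IsNoetherianRing R]
    {x y : R} (h : IsRegularPair x y) (hI : (Ideal.span {x, y}).IsPrime) :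
    (Ideal.span {x, y}).height ≠ 1 := by
  intro h1
  have hx : x ∈ Ideal.span {x, y} := Ideal.subset_span (by simp)
  obtain ⟨Q, hQ, hQI⟩ := Ideal.exists_minimalPrimes_le (I := Ideal.span {x})
    (J := Ideal.span {x, y}) (Ideal.span_mono (by simp))
  have hQp : Q.IsPrime := hQ.1.1
  have hxQ : x ∈ Q := hQ.1.2 (Ideal.mem_span_singleton_self x)
  have hQeq : Q = Ideal.span {x, y} := by
    by_contra hne
    have : (Ideal.span {x, y}).FiniteHeight := by simp [Ideal.finiteHeight_iff, h1]
    have h2 := Ideal.height_strict_mono_of_isPrime_of_isPrime (lt_of_le_of_ne hQI hne)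
    rw [h1, Order.lt_one_iff, Ideal.height_eq_zero_iff_eq_bot] at h2
    rw [h2] at hxQ
    exact h.left_ne_zero hxQ
  obtain ⟨s, hs, hn⟩ := Ideal.exists_mul_mem_of_mem_minimalPrimes hQ
    (show y ∈ Q by rw [hQeq]; exact Ideal.subset_span (by simp))
  obtain ⟨c, hc⟩ := Ideal.mem_span_singleton.mp hn
  exact hs (Ideal.mem_span_singleton.mpr (h.symm.dvd s c (by linear_combination hc)))

/-! ### The Rees algebra -/

section Rees

variable {R : Type u} [CommRing R] (I : Ideal R)

/-- The element `a tⁿ` of the Rees algebra. -/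
def reesMonomial (n : ℕ) (a : R) (ha : a ∈ I ^ n) : reesAlgebra I :=
  ⟨monomial n a, reesAlgebra.monomial_mem.mpr ha⟩

theorem reesMonomial_mem {n : ℕ} {a : R} (ha : a ∈ I ^ n) :
    reesMonomial I n a ha ∈ reesGrading I n := ⟨a, rfl⟩

/-- The element `f t` of degree one of the Rees algebra. -/
abbrev reesGenerator {f : R} (hf : f ∈ I) : reesAlgebra I :=
  reesMonomial I 1 f (by simpa using hf)

theorem reesGenerator_mem {f : R} (hf : f ∈ I) : reesGenerator I hf ∈ reesGrading I 1 :=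
  reesMonomial_mem I _

/-- The coordinate ring of the chart `D₊(f t)` of the blow-up. -/
abbrev ReesChart {f : R} (hf : f ∈ I) : Type u :=
  HomogeneousLocalization.Away (reesGrading I) (reesGenerator I hf)

/-- The structure homomorphism of the chart `D₊(f t)`. -/
def reesChartMap {f : R} (hf : f ∈ I) : R →+* ReesChart I hf :=
  (HomogeneousLocalization.fromZeroRingHom (reesGrading I) _).comp
    (algebraMap R (reesGrading I 0))

theorem val_reesChartMap {f : R} (hf : f ∈ I) (r : R) :
    (reesChartMap I hf r).val = algebraMap (reesAlgebra I) _ (algebraMap R (reesAlgebra I) r) :=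
  Localization.mk_one_eq_algebraMap _

theorem reesChartMap_pow_mul_mk {f : R} (hf : f ∈ I) (n : ℕ) (a : R) (ha : a ∈ I ^ n)
    (ha' : reesMonomial I n a ha ∈ reesGrading I (n • 1)) :
    reesChartMap I hf f ^ n * HomogeneousLocalization.Away.mk (reesGrading I)
      (reesGenerator_mem I hf) n (reesMonomial I n a ha) ha' =
      reesChartMap I hf a := by
  have h : (algebraMap R (reesAlgebra I) f) ^ n * reesMonomial I n a ha =
      reesGenerator I hf ^ n * algebraMap R (reesAlgebra I) a := by
    apply Subtype.ext
    change (C f) ^ n * monomial n a = (monomial 1 f) ^ n * C a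
    rw [monomial_pow, one_mul, ← C_pow, C_mul_monomial, monomial_mul_C]
  apply HomogeneousLocalization.val_injective
  rw [HomogeneousLocalization.val_mul, HomogeneousLocalization.val_pow, val_reesChartMap,
    val_reesChartMap, HomogeneousLocalization.Away.val_mk, ← map_pow,
    ← Localization.mk_one_eq_algebraMap, ← Localization.mk_one_eq_algebraMap,
    Localization.mk_mul, Localization.mk_eq_mk_iff,
    Localization.r_iff_exists]
  exact ⟨1, by simpa using h⟩

theorem reesChart_exists_div {f : R} (hf : f ∈ I) (n : ℕ) (a : R) (ha : a ∈ I ^ n) :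
    ∃ z, reesChartMap I hf f ^ n * z = reesChartMap I hf a :=
  ⟨_, reesChartMap_pow_mul_mk I hf n a ha (by simpa using reesMonomial_mem I ha)⟩

theorem reesChart_exists_mul {f : R} (hf : f ∈ I) (z : ReesChart I hf) :
    ∃ (n : ℕ) (a : R), a ∈ I ^ n ∧ reesChartMap I hf f ^ n * z = reesChartMap I hf a := by
  obtain ⟨n, b, hb, rfl⟩ := HomogeneousLocalization.Away.mk_surjective (reesGrading I)
    (reesGenerator_mem I hf) z
  obtain ⟨a, ha⟩ := mem_reesGrading.mp hb
  have hn : n • 1 = n := by simp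
  have haI : a ∈ I ^ n := by
    rw [← reesAlgebra.monomial_mem]
    rw [hn] at ha
    rw [ha]
    exact b.2
  obtain rfl : b = reesMonomial I n a haI := Subtype.ext (by rw [← ha]; simp [reesMonomial])
  exact ⟨n, a, haI, reesChartMap_pow_mul_mk I hf n a haI hb⟩

theorem isDomain_reesChart [IsDomain R] {f : R} (hf : f ∈ I) (hf0 : f ≠ 0) :
    IsDomain (ReesChart I hf) := by
  have : IsDomain (Localization.Away (reesGenerator I hf)) := by
    refine IsLocalization.isDomain_localization (powers_le_nonZeroDivisors_of_noZeroDivisors ?_)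
    intro h
    have := congrArg Subtype.val h
    exact hf0 (by simpa [reesMonomial] using this)
  have hinj := HomogeneousLocalization.val_injective (𝒜 := reesGrading I)
    (Submonoid.powers (reesGenerator I hf))
  have : Nontrivial (ReesChart I hf) := by
    refine ⟨0, 1, fun h => ?_⟩
    have h1 := congrArg HomogeneousLocalization.val h
    rw [HomogeneousLocalization.val_zero, HomogeneousLocalization.val_one] at h1
    exact zero_ne_one h1
  have : NoZeroDivisors (ReesChart I hf) := by
    refine ⟨fun {a b} h => ?_⟩
    have h1 := congrArg HomogeneousLocalization.val h
    rw [HomogeneousLocalization.val_zero, HomogeneousLocalization.val_mul, mul_eq_zero] at h1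
    exact h1.imp (fun h => hinj (by rw [h, HomogeneousLocalization.val_zero]))
      (fun h => hinj (by rw [h, HomogeneousLocalization.val_zero]))
  exact NoZeroDivisors.to_isDomain _

theorem isBlowUpChart_reesChartMap [IsDomain R] {f : R} (hf : f ∈ I) (hf0 : f ≠ 0) :
    IsBlowUpChart I f (reesChartMap I hf) where
  injective := by
    rw [injective_iff_map_eq_zero]
    intro r hr
    have h := congrArg HomogeneousLocalization.val hr
    rw [val_reesChartMap, HomogeneousLocalization.val_zero, map_eq_zero_iff] at h
    · have := congrArg Subtype.val h
      simpa [Algebra.algebraMap_eq_smul_one] using this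
    · refine IsLocalization.injective (M := Submonoid.powers (reesGenerator I hf)) _
        (powers_le_nonZeroDivisors_of_noZeroDivisors ?_)
      intro h
      have := congrArg Subtype.val h
      exact hf0 (by simpa [reesMonomial] using this)
  exists_mul := reesChart_exists_mul I hf
  exists_div := reesChart_exists_div I hf

/-- The charts given by generators of `I` cover the blow-up. -/
theorem irrelevant_le_span_reesGenerator {ι : Type} (s : ι → R) (hs : ∀ i, s i ∈ I)
    (hI : I = Ideal.span (Set.range s)) :
    (HomogeneousIdeal.irrelevant (reesGrading I)).toIdeal ≤
      Ideal.span (Set.range fun i => reesGenerator I (hs i)) := by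
  rw [HomogeneousIdeal.toIdeal_irrelevant_le]
  intro n hn b hb
  obtain ⟨a, ha⟩ := mem_reesGrading.mp hb
  obtain ⟨n, rfl⟩ := Nat.exists_eq_add_one.mpr hn
  have haI : a ∈ I ^ (n + 1) := by
    rw [← reesAlgebra.monomial_mem, ha]
    exact b.2
  obtain rfl : b = reesMonomial I (n + 1) a haI := Subtype.ext ha.symm
  clear ha hb hn
  set J := Ideal.span (Set.range fun i => reesGenerator I (hs i))
  have key : ∀ r (hr : r ∈ I), reesGenerator I hr ∈ J := by
    intro r hr
    have hr' := hr
    rw [hI] at hr'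
    induction hr' using Submodule.span_induction with
    | mem x hx =>
      obtain ⟨i, rfl⟩ := hx
      exact Ideal.subset_span ⟨i, rfl⟩
    | zero =>
      convert! J.zero_mem
      exact Subtype.ext (monomial_zero_right 1)
    | add x y hx hy hx' hy' =>
      rw [← Ideal.span, ← hI] at hx hy
      convert! J.add_mem (hx' hx) (hy' hy)
      exact Subtype.ext ((monomial 1).map_add x y)
    | smul c x hx hx' =>
      rw [← Ideal.span, ← hI] at hx
      convert! J.mul_mem_left (algebraMap R _ c) (hx' hx)
      exact Subtype.ext (C_mul_monomial (n := 1) (a := c) (b := x)).symm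
  have haI' := haI
  rw [pow_succ'] at haI'
  induction haI' using Submodule.mul_induction_on' with
  | mem_mul_mem r hr t ht =>
    convert! J.mul_mem_right (reesMonomial I n t ht) (key r hr)
    apply Subtype.ext
    change monomial (n + 1) (r * t) = monomial 1 r * monomial n t
    rw [monomial_mul_monomial, add_comm]
  | add x hx y hy hx' hy' =>
    rw [← pow_succ'] at hx hy
    convert! J.add_mem (hx' hx) (hy' hy)
    exact Subtype.ext ((monomial (n + 1)).map_add x y)

/-- The blow-up of the unit ideal has a single chart, which is the whole of `Spec R`. -/
theorem bijective_reesChartMap_top :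
    Function.Bijective (reesChartMap (⊤ : Ideal R) (f := 1) Submodule.mem_top) := by
  constructor
  · rw [injective_iff_map_eq_zero]
    intro r hr
    have h := congrArg HomogeneousLocalization.val hr
    rw [val_reesChartMap, HomogeneousLocalization.val_zero,
      IsLocalization.map_eq_zero_iff (Submonoid.powers
        (reesGenerator (⊤ : Ideal R) (f := 1) Submodule.mem_top))]
      at h
    obtain ⟨⟨_, n, rfl⟩, h⟩ := h
    have h1 : (monomial 1 (1 : R)) ^ n * C r = 0 := congrArg Subtype.val h
    rw [monomial_pow, one_pow, one_mul, monomial_mul_C, one_mul, monomial_eq_zero_iff] at h1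
    exact h1
  · intro z
    obtain ⟨n, a, -, ha⟩ := reesChart_exists_mul _ _ z
    refine ⟨a, ha.symm.trans ?_⟩
    rw [map_one]
    exact (congrArg (· * z) (one_pow n)).trans (one_mul z)

/-- The ratio of two generators, as a coordinate on a chart. -/
theorem reesChartMap_mul_isLocalizationElem {f g : R} (hf : f ∈ I) (hg : g ∈ I) :
    reesChartMap I hf f * HomogeneousLocalization.Away.isLocalizationElem
      (reesGenerator_mem I hf) (reesGenerator_mem I hg) = reesChartMap I hf g := by
  have h := reesChartMap_pow_mul_mk I hf 1 g (by simpa using hg) (reesMonomial_mem I _)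
  rw [← h, pow_one (reesChartMap I hf f)]
  congr 1
  apply HomogeneousLocalization.val_injective
  rw [HomogeneousLocalization.Away.val_mk, HomogeneousLocalization.Away.val_mk, pow_one]

end Rees

/-! ### Function fields, orders of vanishing and open immersions -/

theorem ringOrd_ringEquiv {R S : Type u} [CommRing R] [CommRing S] (e : R ≃+* S) (x : R) :
    Ring.ord S (e x) = Ring.ord R x := by
  rw [Ring.ord, Ring.ord, Module.length_quotient, Module.length_quotient,
    ← Order.coheight_orderIso e.symm.idealComapOrderIso]
  congr 1
  change Ideal.span {e x} = Ideal.comap e.symm (Ideal.span {x})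
  rw [← Ideal.map_symm, RingEquiv.symm_symm, Ideal.map_span, Set.image_singleton]

theorem ordFrac_ringEquiv {R S K L : Type u} [CommRing R] [CommRing S] [IsDomain R] [IsDomain S]
    [IsNoetherianRing R] [IsNoetherianRing S] [Ring.KrullDimLE 1 R] [Ring.KrullDimLE 1 S]
    [Field K] [Field L] [Algebra R K] [Algebra S L] [IsFractionRing R K] [IsFractionRing S L]
    (e : R ≃+* S) (φ : K →+* L) (h : ∀ r, φ (algebraMap R K r) = algebraMap S L (e r)) (z : K) :
    Ring.ordFrac S (φ z) = Ring.ordFrac R z := by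
  have key : ∀ r : R, r ≠ 0 →
      Ring.ordFrac S (φ (algebraMap R K r)) = Ring.ordFrac R (algebraMap R K r) := by
    intro r hr
    have hr' : e r ≠ 0 := (map_ne_zero_iff e e.injective).mpr hr
    rw [h, Ring.ordFrac_eq_ord S hr', Ring.ordFrac_eq_ord R hr,
      Ring.ordMonoidWithZeroHom_eq_ord (mem_nonZeroDivisors_of_ne_zero hr'),
      Ring.ordMonoidWithZeroHom_eq_ord (mem_nonZeroDivisors_of_ne_zero hr), ringOrd_ringEquiv]
  obtain ⟨a, b, hb, rfl⟩ := IsFractionRing.div_surjective (A := R) z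
  rw [map_div₀, map_div₀, map_div₀, key b (nonZeroDivisors.ne_zero hb)]
  rcases eq_or_ne a 0 with rfl | ha
  · simp
  · rw [key a ha]

section OpenImmersion

variable {Y X : Scheme.{u}} [IsIntegral Y] [IsIntegral X] (j : Y ⟶ X) [IsOpenImmersion j]

/-- Restriction of rational functions to an open subscheme. -/
def functionFieldIso : X.functionField ≅ Y.functionField :=
  X.presheaf.stalkCongr (.of_eq (genericPoint_eq_of_isOpenImmersion j).symm) ≪≫
    asIso (j.stalkMap (genericPoint Y))

theorem functionFieldIso_germ (U : X.Opens) [Nonempty U] [Nonempty (j ⁻¹ᵁ U)] (u : Γ(X, U)) :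
    (functionFieldIso j).hom (X.germToFunctionField U u) =
      Y.germToFunctionField (j ⁻¹ᵁ U) (j.app U u) := by
  have h : X.germToFunctionField U ≫ (functionFieldIso j).hom =
      j.app U ≫ Y.germToFunctionField (j ⁻¹ᵁ U) := by
    simp only [functionFieldIso, TopCat.Presheaf.stalkCongr, Iso.trans_hom, asIso_hom]
    rw [← Category.assoc]
    exact (congrArg (· ≫ _) (X.presheaf.germ_stalkSpecializes _ _)).trans
      (j.germ_stalkMap U (genericPoint Y) _)
  exact ConcreteCategory.congr_hom h u

theorem functionFieldIso_algebraMap (y : Y) (a : X.presheaf.stalk (j y)) :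
    (functionFieldIso j).hom (algebraMap _ X.functionField a) =
      algebraMap _ Y.functionField (j.stalkMap y a) := by
  have h : X.presheaf.stalkSpecializes (genericPoint_specializes (j y)) ≫
      (functionFieldIso j).hom =
      j.stalkMap y ≫ Y.presheaf.stalkSpecializes (genericPoint_specializes y) := by
    simp only [functionFieldIso, TopCat.Presheaf.stalkCongr, Iso.trans_hom, asIso_hom]
    rw [← Category.assoc]
    exact (congrArg (· ≫ _) (X.presheaf.stalkSpecializes_comp _ _)).trans
      (j.stalkSpecializes_stalkMap (genericPoint Y) y (genericPoint_specializes y))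
  exact ConcreteCategory.congr_hom h a

variable [IsLocallyNoetherian Y] [IsLocallyNoetherian X]

theorem ord_functionFieldIso (y : Y) (g : X.functionField) :
    Scheme.ord ((functionFieldIso j).hom g) y = Scheme.ord g (j y) := by
  by_cases hy : Order.coheight y = 1
  · have hy' : Order.coheight (j y) = 1 := (coheight_eq_of_isOpenImmersion j).trans hy
    rw [Scheme.ord_eq_ordHom_of_coheight_eq_one hy, Scheme.ord_eq_ordHom_of_coheight_eq_one hy']
    congr 2
    have h1 : Ring.KrullDimLE 1 (Y.presheaf.stalk y) := krullDimLE_of_coheight_le hy.le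
    have h2 : Ring.KrullDimLE 1 (X.presheaf.stalk (j y)) := krullDimLE_of_coheight_le hy'.le
    exact ordFrac_ringEquiv (asIso (j.stalkMap y)).commRingCatIsoToRingEquiv
      (functionFieldIso j).hom.hom (functionFieldIso_algebraMap j y) g
  · have hy' : Order.coheight (j y) ≠ 1 := fun h =>
      hy ((coheight_eq_of_isOpenImmersion j).symm.trans h)
    rw [Scheme.ord_eq_zero_of_coheight_neq_one hy, Scheme.ord_eq_zero_of_coheight_neq_one hy']

/-! ### Divisor classes and open immersions -/

/-- The prime divisor of `X` which is the closure of a prime divisor of an open subscheme. -/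
def primeDivisorMap (C : PrimeDivisor Y) : PrimeDivisor X :=
  ⟨j C.1, (coheight_eq_of_isOpenImmersion j).trans C.2⟩

omit [IsIntegral Y] [IsIntegral X] [IsLocallyNoetherian Y] [IsLocallyNoetherian X] in
theorem primeDivisorMap_injective : Function.Injective (primeDivisorMap j) := fun _ _ h =>
  Subtype.ext (j.isOpenEmbedding.injective (congrArg Subtype.val h))

omit [IsIntegral Y] [IsIntegral X] [IsLocallyNoetherian Y] [IsLocallyNoetherian X] in
theorem exists_primeDivisorMap_eq {C : PrimeDivisor X} (hC : C.1 ∈ Set.range j) :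
    ∃ C', primeDivisorMap j C' = C := by
  obtain ⟨y, hy⟩ := hC
  refine ⟨⟨y, ?_⟩, Subtype.ext hy⟩
  rw [← coheight_eq_of_isOpenImmersion j]
  exact (congrArg Order.coheight hy).trans C.2

/-- Restriction of divisors to an open subscheme. -/
def divisorRestrict : Divisor X →+ Divisor Y :=
  Finsupp.comapDomain.addMonoidHom (primeDivisorMap_injective j)

omit [IsIntegral Y] [IsIntegral X] [IsLocallyNoetherian Y] [IsLocallyNoetherian X] in
theorem divisorRestrict_apply (D : Divisor X) (C : PrimeDivisor Y) :
    divisorRestrict j D C = D (primeDivisorMap j C) := rfl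

omit [IsIntegral Y] [IsIntegral X] [IsLocallyNoetherian Y] [IsLocallyNoetherian X] in
theorem divisorRestrict_surjective : Function.Surjective (divisorRestrict j) := fun D =>
  ⟨D.mapDomain (primeDivisorMap j), Finsupp.ext fun C => by
    rw [divisorRestrict_apply, Finsupp.mapDomain_apply (primeDivisorMap_injective j)]⟩

theorem divisorRestrict_mem {D : Divisor X} (hD : D ∈ principalDivisors X) :
    divisorRestrict j D ∈ principalDivisors Y := by
  obtain ⟨g, hg, hD⟩ := hD
  refine ⟨(functionFieldIso j).hom g, ?_, fun C => ?_⟩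
  · exact (map_ne_zero_iff (functionFieldIso j).hom.hom
      (functionFieldIso j).commRingCatIsoToRingEquiv.injective).mpr hg
  · rw [divisorRestrict_apply, hD, ord_functionFieldIso]
    rfl

theorem exists_of_divisorRestrict_mem {D : Divisor X}
    (hD : divisorRestrict j D ∈ principalDivisors Y) :
    ∃ g : X.functionField, g ≠ 0 ∧
      ∀ C : PrimeDivisor X, C.1 ∈ Set.range j → D C = Scheme.ord g C.1 := by
  obtain ⟨g, hg, hD⟩ := hD
  obtain ⟨g, rfl⟩ := (functionFieldIso j).commRingCatIsoToRingEquiv.surjective g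
  refine ⟨g, fun h => hg (by rw [h, map_zero]), fun C hC => ?_⟩
  obtain ⟨C, rfl⟩ := exists_primeDivisorMap_eq j hC
  rw [← divisorRestrict_apply, hD]
  exact ord_functionFieldIso j C.1 g

/-- The divisor class group of `X` is torsion-free and generated by `r` elements. -/
structure IsClassGroupBounded (r : ℕ) (X : Scheme.{u}) [IsIntegral X] [IsLocallyNoetherian X] :
    Prop where
  torsionFree : ∀ (m : ℤ) (D : Divisor X), m ≠ 0 → m • D ∈ principalDivisors X →
    D ∈ principalDivisors X
  generators : ∃ c : Fin r → Divisor X, ∀ D, ∃ z : Fin r → ℤ,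
    D - ∑ i, z i • c i ∈ principalDivisors X

/-- Removing a closed subset of codimension at least two does not change the class group. -/
theorem IsClassGroupBounded.restrict {r : ℕ} (h : IsClassGroupBounded r X)
    (hj : ∀ C : PrimeDivisor X, C.1 ∈ Set.range j) : IsClassGroupBounded r Y where
  torsionFree m D hm hD := by
    obtain ⟨D, rfl⟩ := divisorRestrict_surjective j D
    rw [← map_zsmul] at hD
    obtain ⟨g, hg, hgD⟩ := exists_of_divisorRestrict_mem j hD
    exact divisorRestrict_mem j (h.torsionFree m D hm ⟨g, hg, fun C => hgD C (hj C)⟩)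
  generators := by
    obtain ⟨c, hc⟩ := h.generators
    refine ⟨fun i => divisorRestrict j (c i), fun D => ?_⟩
    obtain ⟨D, rfl⟩ := divisorRestrict_surjective j D
    obtain ⟨z, hz⟩ := hc D
    refine ⟨z, ?_⟩
    simpa only [map_sub, map_sum, map_zsmul] using divisorRestrict_mem j hz

/-- Excision: if a single prime divisor `E` lies outside of the open subscheme `Y`, and no nonzero
multiple of `E` is principal, then the class group of `X` is an extension of that of `Y` by the
infinite cyclic group generated by `E`. -/
theorem IsClassGroupBounded.extend {r : ℕ} (h : IsClassGroupBounded r Y) (E : PrimeDivisor X)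
    (hj : ∀ C : PrimeDivisor X, C.1 ∉ Set.range j → C = E) (hjE : E.1 ∉ Set.range j)
    (hE : ∀ m : ℤ, m • Finsupp.single E 1 ∈ principalDivisors X → m = 0) :
    IsClassGroupBounded (r + 1) X := by
  have key : ∀ D : Divisor X, divisorRestrict j D ∈ principalDivisors Y →
      ∃ a : ℤ, D - a • Finsupp.single E 1 ∈ principalDivisors X := by
    intro D hD
    obtain ⟨g, hg, hgD⟩ := exists_of_divisorRestrict_mem j hD
    refine ⟨D E - Scheme.ord g E.1, g, hg, fun C => ?_⟩
    by_cases hC : C.1 ∈ Set.range j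
    · have hCE : E ≠ C := by rintro rfl; exact hjE hC
      simp [hgD C hC, Finsupp.single_eq_of_ne' hCE]
    · obtain rfl := hj C hC
      simp
  constructor
  · intro m D hm hD
    obtain ⟨a, ha⟩ := key D (h.torsionFree m _ hm (by
      rw [← map_zsmul]
      exact divisorRestrict_mem j hD))
    have h1 := sub_mem hD (zsmul_mem ha m)
    rw [smul_sub, sub_sub_cancel, smul_smul] at h1
    obtain rfl : a = 0 := (mul_eq_zero.mp (hE _ h1)).resolve_left hm
    simpa using ha
  · obtain ⟨c, hc⟩ := h.generators
    choose d hd using fun i => divisorRestrict_surjective j (c i)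
    refine ⟨Fin.cons (Finsupp.single E 1) d, fun D => ?_⟩
    obtain ⟨z, hz⟩ := hc (divisorRestrict j D)
    obtain ⟨a, ha⟩ := key (D - ∑ i, z i • d i) (by
      simpa only [map_sub, map_sum, map_zsmul, hd] using hz)
    refine ⟨Fin.cons a z, ?_⟩
    rw [Fin.sum_univ_succ]
    simp only [Fin.cons_zero, Fin.cons_succ]
    rwa [add_comm, ← sub_sub]

end OpenImmersion

/-! ### Rational functions without zeros and poles -/

section Normal

variable {X : Scheme.{u}} [IsIntegral X] [IsLocallyNoetherian X]

theorem isDiscreteValuationRing_stalk {x : X} (hx : Order.coheight x = 1)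
    [IsIntegrallyClosed (X.presheaf.stalk x)] : IsDiscreteValuationRing (X.presheaf.stalk x) := by
  have h1 : Ring.KrullDimLE 1 (X.presheaf.stalk x) := krullDimLE_of_coheight_le hx.le
  have hfield : ¬ IsField (X.presheaf.stalk x) := fun h => by
    have := ringKrullDim_eq_zero_of_isField h
    rw [ringKrullDim_stalk_eq_coheight, hx] at this
    exact one_ne_zero (α := ℕ∞) (WithBot.coe_injective this)
  refine ((IsDiscreteValuationRing.TFAE (X.presheaf.stalk x) hfield).out 0 2).mpr ?_
  have : Ring.DimensionLEOne (X.presheaf.stalk x) :=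
    ⟨fun {p} hp hpp => (Ring.krullDimLE_one_iff_of_noZeroDivisors.mp h1 p hp hpp)⟩
  exact {}

theorem exists_isUnit_stalk_of_ord_eq_zero {x : X} (hx : Order.coheight x = 1)
    [IsIntegrallyClosed (X.presheaf.stalk x)] {g : X.functionField} (hg : g ≠ 0)
    (h : Scheme.ord g x = 0) :
    ∃ a : X.presheaf.stalk x, IsUnit a ∧ algebraMap _ X.functionField a = g := by
  have := isDiscreteValuationRing_stalk hx
  have h1 : Ring.KrullDimLE 1 (X.presheaf.stalk x) := krullDimLE_of_coheight_le hx.le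
  rw [Scheme.ord_eq_iff hx hg] at h
  obtain ⟨u, hu⟩ := Ring.associated_of_ordFrac_eq (R := X.presheaf.stalk x) 1 g (by
    rw [map_one]
    exact h.symm)
  exact ⟨u, u.isUnit, by rw [← hu, Units.smul_def, Algebra.smul_def, mul_one]⟩

omit [IsIntegral X] [IsLocallyNoetherian X] in
theorem coheight_fromSpec {U : X.Opens} (hU : IsAffineOpen U) (q : PrimeSpectrum Γ(X, U)) :
    Order.coheight (hU.fromSpec q) = q.asIdeal.height :=
  (coheight_eq_of_isOpenImmersion hU.fromSpec).trans (idealHeight_eq_coheight _ _).symm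

/-- On a normal affine open subset a rational function without zeros and poles is an invertible
regular function. -/
theorem exists_isUnit_of_ord_eq_zero {U : X.Opens} (hU : IsAffineOpen U) [Nonempty U]
    [IsIntegrallyClosed Γ(X, U)] {g : X.functionField} (hg : g ≠ 0)
    (h : ∀ x ∈ U, Scheme.ord g x = 0) :
    ∃ u : Γ(X, U), IsUnit u ∧ X.germToFunctionField U u = g := by
  have hfrac := functionField_isFractionRing_of_isAffineOpen X U hU
  have hnoeth : IsNoetherianRing Γ(X, U) := IsLocallyNoetherian.component_noetherian ⟨U, hU⟩
  have key : ∀ g : X.functionField, g ≠ 0 → (∀ x ∈ U, Scheme.ord g x = 0) →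
      ∃ u : Γ(X, U), algebraMap _ X.functionField u = g := by
    intro g hg h
    refine exists_algebraMap_eq_of_height_one g fun q hq hq1 => ?_
    let y : PrimeSpectrum Γ(X, U) := ⟨q, hq⟩
    have hy : hU.fromSpec y ∈ U := by
      rw [← SetLike.mem_coe, ← hU.range_fromSpec]
      exact Set.mem_range_self _
    have hcy : Order.coheight (hU.fromSpec y) = 1 := (coheight_fromSpec hU y).trans hq1
    let _ : Algebra Γ(X, U) (X.presheaf.stalk (hU.fromSpec y)) :=
      TopCat.Presheaf.algebra_section_stalk X.presheaf (⟨_, hy⟩ : U)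
    have hloc : IsLocalization.AtPrime (X.presheaf.stalk (hU.fromSpec y)) q :=
      hU.isLocalization_stalk' y hy
    have : IsIntegrallyClosed (X.presheaf.stalk (hU.fromSpec y)) :=
      isIntegrallyClosed_of_isLocalization _ q.primeCompl q.primeCompl_le_nonZeroDivisors
    have htower : IsScalarTower Γ(X, U) (X.presheaf.stalk (hU.fromSpec y)) X.functionField :=
      functionField_isScalarTower X U ⟨_, hy⟩
    obtain ⟨a, -, ha⟩ := exists_isUnit_stalk_of_ord_eq_zero hcy hg (h _ hy)
    obtain ⟨⟨r, s⟩, hrs⟩ := IsLocalization.surj q.primeCompl a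
    refine ⟨r, s, s.2, ?_⟩
    have h1 := congrArg (algebraMap (X.presheaf.stalk (hU.fromSpec y)) X.functionField) hrs
    rwa [map_mul, ha, ← IsScalarTower.algebraMap_apply, ← IsScalarTower.algebraMap_apply] at h1
  obtain ⟨u, hu⟩ := key g hg h
  obtain ⟨v, hv⟩ := key g⁻¹ (inv_ne_zero hg) fun x hx => by
    have h1 := Scheme.ord_mul (x := x) hg (inv_ne_zero hg)
    have h2 := Scheme.ord_mul (x := x) (one_ne_zero (α := X.functionField)) one_ne_zero
    rw [mul_inv_cancel₀ hg] at h1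
    rw [mul_one] at h2
    have := h x hx
    linarith
  refine ⟨u, IsUnit.of_mul_eq_one v ?_, hu⟩
  apply IsFractionRing.injective Γ(X, U) X.functionField
  rw [map_mul, hu, hv, mul_inv_cancel₀ hg, map_one]

/-- All divisors on the spectrum of a factorial ring are principal. -/
theorem isClassGroupBounded_spec (R : CommRingCat.{u}) [IsDomain R] [IsNoetherianRing R]
    [UniqueFactorizationMonoid R] : IsClassGroupBounded 0 (Spec R) := by
  have h : ∀ D : Divisor (Spec R), D ∈ principalDivisors (Spec R) := by
    intro D
    induction D using Finsupp.induction_linear with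
    | zero => exact zero_mem _
    | add D E hD hE => exact add_mem hD hE
    | single P n =>
      suffices h : Finsupp.single P 1 ∈ principalDivisors (Spec R) by
        have := zsmul_mem h n
        rwa [Finsupp.smul_single, smul_eq_mul, mul_one] at this
      have hP : P.1.asIdeal.height = 1 := (idealHeight_eq_coheight R P.1).trans P.2
      have hp := P.1.isPrime
      obtain ⟨ϖ, hϖ⟩ := (UniqueFactorizationMonoid.isPrincipal_of_height_eq_one hP).principal
      have hϖ0 : ϖ ≠ 0 := by
        rintro rfl
        refine Ideal.ne_bot_of_height_eq_one hP ?_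
        rw [hϖ]
        simp
      refine ⟨algebraMap R _ ϖ, ?_, fun Q => ?_⟩
      · exact (map_ne_zero_iff _ (IsFractionRing.injective R (Spec R).functionField)).mpr hϖ0
      have hq := Q.1.isPrime
      let _ : Algebra R ((Spec R).presheaf.stalk Q.1) := StructureSheaf.stalkAlgebra R Q.1
      have hK : ∀ r : R, algebraMap ((Spec R).presheaf.stalk Q.1) (Spec R).functionField
          (algebraMap R _ r) = algebraMap R _ r := fun r =>
        ConcreteCategory.congr_hom
          (StructureSheaf.toStalk_stalkSpecializes (genericPoint_specializes Q.1)) r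
      have hloc : IsLocalization.AtPrime ((Spec R).presheaf.stalk Q.1) Q.1.asIdeal :=
        StructureSheaf.IsLocalization.to_stalk R Q.1
      have : Ring.KrullDimLE 1 ((Spec R).presheaf.stalk Q.1) := krullDimLE_of_coheight_le Q.2.le
      have hϖK : algebraMap R (Spec R).functionField ϖ ≠ 0 :=
        (map_ne_zero_iff _ (IsFractionRing.injective R (Spec R).functionField)).mpr hϖ0
      symm
      by_cases hQP : P = Q
      · subst hQP
        have : IsIntegrallyClosed ((Spec R).presheaf.stalk P.1) :=
          isIntegrallyClosed_of_isLocalization _ P.1.asIdeal.primeCompl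
            P.1.asIdeal.primeCompl_le_nonZeroDivisors
        have := isDiscreteValuationRing_stalk P.2
        rw [Finsupp.single_eq_same, Scheme.ord_eq_iff P.2 hϖK, ← hK]
        refine Ring.ordFrac_irreducible ?_
        rw [IsDiscreteValuationRing.irreducible_iff_uniformizer,
          ← IsLocalization.AtPrime.map_eq_maximalIdeal P.1.asIdeal, hϖ, Ideal.submodule_span_eq,
          Ideal.map_span, Set.image_singleton]
      · rw [Finsupp.single_eq_of_ne' hQP, Scheme.ord_eq_iff Q.2 hϖK, ← hK]
        refine Ring.ordFrac_of_isUnit ((IsLocalization.AtPrime.isUnit_to_map_iff _ Q.1.asIdeal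
          ϖ).mpr fun hϖQ => hQP (Subtype.ext (PrimeSpectrum.ext ?_)))
        have hle : P.1.asIdeal ≤ Q.1.asIdeal := by
          rw [hϖ, Ideal.submodule_span_eq, Ideal.span_singleton_le_iff_mem]
          exact hϖQ
        by_contra hne
        have hQ : Q.1.asIdeal.height = 1 := (idealHeight_eq_coheight R Q.1).trans Q.2
        have : Q.1.asIdeal.FiniteHeight := by simp [Ideal.finiteHeight_iff, hQ]
        have := Ideal.height_strict_mono_of_isPrime_of_isPrime (lt_of_le_of_ne hle hne)
        rw [hP, hQ] at this
        exact lt_irrefl _ this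
  exact ⟨fun _ D _ _ => h D, Fin.elim0, fun D => ⟨Fin.elim0, h _⟩⟩

end Normal

/-! ### Charts of a blow-up -/

section BlowUp

theorem awayι_projStructure {R : Type u} [CommRing R] (I : Ideal R) {f : R} (hf : f ∈ I) :
    Proj.awayι (reesGrading I) (reesGenerator I hf) (reesGenerator_mem I hf) one_pos ≫
      projStructure (reesGrading I) =
      Spec.map (CommRingCat.ofHom (reesChartMap I hf)) := by
  rw [projStructure, Proj.awayι_toSpecZero_assoc, ← Spec.map_comp, ← CommRingCat.ofHom_comp]
  rfl

theorem isIso_ofHom_of_bijective {A B : Type u} [CommRing A] [CommRing B] (φ : A →+* B)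
    (hφ : Function.Bijective φ) : IsIso (CommRingCat.ofHom φ) :=
  (RingEquiv.ofBijective φ hφ).toCommRingCatIso.isIso_hom

theorem isIso_projStructure_top {R : Type u} [CommRing R] :
    IsIso (projStructure (reesGrading (⊤ : Ideal R))) := by
  have h1 := awayι_projStructure (⊤ : Ideal R) (f := 1) Submodule.mem_top
  have h2 : IsIso (Spec.map (CommRingCat.ofHom
      (reesChartMap (⊤ : Ideal R) (f := 1) Submodule.mem_top))) := by
    have := isIso_ofHom_of_bijective _ (bijective_reesChartMap_top (R := R))
    infer_instance
  have h3 : IsIso (Proj.awayι (reesGrading (⊤ : Ideal R)) (reesGenerator ⊤ (f := 1)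
      Submodule.mem_top) (reesGenerator_mem _ _) one_pos) := by
    refine isIso_of_isOpenImmersion_of_opensRange_eq_top _ ?_
    have h := Proj.iSup_basicOpen_eq_top (reesGrading (⊤ : Ideal R)) _
      (irrelevant_le_span_reesGenerator (⊤ : Ideal R) (fun _ : Unit => (1 : R))
        (fun _ => Submodule.mem_top) (by simp))
    rw [iSup_unique] at h
    rw [Proj.opensRange_awayι]
    exact h
  rw [← h1] at h2
  exact IsIso.of_isIso_comp_left (Proj.awayι (reesGrading (⊤ : Ideal R)) (reesGenerator ⊤ (f := 1)
      Submodule.mem_top) (reesGenerator_mem _ _) one_pos) _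

variable {X' X : Scheme.{u}} {π : X' ⟶ X} {p : X}

/-- Over an affine open subset without `p` the ideal of `p` is the unit ideal by convention, and
its blow-up is trivial. -/
theorem IsBlowUpAt.isIso_morphismRestrict (h : IsBlowUpAt π p) {W : X.Opens}
    (hW : IsAffineOpen W) (hp : p ∉ W) : IsIso (π ∣_ W) := by
  obtain ⟨e, he⟩ := h W hW
  have hI : pointIdeal p W = ⊤ := by
    simp [pointIdeal, hp]
  have : IsIso (projStructure (reesGrading (pointIdeal p W))) := by
    rw [hI]
    exact isIso_projStructure_top
  have h2 : IsIso ((π ∣_ W) ≫ hW.isoSpec.hom) := by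
    rw [← he]
    infer_instance
  exact IsIso.of_isIso_comp_right _ hW.isoSpec.hom

/-- Outside of its centre a blow-up is an isomorphism. -/
theorem IsBlowUpAt.isOpenImmersion_comp (h : IsBlowUpAt π p) (V : X.Opens) (hp : p ∉ V) :
    IsOpenImmersion ((π ⁻¹ᵁ V).ι ≫ π) := by
  refine IsZariskiLocalAtTarget.of_range_subset_iSup (P := @IsOpenImmersion)
    (fun W : {W : X.affineOpens // W.1 ≤ V} => W.1.1) ?_ ?_
  · rintro _ ⟨y, rfl⟩
    have hy : π y.1 ∈ V := y.2
    obtain ⟨W, hW, hyW, hWV⟩ := exists_isAffineOpen_mem_and_subset hy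
    exact TopologicalSpace.Opens.mem_iSup.mpr ⟨⟨⟨W, hW⟩, hWV⟩, hyW⟩
  · rintro ⟨⟨W, hW⟩, hWV⟩
    have := h.isIso_morphismRestrict hW (fun hpW => hp (hWV hpW))
    rw [morphismRestrict_comp]
    have h1 : IsOpenImmersion ((π ⁻¹ᵁ V).ι ∣_ π ⁻¹ᵁ W) := inferInstance
    have h2 : IsOpenImmersion (π ∣_ W) := inferInstance
    exact @IsOpenImmersion.comp _ _ _ _ _ h1 h2

theorem IsBlowUpAt.exists_eq (h : IsBlowUpAt π p) {x : X} (hx : x ≠ p)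
    (hp : IsClosed ({p} : Set X)) : ∃ x' : X', π x' = x := by
  let V : X.Opens := ⟨{p}ᶜ, hp.isOpen_compl⟩
  obtain ⟨W, hW, hyW, hWV⟩ := exists_isAffineOpen_mem_and_subset (show x ∈ V from hx)
  have := h.isIso_morphismRestrict hW (fun hpW => hWV hpW rfl)
  have hs : Function.Surjective (π ∣_ W) := (π ∣_ W).homeomorph.surjective
  obtain ⟨x', hx'⟩ := hs ⟨x, hyW⟩
  exact ⟨x'.1, by rw [← morphismRestrict_base_coe, hx']⟩

/-- Transport of the charts `a i` of `P` along an isomorphism of `P` with `π ⁻¹ᵁ U` over `U ≅ B`. -/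
theorem exists_charts_of_iso {X' X P B : Scheme.{u}} (π : X' ⟶ X) (U : X.Opens)
    (e : (π ⁻¹ᵁ U).toScheme ≅ P) (φ : U.toScheme ≅ B) (st : P ⟶ B)
    (he : e.hom ≫ st = (π ∣_ U) ≫ φ.hom) {ι : Type} (Z : ι → Scheme.{u}) (a : ∀ i, Z i ⟶ P)
    [∀ i, IsOpenImmersion (a i)] (ha : ∀ y, ∃ i, y ∈ Set.range (a i)) :
    ∃ c : ∀ i, Z i ⟶ X', (∀ i, IsOpenImmersion (c i)) ∧
      (∀ i, c i ≫ π = (a i ≫ st) ≫ φ.inv ≫ U.ι) ∧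
      (∀ x', π x' ∈ U → ∃ i, x' ∈ Set.range (c i)) ∧
      ∀ i j, ∀ q, a i q ∈ Set.range (a j) → c i q ∈ Set.range (c j) := by
  refine ⟨fun i => a i ≫ e.inv ≫ (π ⁻¹ᵁ U).ι, fun i => inferInstance, fun i => ?_, ?_, ?_⟩
  · have h1 : e.inv ≫ (π ⁻¹ᵁ U).ι ≫ π = st ≫ φ.inv ≫ U.ι := by
      rw [← morphismRestrict_ι, Iso.inv_comp_eq, reassoc_of% he, Iso.hom_inv_id_assoc]
    simp only [Category.assoc, h1]
  · intro x' hx'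
    obtain ⟨i, q, hq⟩ := ha (e.hom ⟨x', hx'⟩)
    refine ⟨i, q, ?_⟩
    rw [Scheme.Hom.comp_apply, Scheme.Hom.comp_apply, hq]
    have h := Scheme.hom_inv_apply e ⟨x', hx'⟩
    rw [h]
    rfl
  · rintro i j q ⟨q', hq'⟩
    exact ⟨q', by simp only [Scheme.Hom.comp_apply, hq']⟩

/-- The charts of `Proj (⨁ Iⁿ)` given by generators `s i` of `I`; the last clause says that the
part of the chart of `s i` where `s j / s i` does not vanish lies in the chart of `s j`. -/
theorem exists_reesCharts {X' X : Scheme.{u}} (π : X' ⟶ X) {U : X.Opens} (hU : IsAffineOpen U)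
    (I : Ideal Γ(X, U)) (e : (π ⁻¹ᵁ U).toScheme ≅ Proj (reesGrading I))
    (he : e.hom ≫ projStructure (reesGrading I) = (π ∣_ U) ≫ hU.isoSpec.hom)
    {ι : Type} (s : ι → Γ(X, U)) (hs : ∀ i, s i ∈ I) (hI : I = Ideal.span (Set.range s)) :
    ∃ c : ∀ i, Spec (.of (ReesChart I (hs i))) ⟶ X',
      (∀ i, IsOpenImmersion (c i)) ∧
      (∀ i, c i ≫ π = Spec.map (CommRingCat.ofHom (reesChartMap _ (hs i))) ≫ hU.fromSpec) ∧
      (∀ x', π x' ∈ U → ∃ i, x' ∈ Set.range (c i)) ∧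
      ∀ i j, ∀ q : Spec (.of (ReesChart I (hs i))),
        HomogeneousLocalization.Away.isLocalizationElem (reesGenerator_mem _ (hs i))
          (reesGenerator_mem _ (hs j)) ∉ q.asIdeal → c i q ∈ Set.range (c j) := by
  have ha : ∀ i, Set.range (Proj.awayι (reesGrading I) (reesGenerator I (hs i))
      (reesGenerator_mem I (hs i)) one_pos) =
      Proj.basicOpen (reesGrading I) (reesGenerator I (hs i)) := by
    intro i
    rw [← Proj.opensRange_awayι _ _ (reesGenerator_mem I (hs i)) one_pos]
    rfl
  obtain ⟨c, hc1, hc2, hc3, hc4⟩ := exists_charts_of_iso π U e hU.isoSpec _ he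
    (fun i => Spec (.of (ReesChart I (hs i))))
    (fun i => Proj.awayι (reesGrading I) (reesGenerator I (hs i)) (reesGenerator_mem I (hs i))
      one_pos) (by
      intro y
      have h1 := Proj.iSup_basicOpen_eq_top (reesGrading I) _
        (irrelevant_le_span_reesGenerator I s hs hI)
      have h2 : y ∈ (⊤ : (Proj (reesGrading I)).Opens) := trivial
      rw [← h1, TopologicalSpace.Opens.mem_iSup] at h2
      obtain ⟨i, hi⟩ := h2
      rw [← SetLike.mem_coe, ← ha] at hi
      exact ⟨i, hi⟩)
  refine ⟨c, hc1, fun i => ?_, hc3, fun i j q hq => hc4 i j q ?_⟩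
  · rw [hc2, awayι_projStructure]
    rfl
  · rw [ha]
    have h2 := Proj.awayι_preimage_basicOpen (reesGrading I) (reesGenerator_mem I (hs i)) one_pos
      (reesGenerator_mem I (hs j)) one_pos
    have h3 : q ∈ Proj.awayι (reesGrading I) (reesGenerator I (hs i)) (reesGenerator_mem I (hs i))
        one_pos ⁻¹ᵁ Proj.basicOpen (reesGrading I) (reesGenerator I (hs j)) := by
      rw [h2]
      exact hq
    exact h3

/-- The affine charts of a blow-up over an affine open subset. -/
theorem IsBlowUpAt.exists_charts (h : IsBlowUpAt π p) {U : X.Opens} (hU : IsAffineOpen U)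
    {ι : Type} (s : ι → Γ(X, U)) (hs : ∀ i, s i ∈ pointIdeal p U)
    (hI : pointIdeal p U = Ideal.span (Set.range s)) :
    ∃ c : ∀ i, Spec (.of (ReesChart (pointIdeal p U) (hs i))) ⟶ X',
      (∀ i, IsOpenImmersion (c i)) ∧
      (∀ i, c i ≫ π = Spec.map (CommRingCat.ofHom (reesChartMap _ (hs i))) ≫ hU.fromSpec) ∧
      (∀ x', π x' ∈ U → ∃ i, x' ∈ Set.range (c i)) ∧
      ∀ i j, ∀ q : Spec (.of (ReesChart (pointIdeal p U) (hs i))),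
        HomogeneousLocalization.Away.isLocalizationElem (reesGenerator_mem _ (hs i))
          (reesGenerator_mem _ (hs j)) ∉ q.asIdeal → c i q ∈ Set.range (c j) := by
  obtain ⟨e, he⟩ := h U hU
  exact exists_reesCharts π hU _ e he s hs hI

end BlowUp

/-! ### Regular points -/

/-- A point whose ideal, in some affine open neighbourhood, is generated by a regular pair. -/
def IsRegularPoint (X : Scheme.{u}) (p : X) : Prop :=
  ∃ (R : CommRingCat.{u}) (c : Spec R ⟶ X) (_ : IsOpenImmersion c) (z : Spec R), c z = p ∧
    ∃ x y : R, z.asIdeal = Ideal.span {x, y} ∧ IsRegularPair x y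

theorem IsRegularPoint.map {X Y : Scheme.{u}} (j : Y ⟶ X) [IsOpenImmersion j] {y : Y}
    (h : IsRegularPoint Y y) : IsRegularPoint X (j y) := by
  obtain ⟨R, c, hc, z, rfl, hz⟩ := h
  exact ⟨R, c ≫ j, inferInstance, z, Scheme.Hom.comp_apply _ _ _, hz⟩

theorem IsRegularPair.map_away {R : Type u} [CommRing R] [IsDomain R] {x y g : R}
    (h : IsRegularPair x y) (hg : g ≠ 0) :
    IsRegularPair (algebraMap R (Localization.Away g) x)
      (algebraMap R (Localization.Away g) y) := by
  have hinj : Function.Injective (algebraMap R (Localization.Away g)) :=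
    IsLocalization.injective _ (powers_le_nonZeroDivisors_of_noZeroDivisors hg)
  have hunit : ∀ n : ℕ, IsUnit (algebraMap R (Localization.Away g) (g ^ n)) := fun n => by
    rw [map_pow]
    exact (IsLocalization.Away.algebraMap_isUnit g).pow n
  refine ⟨fun h0 => h.left_ne_zero ?_, fun h0 => h.right_ne_zero ?_, fun a b hab => ?_⟩
  · rwa [map_eq_zero_iff _ hinj] at h0
  · rwa [map_eq_zero_iff _ hinj] at h0
  · obtain ⟨n, a', ha⟩ := IsLocalization.Away.surj g a
    obtain ⟨m, b', hb⟩ := IsLocalization.Away.surj g b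
    rw [← map_pow] at ha hb
    have h1 : (g ^ m * a') * x = (g ^ n * b') * y := by
      apply hinj
      simp only [map_mul, ← ha, ← hb]
      linear_combination (algebraMap R (Localization.Away g) (g ^ m)) *
        (algebraMap R (Localization.Away g) (g ^ n)) * hab
    have h2 := map_dvd (algebraMap R (Localization.Away g)) (h.dvd _ _ h1)
    rw [map_mul, ← ha] at h2
    rwa [IsUnit.dvd_mul_left (hunit m), IsUnit.dvd_mul_right (hunit n)] at h2

theorem IsRegularPoint.of_map {X Y : Scheme.{u}} [IsIntegral X] (j : Y ⟶ X) [IsOpenImmersion j]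
    {y : Y} (h : IsRegularPoint X (j y)) : IsRegularPoint Y y := by
  obtain ⟨R, c, hc, z, hz, a, b, hzab, hab⟩ := h
  have : Nonempty (Spec R) := ⟨z⟩
  have hint : IsIntegral (Spec R) := isIntegral_of_isOpenImmersion c
  have : IsDomain R := (affine_isIntegral_iff R).mp hint
  obtain ⟨_, ⟨g, rfl⟩, hzg, hg⟩ :=
    PrimeSpectrum.isTopologicalBasis_basic_opens.exists_subset_of_mem_open
    (show z ∈ c ⁻¹ᵁ j.opensRange from ⟨y, hz.symm⟩) (c ⁻¹ᵁ j.opensRange).2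
  have hg0 : g ≠ 0 := by
    rintro rfl
    exact hzg (zero_mem _)
  let i : Spec (.of (Localization.Away g)) ⟶ Spec R :=
    Spec.map (CommRingCat.ofHom (algebraMap R (Localization.Away g)))
  have hi : Set.range i = (PrimeSpectrum.basicOpen g : Set (PrimeSpectrum R)) :=
    PrimeSpectrum.localization_away_comap_range (Localization.Away g) g
  have hio : IsOpenImmersion i := inferInstance
  have hr : Set.range (i ≫ c) ⊆ Set.range j := by
    rintro _ ⟨w, rfl⟩
    rw [Scheme.Hom.comp_apply]
    exact hg (hi.subset (Set.mem_range_self w))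
  let l := IsOpenImmersion.lift j (i ≫ c) hr
  have hl : l ≫ j = i ≫ c := IsOpenImmersion.lift_fac _ _ _
  have : IsOpenImmersion (l ≫ j) := hl ▸ inferInstance
  have hlo : IsOpenImmersion l := IsOpenImmersion.of_comp l j
  obtain ⟨w, hw⟩ : z ∈ Set.range i := hi.superset hzg
  refine ⟨_, l, hlo, w, j.isOpenEmbedding.injective ?_, _, _, ?_, hab.map_away hg0⟩
  · rw [← Scheme.Hom.comp_apply, hl, Scheme.Hom.comp_apply, hw, hz]
  · have h1 : w.asIdeal.comap (algebraMap R (Localization.Away g)) = Ideal.span {a, b} := by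
      rw [← hzab, ← hw]
      rfl
    rw [← Set.image_pair, ← Ideal.map_span, ← h1]
    exact (IsLocalization.map_under (Submonoid.powers g) _ _).symm

theorem mem_pointIdeal {X : Scheme.{u}} {p : X} {U : X.Opens} (s : Γ(X, U)) :
    s ∈ pointIdeal p U ↔ p ∉ X.basicOpen s := by
  rw [pointIdeal, Ideal.mem_iInf, Scheme.mem_basicOpen'', not_exists]
  refine forall_congr' fun h => ?_
  rw [Ideal.mem_comap, IsLocalRing.mem_maximalIdeal, mem_nonunits_iff]

theorem IsRegularPoint.exists_pointIdeal_eq {X : Scheme.{u}} {p : X} (h : IsRegularPoint X p) :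
    ∃ U : X.Opens, IsAffineOpen U ∧ p ∈ U ∧ ∃ x y : Γ(X, U),
      pointIdeal p U = Ideal.span {x, y} ∧ IsRegularPair x y := by
  obtain ⟨R, c, hc, z, rfl, a, b, hz, hab⟩ := h
  let ψ : R ≃+* Γ(X, c ''ᵁ ⊤) :=
    ((Scheme.ΓSpecIso R).symm ≪≫ (c.appIso ⊤).symm).commRingCatIsoToRingEquiv
  have hψ : ∀ r : R, ψ r ∈ pointIdeal (c z) (c ''ᵁ ⊤) ↔ r ∈ z.asIdeal := by
    intro r
    have h1 : X.basicOpen (ψ r) = c ''ᵁ PrimeSpectrum.basicOpen r := by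
      rw [← basicOpen_eq_of_affine, Scheme.image_basicOpen]
      rfl
    rw [mem_pointIdeal, h1]
    have h2 : c z ∈ c ''ᵁ PrimeSpectrum.basicOpen r ↔ z ∈ PrimeSpectrum.basicOpen r :=
      c.isOpenEmbedding.injective.mem_set_image
    exact (not_congr h2).trans not_not
  have hI : pointIdeal (c z) (c ''ᵁ ⊤) = z.asIdeal.map ψ := by
    ext s
    obtain ⟨r, rfl⟩ := ψ.surjective s
    rw [hψ]
    refine ⟨fun h => Ideal.mem_map_of_mem _ h, fun h => ?_⟩
    obtain ⟨r', hr', h⟩ := (Ideal.mem_map_of_equiv ψ _).mp h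
    exact ψ.injective h ▸ hr'
  refine ⟨c ''ᵁ ⊤, (isAffineOpen_top _).image_of_isOpenImmersion c, ⟨z, trivial, rfl⟩, ψ a, ψ b,
    ?_, ?_⟩
  · rw [hI, hz, Ideal.map_span, Set.image_pair]
  · refine ⟨?_, ?_, fun s t hst => ?_⟩
    · simpa using hab.left_ne_zero
    · simpa using hab.right_ne_zero
    · obtain ⟨s, rfl⟩ := ψ.surjective s
      obtain ⟨t, rfl⟩ := ψ.surjective t
      rw [← map_mul, ← map_mul] at hst
      exact map_dvd ψ (hab.dvd s t (ψ.injective hst))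

/-! ### Gluing -/

/-- A scheme is integral if it is covered by integral open subschemes that all meet a fixed one. -/
theorem isIntegral_of_isOpenImmersion_cover {X Z : Scheme.{u}} [IsIntegral Z] (c : Z ⟶ X)
    [IsOpenImmersion c] (h : ∀ x : X, ∃ (Y : Scheme.{u}) (i : Y ⟶ X) (_ : IsOpenImmersion i)
      (_ : IsIntegral Y), x ∈ Set.range i ∧ (Set.range i ∩ Set.range c).Nonempty) :
    IsIntegral X := by
  have hred : ∀ x : X, _root_.IsReduced (X.presheaf.stalk x) := by
    intro x
    obtain ⟨Y, i, _, _, ⟨y, rfl⟩, -⟩ := h x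
    exact isReduced_of_injective _ (asIso (i.stalkMap y)).commRingCatIsoToRingEquiv.injective
  have := isReduced_of_isReduced_stalk X
  have hgen : closure {c (genericPoint Z)} = Set.univ := by
    rw [Set.eq_univ_iff_forall]
    intro x
    rw [mem_closure_iff]
    intro O hO hxO
    refine ⟨_, ?_, rfl⟩
    obtain ⟨Y, i, _, _, ⟨y, rfl⟩, _, ⟨y', rfl⟩, z, hz⟩ := h x
    obtain ⟨w, hw1, hw2⟩ := nonempty_preirreducible_inter (hO.preimage i.continuous)
      (c.isOpenEmbedding.isOpen_range.preimage i.continuous) ⟨y, hxO⟩ ⟨y', z, hz⟩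
    obtain ⟨v, hv⟩ := hw2
    exact (genericPoint_spec Z).mem_open_set_iff (hO.preimage c.continuous) |>.mpr
      ⟨v, trivial, by rw [Set.mem_preimage, hv]; exact hw1⟩
  have : IrreducibleSpace X := by
    have h1 : IsIrreducible (Set.univ : Set X) := hgen ▸ isIrreducible_singleton.closure
    exact { isPreirreducible_univ := h1.2, toNonempty := ⟨c (genericPoint Z)⟩ }
  exact isIntegral_of_irreducibleSpace_of_isReduced X

theorem locallyOfFiniteType_of_isOpenImmersion_cover {X B : Scheme.{u}} (f : X ⟶ B)
    (h : ∀ x : X, ∃ (Y : Scheme.{u}) (i : Y ⟶ X) (_ : IsOpenImmersion i),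
      LocallyOfFiniteType (i ≫ f) ∧ x ∈ Set.range i) : LocallyOfFiniteType f := by
  choose Y i hi hf hx using h
  have : IsZariskiLocalAtSource @LocallyOfFiniteType.{u} :=
    HasRingHomProperty.instIsZariskiLocalAtSource (Q := RingHom.FiniteType)
  refine IsZariskiLocalAtSource.of_iSup_eq_top (P := @LocallyOfFiniteType)
    (fun x => (i x).opensRange) (top_le_iff.mp fun x _ => ?_) fun x => ?_
  · exact TopologicalSpace.Opens.mem_iSup.mpr ⟨x, hx x⟩
  · have := hf x
    rw [← IsOpenImmersion.isoOfRangeEq_inv_fac (i x) (Scheme.Opens.ι _)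
      (congr_arg TopologicalSpace.Opens.carrier (i x).opensRange.opensRange_ι.symm),
      Category.assoc]
    infer_instance

/-! ### Exceptional curves -/

theorem coheight_spec {X : Scheme.{u}} {S : CommRingCat.{u}} (c : Spec S ⟶ X) [IsOpenImmersion c]
    (q : Spec S) : Order.coheight (c q) = q.asIdeal.height :=
  (coheight_eq_of_isOpenImmersion c).trans (idealHeight_eq_coheight _ _).symm

theorem eq_span_of_coheight_eq_one {X : Scheme.{u}} {S : CommRingCat.{u}} [IsDomain S]
    (c : Spec S ⟶ X) [IsOpenImmersion c] {q : Spec S} {v : S} (hv : Prime v) (hvq : v ∈ q.asIdeal)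
    (h : Order.coheight (c q) = 1) : q.asIdeal = Ideal.span {v} :=
  have := q.isPrime
  Ideal.eq_span_singleton_of_height_eq_one ((coheight_spec c q).symm.trans h) hvq hv

/-- If the complement of an open subset is given in two charts by prime elements, then it contains
exactly one prime divisor. -/
theorem exists_unique_primeDivisor {X : Scheme.{u}} (W : Set X) {S₁ S₂ : CommRingCat.{u}}
    [IsDomain S₁] [IsDomain S₂] [IsNoetherianRing S₁] (c₁ : Spec S₁ ⟶ X) (c₂ : Spec S₂ ⟶ X)
    [IsOpenImmersion c₁]
    [IsOpenImmersion c₂] {u₁ v₁ : S₁} {u₂ : S₂} (hu₁ : Prime u₁) (hu₂ : Prime u₂)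
    (hv : ¬ u₁ ∣ v₁) (h₁ : ∀ q, c₁ q ∉ W ↔ u₁ ∈ q.asIdeal) (h₂ : ∀ q, c₂ q ∉ W ↔ u₂ ∈ q.asIdeal)
    (h₁₂ : ∀ q, v₁ ∉ q.asIdeal → c₁ q ∈ Set.range c₂)
    (hc : ∀ x ∉ W, x ∈ Set.range c₁ ∨ x ∈ Set.range c₂) :
    ∃ E : PrimeDivisor X, E.1 ∉ W ∧ ∀ C : PrimeDivisor X, C.1 ∉ W → C = E := by
  let q₁ : Spec S₁ := ⟨Ideal.span {u₁}, (Ideal.span_singleton_prime hu₁.ne_zero).mpr hu₁⟩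
  have hq₁ : u₁ ∈ q₁.asIdeal := Ideal.mem_span_singleton_self u₁
  have hE : Order.coheight (c₁ q₁) = 1 := by
    rw [coheight_spec]
    exact Ideal.height_span_singleton_eq_one_of_mem_nonZeroDivisors
      (mem_nonZeroDivisors_of_ne_zero hu₁.ne_zero) hu₁.not_isUnit
  refine ⟨⟨c₁ q₁, hE⟩, (h₁ q₁).mpr hq₁, fun C hC => Subtype.ext ?_⟩
  rcases hc C.1 hC with ⟨q, hq⟩ | ⟨q, hq⟩
  · rw [← hq] at hC
    have h3 : q = q₁ := PrimeSpectrum.ext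
      (eq_span_of_coheight_eq_one c₁ hu₁ ((h₁ q).mp hC) (hq ▸ C.2))
    rw [← hq, h3]
  · obtain ⟨q', hq'⟩ := h₁₂ q₁ (fun h => hv (Ideal.mem_span_singleton.mp h))
    have h3 : u₂ ∈ q'.asIdeal := by
      rw [← h₂, hq', h₁]
      exact hq₁
    rw [← hq] at hC
    have h4 := eq_span_of_coheight_eq_one c₂ hu₂ ((h₂ q).mp hC) (hq ▸ C.2)
    have h5 := eq_span_of_coheight_eq_one c₂ hu₂ h3 (hq' ▸ hE)
    change _ = c₁ q₁
    have h6 : q = q' := PrimeSpectrum.ext (h4.trans h5.symm)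
    rw [← hq, ← hq', h6]

/-! ### Blowing up a regular point -/

/-- A normal integral `k`-scheme, locally of finite type, all of whose closed points are regular
and whose class group is torsion-free and generated by `r` elements. -/
structure IsNormalSurface {k : Type u} [Field k] {X : Scheme.{u}} (f : X ⟶ Spec (.of k)) (r : ℕ) :
    Prop where
  isIntegral : IsIntegral X
  locallyOfFiniteType : LocallyOfFiniteType f
  isIntegrallyClosed : ∀ x, IsIntegrallyClosed (X.presheaf.stalk x)
  isRegularPoint : ∀ p : X, IsClosed ({p} : Set X) → IsRegularPoint X p
  classGroup : ∀ [IsIntegral X] [IsLocallyNoetherian X], IsClassGroupBounded r X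

/-- An affine chart of a blow-up `π` of `p` in which the exceptional curve is `u = 0`. -/
structure IsExceptionalChart {X' X : Scheme.{u}} (π : X' ⟶ X) (p : X) {S : CommRingCat.{u}}
    (c : Spec S ⟶ X') (u : S) : Prop where
  isOpenImmersion : IsOpenImmersion c
  isDomain : IsDomain S
  isIntegrallyClosed : IsIntegrallyClosed S
  prime : Prime u
  apply_eq_iff : ∀ q, π (c q) = p ↔ u ∈ q.asIdeal
  locallyOfFiniteType : LocallyOfFiniteType (c ≫ π)
  isRegularPoint : ∀ q : Spec S, q.asIdeal.IsMaximal → u ∈ q.asIdeal → IsRegularPoint (Spec S) q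

theorem pointIdeal_fromSpec {X : Scheme.{u}} {U : X.Opens} (hU : IsAffineOpen U)
    (P : PrimeSpectrum Γ(X, U)) : pointIdeal (hU.fromSpec P) U = P.asIdeal := by
  ext s
  rw [mem_pointIdeal, ← hU.fromSpec_image_basicOpen]
  have h : hU.fromSpec P ∈ hU.fromSpec ''ᵁ PrimeSpectrum.basicOpen s ↔
      P ∈ PrimeSpectrum.basicOpen s := hU.fromSpec.isOpenEmbedding.injective.mem_set_image
  exact (not_congr h).trans not_not

theorem exists_fromSpec_eq {X : Scheme.{u}} {U : X.Opens} (hU : IsAffineOpen U) {p : X}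
    (hp : p ∈ U) : ∃ P : PrimeSpectrum Γ(X, U), hU.fromSpec P = p :=
  hU.range_fromSpec.superset hp

theorem isMaximal_of_isClosed {X : Scheme.{u}} {S : CommRingCat.{u}} (c : Spec S ⟶ X)
    [IsOpenImmersion c] {q : Spec S} (h : IsClosed ({c q} : Set X)) : q.asIdeal.IsMaximal := by
  refine (PrimeSpectrum.isClosed_singleton_iff_isMaximal _).mp ?_
  have h1 : c ⁻¹' {c q} = {q} := by
    rw [← Set.image_singleton, c.isOpenEmbedding.injective.preimage_image]
  exact h1 ▸ h.preimage c.continuous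

theorem isIntegrallyClosed_section {X : Scheme.{u}} [IsIntegral X] {U : X.Opens}
    (hU : IsAffineOpen U) [Nonempty U] (h : ∀ x, IsIntegrallyClosed (X.presheaf.stalk x)) :
    IsIntegrallyClosed Γ(X, U) := by
  refine IsIntegrallyClosed.of_localization_maximal fun q _ hq => ?_
  let y : PrimeSpectrum Γ(X, U) := ⟨q, inferInstance⟩
  have hy : hU.fromSpec y ∈ U := by
    rw [← SetLike.mem_coe, ← hU.range_fromSpec]
    exact Set.mem_range_self _
  let _ : Algebra Γ(X, U) (X.presheaf.stalk (hU.fromSpec y)) :=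
    TopCat.Presheaf.algebra_section_stalk X.presheaf (⟨_, hy⟩ : U)
  have hloc : IsLocalization.AtPrime (X.presheaf.stalk (hU.fromSpec y)) q :=
    hU.isLocalization_stalk' y hy
  have := h (hU.fromSpec y)
  exact IsIntegrallyClosed.of_equiv (IsLocalization.algEquiv q.primeCompl
    (X.presheaf.stalk (hU.fromSpec y)) (Localization.AtPrime q)).toRingEquiv

theorem isIntegrallyClosed_stalk_spec {X : Scheme.{u}} {S : CommRingCat.{u}} [IsDomain S]
    [IsIntegrallyClosed S] (c : Spec S ⟶ X) [IsOpenImmersion c] (q : Spec S) :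
    IsIntegrallyClosed (X.presheaf.stalk (c q)) := by
  have := q.isPrime
  let _ : Algebra S ((Spec S).presheaf.stalk q) := StructureSheaf.stalkAlgebra S q
  have hloc : IsLocalization.AtPrime ((Spec S).presheaf.stalk q) q.asIdeal :=
    StructureSheaf.IsLocalization.to_stalk S q
  have h : IsIntegrallyClosed ((Spec S).presheaf.stalk q) :=
    isIntegrallyClosed_of_isLocalization _ q.asIdeal.primeCompl
      q.asIdeal.primeCompl_le_nonZeroDivisors
  exact IsIntegrallyClosed.of_equiv (asIso (c.stalkMap q)).commRingCatIsoToRingEquiv.symm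

/-- If `p` is cut out by the regular pair `x, y`, then the chart `Γ(X, U)[y/x]` of the blow-up is
an exceptional chart. -/
theorem isExceptionalChart {X' X : Scheme.{u}} {π : X' ⟶ X} {p : X} [IsIntegral X]
    (hn : ∀ x, IsIntegrallyClosed (X.presheaf.stalk x)) (hp : IsClosed ({p} : Set X))
    {U : X.Opens} (hU : IsAffineOpen U) (hpU : p ∈ U) {x y : Γ(X, U)}
    (hI : pointIdeal p U = Ideal.span {x, y}) (hxy : IsRegularPair x y) {S : CommRingCat.{u}}
    [IsDomain S] (c : Spec S ⟶ X') [IsOpenImmersion c] (ι : Γ(X, U) →+* S)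
    (hι : IsBlowUpChart (Ideal.span {x, y}) x ι)
    (hc : c ≫ π = Spec.map (CommRingCat.ofHom ι) ≫ hU.fromSpec) {T : S} (hT : ι x * T = ι y) :
    IsExceptionalChart π p c (ι x) := by
  have : Nonempty U := ⟨⟨p, hpU⟩⟩
  have := isIntegrallyClosed_section hU hn
  obtain ⟨P, rfl⟩ := exists_fromSpec_eq hU hpU
  rw [pointIdeal_fromSpec] at hI
  have hmax : (Ideal.span {x, y}).IsMaximal := hI ▸ isMaximal_of_isClosed hU.fromSpec hp
  have hprime := hι.prime hxy hmax.isPrime hT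
  refine ⟨inferInstance, inferInstance, isIntegrallyClosed_of_prime hι.injective hprime
    fun z => ?_, hprime, fun q => ?_, ?_, fun q hq hxq => ?_⟩
  · obtain ⟨n, a, -, h⟩ := hι.exists_mul z
    exact ⟨n, a, h⟩
  · have := q.isPrime
    rw [IsBlowUpChart.mem_iff_comap_eq hmax hT, ← hI, ← Scheme.Hom.comp_apply, hc,
      Scheme.Hom.comp_apply]
    exact hU.fromSpec.isOpenEmbedding.injective.eq_iff.trans PrimeSpectrum.ext_iff
  · have h1 : LocallyOfFiniteType (Spec.map (CommRingCat.ofHom ι)) := by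
      rw [HasRingHomProperty.Spec_iff (P := @LocallyOfFiniteType)]
      have h3 : ι = (eval₂RingHom ι T).comp C := by
        ext r
        simp
      change RingHom.FiniteType ι
      rw [h3]
      refine RingHom.FiniteType.comp_surjective ?_ (hι.eval₂_surjective hxy.left_ne_zero hT)
      exact RingHom.finiteType_algebraMap.mpr inferInstance
    rw [hc]
    infer_instance
  · obtain ⟨a, b, h1, h2⟩ := hι.exists_regularPair hxy hmax hT q.asIdeal hq hxq
    exact ⟨S, 𝟙 _, inferInstance, q, rfl, a, b, h1, h2⟩

/-- The exceptional curve over a regular point is covered by two exceptional charts, overlapping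
in a nonempty part of the curve. -/
theorem IsBlowUpAt.exists_exceptionalCharts {X' X : Scheme.{u}} {π : X' ⟶ X} {p : X} [IsIntegral X]
    (h : IsBlowUpAt π p) (hn : ∀ x, IsIntegrallyClosed (X.presheaf.stalk x))
    (hp : IsClosed ({p} : Set X)) (hreg : IsRegularPoint X p) :
    ∃ (S₁ S₂ : CommRingCat.{u}) (c₁ : Spec S₁ ⟶ X') (c₂ : Spec S₂ ⟶ X') (u₁ v₁ : S₁) (u₂ : S₂),
      IsExceptionalChart π p c₁ u₁ ∧ IsExceptionalChart π p c₂ u₂ ∧ ¬ u₁ ∣ v₁ ∧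
      (∀ q, v₁ ∉ q.asIdeal → c₁ q ∈ Set.range c₂) ∧
      ∀ x', π x' = p → x' ∈ Set.range c₁ ∨ x' ∈ Set.range c₂ := by
  obtain ⟨U, hU, hpU, x, y, hI, hxy⟩ := hreg.exists_pointIdeal_eq
  have : Nonempty U := ⟨⟨p, hpU⟩⟩
  have hx : x ∈ pointIdeal p U := hI ▸ Ideal.subset_span (by simp)
  have hy : y ∈ pointIdeal p U := hI ▸ Ideal.subset_span (by simp)
  have hs : ∀ i, ![x, y] i ∈ pointIdeal p U := by
    intro i
    fin_cases i
    exacts [hx, hy]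
  obtain ⟨c, hc1, hc2, hc3, hc4⟩ := h.exists_charts hU ![x, y] hs
    (by rw [hI, Matrix.range_cons, Matrix.range_cons, Matrix.range_empty, Set.union_empty,
      Set.singleton_union])
  have hI' : pointIdeal p U = Ideal.span {y, x} := by rw [hI, Set.pair_comm]
  have hd0 := isDomain_reesChart _ hx hxy.left_ne_zero
  have hd1 := isDomain_reesChart _ hy hxy.right_ne_zero
  have hι0 : IsBlowUpChart (Ideal.span {x, y}) x (reesChartMap (pointIdeal p U) hx) := by
    rw [← hI]
    exact isBlowUpChart_reesChartMap _ hx hxy.left_ne_zero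
  have hι1 : IsBlowUpChart (Ideal.span {y, x}) y (reesChartMap (pointIdeal p U) hy) := by
    rw [← hI']
    exact isBlowUpChart_reesChartMap _ hy hxy.right_ne_zero
  have hT0 := reesChartMap_mul_isLocalizationElem (pointIdeal p U) hx hy
  have hT1 := reesChartMap_mul_isLocalizationElem (pointIdeal p U) hy hx
  have ho0 : IsOpenImmersion (X := Spec (.of (ReesChart _ hx))) (c 0) := hc1 0
  have ho1 : IsOpenImmersion (X := Spec (.of (ReesChart _ hy))) (c 1) := hc1 1
  have e0 : IsExceptionalChart π p (c 0) (reesChartMap (pointIdeal p U) hx x) :=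
    isExceptionalChart hn hp hU hpU hI hxy (S := .of (ReesChart _ hx)) (c 0) _ hι0 (hc2 0) hT0
  have e1 : IsExceptionalChart π p (c 1) (reesChartMap (pointIdeal p U) hy y) :=
    isExceptionalChart hn hp hU hpU hI' hxy.symm (S := .of (ReesChart _ hy)) (c 1) _ hι1 (hc2 1)
      hT1
  have hprime : (Ideal.span {x, y}).IsPrime := by
    obtain ⟨P, rfl⟩ := exists_fromSpec_eq hU hpU
    rw [← hI, pointIdeal_fromSpec]
    exact P.isPrime
  refine ⟨_, _, c 0, c 1, _, _, _, e0, e1, hι0.not_dvd hxy hprime hT0, hc4 0 1, fun x' hx' => ?_⟩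
  obtain ⟨i, hi⟩ := hc3 x' (hx' ▸ hpU)
  fin_cases i
  exacts [Or.inl hi, Or.inr hi]

/-- A regular point is not the generic point of a curve. -/
theorem coheight_ne_one_of_isRegularPoint {X : Scheme.{u}} [IsIntegral X] [IsLocallyNoetherian X]
    {p : X} (h : IsRegularPoint X p) : Order.coheight p ≠ 1 := by
  obtain ⟨U, hU, hpU, x, y, hI, hxy⟩ := h.exists_pointIdeal_eq
  have : Nonempty U := ⟨⟨p, hpU⟩⟩
  have hnoeth : IsNoetherianRing Γ(X, U) := IsLocallyNoetherian.component_noetherian ⟨U, hU⟩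
  obtain ⟨P, rfl⟩ := exists_fromSpec_eq hU hpU
  rw [pointIdeal_fromSpec] at hI
  rw [coheight_fromSpec, hI]
  exact hxy.height_ne_one (hI ▸ P.isPrime)

/-- A rational function on the blow-up whose divisor is supported on the exceptional curve is a
rational function on `X` without zeros and poles, hence a unit near the centre. -/
theorem eq_zero_of_smul_single_mem {X X' Y : Scheme.{u}} [IsIntegral X] [IsIntegral X']
    [IsIntegral Y] [IsLocallyNoetherian X] [IsLocallyNoetherian X'] [IsLocallyNoetherian Y]
    (hn : ∀ x, IsIntegrallyClosed (X.presheaf.stalk x)) (π : X' ⟶ X) (i : Y ⟶ X')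
    [IsOpenImmersion i] [IsOpenImmersion (i ≫ π)] {p : X} (hp : Order.coheight p ≠ 1)
    (hrange : ∀ x, x ≠ p → x ∈ Set.range (i ≫ π)) (E : PrimeDivisor X') (hE : π E.1 = p)
    (hEi : E.1 ∉ Set.range i) {m : ℤ} (hm : m • Finsupp.single E 1 ∈ principalDivisors X') :
    m = 0 := by
  obtain ⟨g', hg', hD⟩ := hm
  obtain ⟨g, hg⟩ := (functionFieldIso (i ≫ π)).commRingCatIsoToRingEquiv.surjective
    ((functionFieldIso i).hom g')
  change (functionFieldIso (i ≫ π)).hom g = _ at hg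
  have hg0 : g ≠ 0 := by
    rintro rfl
    rw [map_zero, eq_comm] at hg
    exact hg' ((map_eq_zero_iff _ (functionFieldIso i).commRingCatIsoToRingEquiv.injective).mp hg)
  have hord : ∀ x : X, Scheme.ord g x = 0 := by
    intro x
    by_cases hx : x = p
    · exact Scheme.ord_eq_zero_of_coheight_neq_one (hx ▸ hp) g
    · obtain ⟨y, rfl⟩ := hrange x hx
      rw [← ord_functionFieldIso, hg, ord_functionFieldIso]
      by_cases hy : Order.coheight (i y) = 1
      · have h1 := hD ⟨i y, hy⟩
        rw [← h1, Finsupp.smul_apply, Finsupp.single_eq_of_ne, smul_zero]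
        rintro h
        exact hEi ⟨y, congrArg Subtype.val h⟩
      · exact Scheme.ord_eq_zero_of_coheight_neq_one hy g'
  obtain ⟨U, hU, hpU, -⟩ := exists_isAffineOpen_mem_and_subset (TopologicalSpace.Opens.mem_top p)
  have : Nonempty U := ⟨⟨p, hpU⟩⟩
  have := isIntegrallyClosed_section hU hn
  obtain ⟨u, hu, hug⟩ := exists_isUnit_of_ord_eq_zero hU hg0 fun x _ => hord x
  have hne : Nonempty (π ⁻¹ᵁ U) := ⟨⟨E.1, show π E.1 ∈ U from hE ▸ hpU⟩⟩
  have hne2 : Nonempty (i ⁻¹ᵁ π ⁻¹ᵁ U) := by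
    obtain ⟨_, h1, y, rfl⟩ := nonempty_preirreducible_inter (π ⁻¹ᵁ U).2
      i.isOpenEmbedding.isOpen_range ⟨E.1, show π E.1 ∈ U from hE ▸ hpU⟩
      ⟨i (genericPoint Y), Set.mem_range_self _⟩
    exact ⟨⟨y, h1⟩⟩
  have hne3 : Nonempty ((i ≫ π) ⁻¹ᵁ U) := hne2
  have h1 := functionFieldIso_germ (i ≫ π) U u
  have h2 := functionFieldIso_germ i (π ⁻¹ᵁ U) (π.app U u)
  have h3 : X'.germToFunctionField (π ⁻¹ᵁ U) (π.app U u) = g' := by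
    apply (functionFieldIso i).commRingCatIsoToRingEquiv.injective
    change (functionFieldIso i).hom _ = (functionFieldIso i).hom _
    rw [h2, ← hg, ← hug, h1, Scheme.Hom.comp_app]
    rfl
  have hEU : E.1 ∈ π ⁻¹ᵁ U := show π E.1 ∈ U from hE ▸ hpU
  have h4 := Scheme.ord_of_isUnit (hu.map (π.app U).hom) hEU
  have h5 := hD E
  rw [← h3, Finsupp.smul_apply, Finsupp.single_eq_same, smul_eq_mul, mul_one] at h5
  exact h5.trans h4

theorem isClosed_singleton_of_isOpenImmersion {X Y : Scheme.{u}} [JacobsonSpace X] (j : Y ⟶ X)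
    [IsOpenImmersion j] {y : Y} (h : IsClosed ({y} : Set Y)) : IsClosed ({j y} : Set X) :=
  j.isOpenEmbedding.preimage_closedPoints.superset h

theorem isClosed_singleton_of_isOpenImmersion' {X Y : Scheme.{u}} (j : Y ⟶ X)
    [IsOpenImmersion j] {y : Y} (h : IsClosed ({j y} : Set X)) : IsClosed ({y} : Set Y) := by
  have h1 : j ⁻¹' {j y} = {y} := by
    rw [← Set.image_singleton, j.isOpenEmbedding.injective.preimage_image]
  exact h1 ▸ h.preimage j.continuous

/-- Blowing up a closed point keeps the surface regular and normal, and adds the exceptional curve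
as a free generator to the class group: the complement of the exceptional curve is `X` without the
centre, which has the class group of `X`. -/
theorem IsNormalSurface.blowUp {k : Type u} [Field k] {X X' : Scheme.{u}} {f : X ⟶ Spec (.of k)}
    {r : ℕ} (hX : IsNormalSurface f r) {p : X} (hp : IsClosed ({p} : Set X)) {π : X' ⟶ X}
    (hπ : IsBlowUpAt π p) : IsNormalSurface (π ≫ f) (r + 1) := by
  have := hX.isIntegral
  have := hX.locallyOfFiniteType
  have := hX.isIntegrallyClosed
  have hXn : IsLocallyNoetherian X := LocallyOfFiniteType.isLocallyNoetherian f
  have hXj : JacobsonSpace X := LocallyOfFiniteType.jacobsonSpace f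
  obtain ⟨S₁, S₂, c₁, c₂, u₁, v₁, u₂, h₁, h₂, hv, h₁₂, hcov⟩ :=
    hπ.exists_exceptionalCharts hX.isIntegrallyClosed hp (hX.isRegularPoint p hp)
  have hd₁ := h₁.isDomain
  have hd₂ := h₂.isDomain
  have := h₁.isOpenImmersion
  have := h₂.isOpenImmersion
  have := h₁.isIntegrallyClosed
  have := h₂.isIntegrallyClosed
  let V : X.Opens := ⟨{p}ᶜ, hp.isOpen_compl⟩
  let Y := (π ⁻¹ᵁ V).toScheme
  let i : Y ⟶ X' := (π ⁻¹ᵁ V).ι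
  have hi : ∀ x', x' ∈ Set.range i ↔ π x' ≠ p := by
    intro x'
    have h := Set.ext_iff.mp (π ⁻¹ᵁ V).range_ι x'
    exact h
  have hj : IsOpenImmersion (i ≫ π) := hπ.isOpenImmersion_comp V (fun h => h rfl)
  have hrange : ∀ x, x ≠ p → x ∈ Set.range (i ≫ π) := by
    intro x hx
    obtain ⟨x', rfl⟩ := hπ.exists_eq hx hp
    obtain ⟨y, rfl⟩ := (hi x').mpr hx
    exact ⟨y, Scheme.Hom.comp_apply _ _ _⟩
  have hgen : ∀ {S : CommRingCat.{u}} (c : Spec S ⟶ X') (u : S), IsExceptionalChart π p c u →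
      (Set.range c ∩ Set.range i).Nonempty := by
    intro S c u h
    have := h.isDomain
    refine ⟨c ⟨⊥, Ideal.isPrime_bot⟩, Set.mem_range_self _, (hi _).mpr fun h1 => ?_⟩
    exact h.prime.ne_zero ((h.apply_eq_iff _).mp h1)
  have hY : Nonempty Y := by
    obtain ⟨_, -, y, -⟩ := hgen c₁ u₁ h₁
    exact ⟨y⟩
  have hYi : IsIntegral Y := isIntegral_of_isOpenImmersion (i ≫ π)
  have hcases : ∀ x', x' ∈ Set.range i ∨ x' ∈ Set.range c₁ ∨ x' ∈ Set.range c₂ := by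
    intro x'
    by_cases hx' : π x' = p
    · exact Or.inr (hcov x' hx')
    · exact Or.inl ((hi x').mpr hx')
  have hint₁ : IsIntegral (Spec S₁) := inferInstance
  have hint₂ : IsIntegral (Spec S₂) := inferInstance
  have hX' : IsIntegral X' := by
    refine isIntegral_of_isOpenImmersion_cover i fun x' => ?_
    rcases hcases x' with h | h | h
    · exact ⟨Y, i, inferInstance, inferInstance, h, i (Classical.arbitrary Y),
        Set.mem_range_self _, Set.mem_range_self _⟩
    · exact ⟨_, c₁, inferInstance, hint₁, h, hgen c₁ u₁ h₁⟩
    · exact ⟨_, c₂, inferInstance, hint₂, h, hgen c₂ u₂ h₂⟩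
  have hlft : LocallyOfFiniteType (π ≫ f) := by
    have := h₁.locallyOfFiniteType
    have := h₂.locallyOfFiniteType
    refine locallyOfFiniteType_of_isOpenImmersion_cover _ fun x' => ?_
    rcases hcases x' with h | h | h
    · exact ⟨Y, i, inferInstance, by rw [← Category.assoc]; infer_instance, h⟩
    · exact ⟨_, c₁, inferInstance, by rw [← Category.assoc]; infer_instance, h⟩
    · exact ⟨_, c₂, inferInstance, by rw [← Category.assoc]; infer_instance, h⟩
  have hnorm : ∀ x', IsIntegrallyClosed (X'.presheaf.stalk x') := by
    intro x'
    rcases hcases x' with ⟨y, rfl⟩ | ⟨q, rfl⟩ | ⟨q, rfl⟩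
    · have h1 := hX.isIntegrallyClosed ((i ≫ π) y)
      have h2 : IsIntegrallyClosed (Y.presheaf.stalk y) :=
        h1.of_equiv (asIso ((i ≫ π).stalkMap y)).commRingCatIsoToRingEquiv
      exact h2.of_equiv (asIso (i.stalkMap y)).commRingCatIsoToRingEquiv.symm
    · exact isIntegrallyClosed_stalk_spec c₁ q
    · exact isIntegrallyClosed_stalk_spec c₂ q
  have hreg : ∀ p' : X', IsClosed ({p'} : Set X') → IsRegularPoint X' p' := by
    intro p' hp'
    by_cases h : π p' = p
    · rcases hcov p' h with ⟨q, rfl⟩ | ⟨q, rfl⟩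
      · exact (h₁.isRegularPoint q (isMaximal_of_isClosed c₁ hp') ((h₁.apply_eq_iff q).mp h)).map c₁
      · exact (h₂.isRegularPoint q (isMaximal_of_isClosed c₂ hp') ((h₂.apply_eq_iff q).mp h)).map c₂
    · obtain ⟨y, rfl⟩ := (hi p').mpr h
      have h1 := isClosed_singleton_of_isOpenImmersion (i ≫ π)
        (isClosed_singleton_of_isOpenImmersion' i hp')
      exact ((hX.isRegularPoint _ h1).of_map (i ≫ π)).map i
  refine ⟨hX', hlft, hnorm, hreg, @fun _ hnoeth => ?_⟩
  have hYn : IsLocallyNoetherian Y := LocallyOfFiniteType.isLocallyNoetherian (i ≫ π ≫ f)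
  have hS₁ : IsNoetherianRing S₁ := by
    have : IsLocallyNoetherian (Spec S₁) := LocallyOfFiniteType.isLocallyNoetherian (c₁ ≫ π ≫ f)
    have h : IsNoetherianRing Γ(Spec S₁, ⊤) :=
      IsLocallyNoetherian.component_noetherian ⟨⊤, isAffineOpen_top _⟩
    exact isNoetherianRing_of_ringEquiv _ (Scheme.ΓSpecIso S₁).commRingCatIsoToRingEquiv
  have hpc := coheight_ne_one_of_isRegularPoint (hX.isRegularPoint p hp)
  have hYc : IsClassGroupBounded r Y := hX.classGroup.restrict (i ≫ π) fun C =>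
    hrange _ (fun h => hpc (h ▸ C.2))
  have hW : ∀ x', x' ∉ Set.range i ↔ π x' = p := fun x' => (not_congr (hi x')).trans not_not
  obtain ⟨E, hE, huniq⟩ := exists_unique_primeDivisor (Set.range i) c₁ c₂ h₁.prime h₂.prime hv
    (fun q => (hW _).trans (h₁.apply_eq_iff q)) (fun q => (hW _).trans (h₂.apply_eq_iff q)) h₁₂
    (fun x' hx' => hcov x' ((hW x').mp hx'))
  exact hYc.extend i E huniq hE fun m hm =>
    eq_zero_of_smul_single_mem hX.isIntegrallyClosed π i hpc hrange E ((hW _).mp hE) hE hm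

/-! ### The standard charts of the projective plane -/

section PlaneChart

attribute [local instance] MvPolynomial.gradedAlgebra

variable (k : Type u) [Field k] (i : Fin 3)

theorem X_mem_homogeneousSubmodule (l : Fin 3) :
    (MvPolynomial.X l : MvPolynomial (Fin 3) k) ∈ MvPolynomial.homogeneousSubmodule (Fin 3) k 1 :=
  (MvPolynomial.mem_homogeneousSubmodule _ _).mpr (MvPolynomial.isHomogeneous_X k l)

/-- The coordinate ring of the chart `xᵢ ≠ 0`. -/
abbrev PlaneChart : Type u :=
  HomogeneousLocalization.Away (MvPolynomial.homogeneousSubmodule (Fin 3) k)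
    (MvPolynomial.X i : MvPolynomial (Fin 3) k)

/-- The structure homomorphism of the chart `xᵢ ≠ 0`. -/
def planeChartConst : k →+* PlaneChart k i :=
  (HomogeneousLocalization.fromZeroRingHom (MvPolynomial.homogeneousSubmodule (Fin 3) k) _).comp
    (algebraMap k (MvPolynomial.homogeneousSubmodule (Fin 3) k 0))

/-- The function `xₗ / xᵢ`. -/
def planeChartRatio (l : Fin 3) : PlaneChart k i :=
  HomogeneousLocalization.Away.isLocalizationElem (X_mem_homogeneousSubmodule k i)
    (X_mem_homogeneousSubmodule k l)

/-- The functions on the chart as polynomials in the two ratios `xₗ / xᵢ`, `l ≠ i`. -/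
def planeChartHom : MvPolynomial (Fin 2) k →+* PlaneChart k i :=
  MvPolynomial.eval₂Hom (planeChartConst k i) fun j => planeChartRatio k i (i.succAbove j)

/-- Setting the coordinate `xᵢ` to `1`. -/
def dehomogenize : MvPolynomial (Fin 3) k →+* MvPolynomial (Fin 2) k :=
  (MvPolynomial.aeval (i.insertNth (1 : MvPolynomial (Fin 2) k) MvPolynomial.X)).toRingHom

theorem dehomogenize_X_self : dehomogenize k i (MvPolynomial.X i) = 1 := by
  simp [dehomogenize]

theorem dehomogenize_X_succAbove (j : Fin 2) :
    dehomogenize k i (MvPolynomial.X (i.succAbove j)) = MvPolynomial.X j := by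
  simp [dehomogenize]

theorem dehomogenize_C (a : k) : dehomogenize k i (MvPolynomial.C a) = MvPolynomial.C a := by
  simp [dehomogenize]

/-- The localization map inverting `xᵢ`. -/
abbrev planeLoc : MvPolynomial (Fin 3) k →+*
    Localization.Away (MvPolynomial.X i : MvPolynomial (Fin 3) k) :=
  algebraMap _ _

/-- Dehomogenization on the localization. -/
def dehomogenizeAway : Localization.Away (MvPolynomial.X i : MvPolynomial (Fin 3) k) →+*
    MvPolynomial (Fin 2) k :=
  IsLocalization.Away.lift (g := dehomogenize k i) (MvPolynomial.X i)
    (by rw [dehomogenize_X_self]; exact isUnit_one)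

theorem dehomogenizeAway_algebraMap (P : MvPolynomial (Fin 3) k) :
    dehomogenizeAway k i (planeLoc k i P) = dehomogenize k i P :=
  IsLocalization.Away.lift_eq _ _ _

theorem val_planeChartConst (a : k) :
    (planeChartConst k i a).val = planeLoc k i (MvPolynomial.C a) :=
  Localization.mk_one_eq_algebraMap _

theorem mul_val_planeChartRatio (l : Fin 3) :
    planeLoc k i (MvPolynomial.X i) * (planeChartRatio k i l).val =
      planeLoc k i (MvPolynomial.X l) := by
  have h : (planeChartRatio k i l).val = IsLocalization.mk' _ (MvPolynomial.X l ^ 1)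
      (⟨MvPolynomial.X i ^ 1, 1, rfl⟩ :
        Submonoid.powers (MvPolynomial.X i : MvPolynomial (Fin 3) k)) := by
    rw [planeChartRatio, HomogeneousLocalization.Away.val_mk, Localization.mk_eq_mk']
  have h1 := IsLocalization.mk'_spec' (Localization.Away (MvPolynomial.X i : MvPolynomial _ k))
    (MvPolynomial.X l ^ 1) (⟨MvPolynomial.X i ^ 1, 1, rfl⟩ :
        Submonoid.powers (MvPolynomial.X i : MvPolynomial (Fin 3) k))
  rw [h]
  simpa only [pow_one] using h1

/-- Dehomogenization on the chart. -/
def dehomogenizeChart : PlaneChart k i →+* MvPolynomial (Fin 2) k :=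
  (dehomogenizeAway k i).comp (algebraMap (PlaneChart k i) _)

theorem dehomogenizeChart_planeChartHom (P : MvPolynomial (Fin 2) k) :
    dehomogenizeChart k i (planeChartHom k i P) = P := by
  suffices h : (dehomogenizeChart k i).comp (planeChartHom k i) = RingHom.id _ from
    RingHom.congr_fun h P
  refine MvPolynomial.ringHom_ext (fun a => ?_) fun j => ?_
  · rw [RingHom.comp_apply, planeChartHom, MvPolynomial.coe_eval₂Hom, MvPolynomial.eval₂_C]
    change dehomogenizeAway k i (planeChartConst k i a).val = _
    rw [val_planeChartConst, dehomogenizeAway_algebraMap, dehomogenize_C]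
    rfl
  · rw [RingHom.comp_apply, planeChartHom, MvPolynomial.coe_eval₂Hom, MvPolynomial.eval₂_X]
    change dehomogenizeAway k i (planeChartRatio k i (i.succAbove j)).val = _
    have h := congrArg (dehomogenizeAway k i) (mul_val_planeChartRatio k i (i.succAbove j))
    rwa [map_mul, dehomogenizeAway_algebraMap, dehomogenizeAway_algebraMap, dehomogenize_X_self,
      one_mul, dehomogenize_X_succAbove] at h

theorem planeChartHom_dehomogenize_X (l : Fin 3) :
    planeChartHom k i (dehomogenize k i (MvPolynomial.X l)) = planeChartRatio k i l := by
  rcases Fin.eq_self_or_eq_succAbove i l with rfl | ⟨j, rfl⟩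
  · rw [dehomogenize_X_self, map_one]
    apply HomogeneousLocalization.val_injective
    rw [HomogeneousLocalization.val_one, planeChartRatio, HomogeneousLocalization.Away.val_mk]
    exact (Localization.mk_self (⟨_, _⟩ : Submonoid.powers _)).symm
  · rw [dehomogenize_X_succAbove, planeChartHom, MvPolynomial.coe_eval₂Hom, MvPolynomial.eval₂_X]

/-- A homogeneous polynomial is `xᵢⁿ` times its dehomogenization. -/
theorem pow_mul_val_planeChartHom {n : ℕ} {P : MvPolynomial (Fin 3) k} (hP : P.IsHomogeneous n) :
    planeLoc k i (MvPolynomial.X i) ^ n * (planeChartHom k i (dehomogenize k i P)).val =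
      planeLoc k i P := by
  let χ : MvPolynomial (Fin 3) k →+*
      Localization.Away (MvPolynomial.X i : MvPolynomial (Fin 3) k) :=
    (algebraMap (PlaneChart k i) _).comp ((planeChartHom k i).comp (dehomogenize k i))
  have hχC : ∀ a, χ (MvPolynomial.C a) = planeLoc k i (MvPolynomial.C a) := by
    intro a
    change (planeChartHom k i (dehomogenize k i (MvPolynomial.C a))).val = _
    rw [dehomogenize_C, planeChartHom, MvPolynomial.coe_eval₂Hom, MvPolynomial.eval₂_C,
      val_planeChartConst]
  have hχX : ∀ l, planeLoc k i (MvPolynomial.X i) * χ (MvPolynomial.X l) =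
      planeLoc k i (MvPolynomial.X l) := by
    intro l
    change _ * (planeChartHom k i (dehomogenize k i (MvPolynomial.X l))).val = _
    rw [planeChartHom_dehomogenize_X, mul_val_planeChartRatio]
  change _ * χ P = _
  rw [P.as_sum, map_sum, map_sum, Finset.mul_sum]
  refine Finset.sum_congr rfl fun m hm => ?_
  have hdeg : n = ∑ l, m l := by
    rw [← hP (MvPolynomial.mem_support_iff.mp hm), Finsupp.weight_apply, Finsupp.sum_fintype]
    · simp
    · simp
  rw [MvPolynomial.monomial_eq, map_mul, map_mul, hχC, Finsupp.prod_fintype _ _ (by simp), map_prod,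
    map_prod, mul_left_comm, hdeg, ← Finset.prod_pow_eq_pow_sum, ← Finset.prod_mul_distrib]
  congr 1
  refine Finset.prod_congr rfl fun l _ => ?_
  rw [map_pow, map_pow, ← mul_pow, hχX]

theorem bijective_planeChartHom : Function.Bijective (planeChartHom k i) := by
  refine ⟨Function.LeftInverse.injective (dehomogenizeChart_planeChartHom k i), fun z => ?_⟩
  obtain ⟨n, P, hP, rfl⟩ := HomogeneousLocalization.Away.mk_surjective
    (MvPolynomial.homogeneousSubmodule (Fin 3) k) (X_mem_homogeneousSubmodule k i) z
  refine ⟨dehomogenize k i P, HomogeneousLocalization.val_injective _ ?_⟩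
  rw [HomogeneousLocalization.Away.val_mk, Localization.mk_eq_mk', eq_comm,
    IsLocalization.mk'_eq_iff_eq_mul]
  have h := pow_mul_val_planeChartHom k i ((MvPolynomial.mem_homogeneousSubmodule _ _).mp hP)
  rw [smul_eq_mul, mul_one] at h
  rw [← h, mul_comm, map_pow]

end PlaneChart

section PlaneCover

attribute [local instance] MvPolynomial.gradedAlgebra

variable (k : Type u) [Field k]

theorem irrelevant_le_span_X :
    (HomogeneousIdeal.irrelevant (MvPolynomial.homogeneousSubmodule (Fin 3) k)).toIdeal ≤
      Ideal.span (Set.range (MvPolynomial.X : Fin 3 → MvPolynomial (Fin 3) k)) := by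
  rw [HomogeneousIdeal.toIdeal_irrelevant_le]
  intro n hn P hP
  rw [P.as_sum]
  refine Ideal.sum_mem _ fun m hm => ?_
  have hdeg : Finsupp.weight 1 m = n :=
    (MvPolynomial.mem_homogeneousSubmodule _ _).mp hP (MvPolynomial.mem_support_iff.mp hm)
  obtain ⟨l, hl⟩ : ∃ l, m l ≠ 0 := by
    by_contra! h
    have : m = 0 := Finsupp.ext h
    rw [this, map_zero] at hdeg
    omega
  obtain ⟨Q, hQ⟩ := MvPolynomial.X_dvd_monomial.mpr (Or.inr hl : P.coeff m = 0 ∨ m l ≠ 0)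
  rw [hQ]
  exact Ideal.mul_mem_right _ _ (Ideal.subset_span ⟨l, rfl⟩)

/-- The three standard charts of the projective plane, identified with the affine plane. -/
theorem exists_planeCharts_proj :
    ∃ c : Fin 3 → (Spec (.of (MvPolynomial (Fin 2) k)) ⟶
        Proj (MvPolynomial.homogeneousSubmodule (Fin 3) k)),
      (∀ i, IsOpenImmersion (c i)) ∧
      (∀ i, c i ≫ projStructure (MvPolynomial.homogeneousSubmodule (Fin 3) k) =
        Spec.map (CommRingCat.ofHom MvPolynomial.C)) ∧
      (∀ x, ∃ i, x ∈ Set.range (c i)) ∧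
      ∀ i j, ∀ q, c i q ∈ Set.range (c (i.succAbove j)) ↔ MvPolynomial.X j ∉ q.asIdeal := by
  let e := fun i => RingEquiv.ofBijective _ (bijective_planeChartHom k i)
  let a : ∀ i, Spec (.of (PlaneChart k i)) ⟶
      Proj (MvPolynomial.homogeneousSubmodule (Fin 3) k) := fun i =>
    Proj.awayι (MvPolynomial.homogeneousSubmodule (Fin 3) k) (MvPolynomial.X i)
      (X_mem_homogeneousSubmodule k i) one_pos
  let g : ∀ i, Spec (.of (MvPolynomial (Fin 2) k)) ⟶ Spec (.of (PlaneChart k i)) := fun i =>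
    Spec.map (CommRingCat.ofHom (e i).symm.toRingHom)
  have hg : ∀ i, IsIso (g i) := fun i => by
    have := isIso_ofHom_of_bijective (e i).symm.toRingHom (e i).symm.bijective
    infer_instance
  have ha : ∀ i, Set.range (a i) = Proj.basicOpen (MvPolynomial.homogeneousSubmodule (Fin 3) k)
      (MvPolynomial.X i) := by
    intro i
    rw [← Proj.opensRange_awayι _ _ (X_mem_homogeneousSubmodule k i) one_pos]
    rfl
  have hrange : ∀ i, Set.range (g i ≫ a i) =
      Proj.basicOpen (MvPolynomial.homogeneousSubmodule (Fin 3) k) (MvPolynomial.X i) := by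
    intro i
    rw [← ha]
    ext x
    constructor
    · rintro ⟨q, rfl⟩
      exact ⟨g i q, (Scheme.Hom.comp_apply _ _ _).symm⟩
    · rintro ⟨w, rfl⟩
      obtain ⟨q, rfl⟩ := (g i).homeomorph.surjective w
      exact ⟨q, Scheme.Hom.comp_apply _ _ _⟩
  refine ⟨fun i => g i ≫ a i, fun i => ?_, fun i => ?_, fun x => ?_, fun i j q => ?_⟩
  · have : IsOpenImmersion (a i) := inferInstanceAs (IsOpenImmersion (Proj.awayι _ _ _ _))
    infer_instance
  · have h1 : a i ≫ projStructure (MvPolynomial.homogeneousSubmodule (Fin 3) k) =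
        Spec.map (CommRingCat.ofHom (planeChartConst k i)) := by
      rw [projStructure, Proj.awayι_toSpecZero_assoc, ← Spec.map_comp, ← CommRingCat.ofHom_comp]
      rfl
    rw [Category.assoc, h1, ← Spec.map_comp, ← CommRingCat.ofHom_comp]
    congr 2
    ext1 b
    apply (e i).injective
    change e i ((e i).symm (planeChartConst k i b)) = planeChartHom k i (MvPolynomial.C b)
    rw [RingEquiv.apply_symm_apply, planeChartHom, MvPolynomial.coe_eval₂Hom, MvPolynomial.eval₂_C]
  · have h1 := Proj.iSup_basicOpen_eq_top (MvPolynomial.homogeneousSubmodule (Fin 3) k) _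
      (irrelevant_le_span_X k)
    have h2 : x ∈ (⊤ : (Proj (MvPolynomial.homogeneousSubmodule (Fin 3) k)).Opens) := trivial
    rw [← h1, TopologicalSpace.Opens.mem_iSup] at h2
    obtain ⟨i, hi⟩ := h2
    exact ⟨i, (hrange i).superset hi⟩
  · rw [hrange, Scheme.Hom.comp_apply]
    have h1 : g i q ∈ a i ⁻¹ᵁ Proj.basicOpen (MvPolynomial.homogeneousSubmodule (Fin 3) k)
        (MvPolynomial.X (i.succAbove j)) ↔
          planeChartRatio k i (i.succAbove j) ∉ (g i q).asIdeal := by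
      have h2 := Proj.awayι_preimage_basicOpen (MvPolynomial.homogeneousSubmodule (Fin 3) k)
        (X_mem_homogeneousSubmodule k i) one_pos
        (X_mem_homogeneousSubmodule k (i.succAbove j)) one_pos
      exact Iff.of_eq (congrArg (g i q ∈ ·) h2)
    refine Iff.trans h1 (not_congr ?_)
    have h3 : (e i).symm (planeChartRatio k i (i.succAbove j)) = MvPolynomial.X j := by
      rw [RingEquiv.symm_apply_eq, ← planeChartHom_dehomogenize_X, dehomogenize_X_succAbove]
      rfl
    rw [← h3]
    rfl

theorem exists_planeCharts :
    ∃ c : Fin 3 → (Spec (.of (MvPolynomial (Fin 2) k)) ⟶ projectivePlane k),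
      (∀ i, IsOpenImmersion (c i)) ∧
      (∀ i, c i ≫ projectivePlaneStructure k = Spec.map (CommRingCat.ofHom MvPolynomial.C)) ∧
      (∀ x, ∃ i, x ∈ Set.range (c i)) ∧
      ∀ i j, ∀ q, c i q ∈ Set.range (c (i.succAbove j)) ↔ MvPolynomial.X j ∉ q.asIdeal :=
  exists_planeCharts_proj k

end PlaneCover

/-! ### The affine plane -/

section AffinePlane

variable (k : Type u) [Field k]

theorem prime_X_sub_C (j : Fin 2) (a : k) :
    Prime (MvPolynomial.X j - MvPolynomial.C a : MvPolynomial (Fin 2) k) := by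
  -- translation by `a` carries the polynomial to a variable
  let σ : k → MvPolynomial (Fin 2) k →ₐ[k] MvPolynomial (Fin 2) k := fun b =>
    MvPolynomial.aeval fun l => MvPolynomial.X l + MvPolynomial.C b
  have hσ : ∀ b, (σ b).comp (σ (-b)) = AlgHom.id k _ := by
    intro b
    ext l : 1
    simp [σ, map_neg]
  let e : MvPolynomial (Fin 2) k ≃ₐ[k] MvPolynomial (Fin 2) k :=
    AlgEquiv.ofAlgHom (σ a) (σ (-a)) (hσ a) (by simpa using hσ (-a))
  have h : e (MvPolynomial.X j - MvPolynomial.C a) = MvPolynomial.X j := by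
    change σ a _ = _
    simp [σ]
  rw [← MulEquiv.prime_iff e.toMulEquiv]
  change Prime (e _)
  rw [h]
  exact MvPolynomial.X_prime

theorem not_X_sub_C_dvd (a b : k) : ¬ (MvPolynomial.X 0 - MvPolynomial.C a :
    MvPolynomial (Fin 2) k) ∣ MvPolynomial.X 1 - MvPolynomial.C b := by
  rintro h
  have h1 := map_dvd (MvPolynomial.eval ![a, b + 1]) h
  simp at h1

/-- By the Nullstellensatz a maximal ideal of `k[x, y]` is `(x - a, y - b)`. -/
theorem exists_isRegularPair_of_isMaximal [IsAlgClosed k] (q : Ideal (MvPolynomial (Fin 2) k))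
    (hq : q.IsMaximal) : ∃ x y, q = Ideal.span {x, y} ∧ IsRegularPair x y := by
  obtain ⟨t, rfl⟩ := MvPolynomial.isMaximal_iff_eq_vanishingIdeal_singleton.mp hq
  refine ⟨MvPolynomial.X 0 - MvPolynomial.C (t 0), MvPolynomial.X 1 - MvPolynomial.C (t 1), ?_,
    isRegularPair_of_prime (prime_X_sub_C k 0 _) (not_X_sub_C_dvd k _ _)⟩
  set J : Ideal (MvPolynomial (Fin 2) k) := Ideal.span
    {MvPolynomial.X 0 - MvPolynomial.C (t 0), MvPolynomial.X 1 - MvPolynomial.C (t 1)}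
  refine le_antisymm (fun P hP => ?_) ?_
  · have h : Ideal.Quotient.mk J =
        (Ideal.Quotient.mk J).comp (MvPolynomial.C.comp (MvPolynomial.eval t)) := by
      refine MvPolynomial.ringHom_ext (fun a => by simp) fun j => ?_
      rw [RingHom.comp_apply, RingHom.comp_apply, MvPolynomial.eval_X, Ideal.Quotient.eq]
      fin_cases j
      · exact Ideal.subset_span (Set.mem_insert _ _)
      · exact Ideal.subset_span (Set.mem_insert_of_mem _ rfl)
    have h1 : MvPolynomial.eval t P = 0 := by
      have := (MvPolynomial.mem_vanishingIdeal_singleton_iff t P).mp hP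
      rwa [MvPolynomial.aeval_eq_eval] at this
    rw [← Ideal.Quotient.eq_zero_iff_mem, h, RingHom.comp_apply, RingHom.comp_apply, h1, map_zero,
      map_zero]
  · rw [Ideal.span_le]
    rintro P (rfl | rfl) <;>
    · rw [SetLike.mem_coe, MvPolynomial.mem_vanishingIdeal_singleton_iff]
      simp

end AffinePlane

/-! ### The class group of the projective plane -/

/-- If an open affine subset has only constant units, then a rational function whose divisor is
supported outside of it is constant. -/
theorem eq_zero_of_smul_single_mem_of_units {k : Type u} [Field k] {X : Scheme.{u}} [IsIntegral X]
    [IsLocallyNoetherian X] {f : X ⟶ Spec (.of k)} {S : CommRingCat.{u}} [IsDomain S]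
    [IsNoetherianRing S] [IsIntegrallyClosed S] (i : Spec S ⟶ X) [IsOpenImmersion i] {φ : k →+* S}
    (hf : i ≫ f = Spec.map (CommRingCat.ofHom φ))
    (hφ : ∀ s : S, IsUnit s → ∃ a, IsUnit a ∧ φ a = s) {E : PrimeDivisor X}
    (hE : E.1 ∉ Set.range i) {m : ℤ} (hm : m • Finsupp.single E 1 ∈ principalDivisors X) :
    m = 0 := by
  obtain ⟨g, hg, hD⟩ := hm
  have hg' : (functionFieldIso i).hom g ≠ 0 := (map_ne_zero_iff _
    (functionFieldIso i).commRingCatIsoToRingEquiv.injective).mpr hg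
  have hord : ∀ y ∈ (⊤ : (Spec S).Opens), Scheme.ord ((functionFieldIso i).hom g) y = 0 := by
    intro y _
    rw [ord_functionFieldIso]
    by_cases hy : Order.coheight (i y) = 1
    · have h1 := hD ⟨i y, hy⟩
      rw [← h1, Finsupp.smul_apply, Finsupp.single_eq_of_ne, smul_zero]
      rintro h
      exact hE ⟨y, congrArg Subtype.val h⟩
    · exact Scheme.ord_eq_zero_of_coheight_neq_one hy g
  have : IsIntegrallyClosed Γ(Spec S, ⊤) :=
    IsIntegrallyClosed.of_equiv (Scheme.ΓSpecIso S).commRingCatIsoToRingEquiv.symm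
  have hne : Nonempty (⊤ : (Spec S).Opens) := ⟨⟨genericPoint _, trivial⟩⟩
  have hneX : Nonempty (⊤ : X.Opens) := ⟨⟨genericPoint _, trivial⟩⟩
  have hne' : Nonempty (i ⁻¹ᵁ ⊤) := hne
  obtain ⟨u, hu, hug⟩ := exists_isUnit_of_ord_eq_zero (isAffineOpen_top _) hg' hord
  obtain ⟨a, ha, hau⟩ := hφ _ (hu.map (Scheme.ΓSpecIso S).hom.hom)
  let w : Γ(X, ⊤) := f.appTop ((Scheme.ΓSpecIso (.of k)).inv a)
  have hw : IsUnit w := (ha.map (Scheme.ΓSpecIso (.of k)).inv.hom).map f.appTop.hom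
  have hwu : i.app ⊤ w = u := by
    have h1 : (Scheme.ΓSpecIso (.of k)).inv ≫ f.appTop ≫ i.appTop =
        CommRingCat.ofHom φ ≫ (Scheme.ΓSpecIso S).inv := by
      rw [← Scheme.Hom.comp_appTop, hf]
      exact (Scheme.ΓSpecIso_inv_naturality (CommRingCat.ofHom φ)).symm
    refine (congrArg (fun ψ => ψ.hom a) h1).trans ?_
    change (Scheme.ΓSpecIso S).inv (φ a) = u
    rw [hau]
    exact Iso.hom_inv_id_apply (Scheme.ΓSpecIso S) u
  have hgw : X.germToFunctionField ⊤ w = g := by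
    apply (functionFieldIso i).commRingCatIsoToRingEquiv.injective
    change (functionFieldIso i).hom _ = (functionFieldIso i).hom _
    rw [functionFieldIso_germ, hwu]
    exact hug
  have h4 := Scheme.ord_of_isUnit hw (TopologicalSpace.Opens.mem_top E.1)
  have h5 := hD E
  rw [← hgw, Finsupp.smul_apply, Finsupp.single_eq_same, smul_eq_mul, mul_one] at h5
  exact h5.trans h4

/-- The complement of an affine plane in the projective plane is a single curve, the line at
infinity, which generates the class group. -/
theorem isNormalSurface_of_planeCharts {k : Type u} [Field k] [IsAlgClosed k] {X : Scheme.{u}}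
    {f : X ⟶ Spec (.of k)} (c : Fin 3 → (Spec (.of (MvPolynomial (Fin 2) k)) ⟶ X))
    [hc : ∀ i, IsOpenImmersion (c i)]
    (hf : ∀ i, c i ≫ f = Spec.map (CommRingCat.ofHom MvPolynomial.C))
    (hcov : ∀ x, ∃ i, x ∈ Set.range (c i))
    (hmem : ∀ i j, ∀ q, c i q ∈ Set.range (c (i.succAbove j)) ↔ MvPolynomial.X j ∉ q.asIdeal) :
    IsNormalSurface f 1 := by
  have hS : IsIntegral (Spec (.of (MvPolynomial (Fin 2) k))) := inferInstance
  have hint : IsIntegral X := by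
    refine isIntegral_of_isOpenImmersion_cover (c 0) fun x => ?_
    obtain ⟨i, hi⟩ := hcov x
    refine ⟨_, c i, hc i, hS, hi, ?_⟩
    rcases Fin.eq_self_or_eq_succAbove i 0 with rfl | ⟨j, hj⟩
    · exact ⟨c 0 ⟨⊥, Ideal.isPrime_bot⟩, Set.mem_range_self _, Set.mem_range_self _⟩
    · refine ⟨c i ⟨⊥, Ideal.isPrime_bot⟩, Set.mem_range_self _, ?_⟩
      rw [hj]
      exact (hmem i j _).mpr (MvPolynomial.X_ne_zero j)
  have hft : LocallyOfFiniteType f := by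
    refine locallyOfFiniteType_of_isOpenImmersion_cover _ fun x => ?_
    obtain ⟨i, hi⟩ := hcov x
    refine ⟨_, c i, hc i, ?_, hi⟩
    rw [hf, HasRingHomProperty.Spec_iff (P := @LocallyOfFiniteType)]
    exact RingHom.finiteType_algebraMap.mpr (inferInstance :
      Algebra.FiniteType k (MvPolynomial (Fin 2) k))
  refine ⟨hint, hft, fun x => ?_, fun p hp => ?_, @fun _ hnoeth => ?_⟩
  · obtain ⟨i, q, rfl⟩ := hcov x
    have : IsIntegrallyClosed (MvPolynomial (Fin 2) k) := inferInstance
    exact isIntegrallyClosed_stalk_spec (c i) q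
  · obtain ⟨i, q, rfl⟩ := hcov p
    obtain ⟨x, y, hxy⟩ := exists_isRegularPair_of_isMaximal k q.asIdeal
      (isMaximal_of_isClosed (c i) hp)
    exact ⟨_, c i, hc i, q, rfl, x, y, hxy⟩
  · have h10 : (1 : Fin 3).succAbove 0 = 0 := rfl
    have h11 : (1 : Fin 3).succAbove 1 = 2 := rfl
    have h20 : (2 : Fin 3).succAbove 0 = 0 := rfl
    have hdvd : ¬ (MvPolynomial.X 0 : MvPolynomial (Fin 2) k) ∣ MvPolynomial.X 1 := by
      rw [MvPolynomial.X_dvd_X]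
      decide
    obtain ⟨E, hE, huniq⟩ := exists_unique_primeDivisor (Set.range (c 0)) (c 1) (c 2)
      (S₁ := .of (MvPolynomial (Fin 2) k)) (S₂ := .of (MvPolynomial (Fin 2) k))
      (u₁ := MvPolynomial.X 0) (u₂ := MvPolynomial.X 0) (v₁ := MvPolynomial.X 1)
      MvPolynomial.X_prime MvPolynomial.X_prime hdvd
      (fun q => (not_congr (hmem 1 0 q)).trans not_not)
      (fun q => (not_congr (hmem 2 0 q)).trans not_not)
      (fun q hq => (hmem 1 1 q).mpr hq) (fun x hx => by
        obtain ⟨i, hi⟩ := hcov x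
        fin_cases i
        exacts [absurd hi hx, Or.inl hi, Or.inr hi])
    have h0 := isClassGroupBounded_spec (.of (MvPolynomial (Fin 2) k))
    exact h0.extend (c 0) E huniq hE fun m hm =>
      eq_zero_of_smul_single_mem_of_units (c 0) (hf 0)
        (fun s hs => (MvPolynomial.isUnit_iff_eq_C_of_isReduced.mp hs).imp
          fun _ h => ⟨h.1, h.2.symm⟩)
        hE hm

theorem IsIteratedBlowUp.isNormalSurface {k : Type u} [Field k] [IsAlgClosed k] {s : ℕ}
    {X : Scheme.{u}} {f : X ⟶ Spec (.of k)} (h : IsIteratedBlowUp k s X f) :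
    IsNormalSurface f (s + 1) := by
  induction h with
  | plane e =>
    obtain ⟨c, hc1, hc2, hc3, hc4⟩ := exists_planeCharts k
    have hmem : ∀ i x, x ∈ Set.range (c i ≫ e.inv) ↔ e.hom x ∈ Set.range (c i) := by
      intro i x
      constructor
      · rintro ⟨q, rfl⟩
        exact ⟨q, by simp⟩
      · rintro ⟨q, hq⟩
        exact ⟨q, by simp [hq]⟩
    refine isNormalSurface_of_planeCharts (fun i => c i ≫ e.inv) (fun i => ?_) (fun x => ?_)
      fun i j q => ?_
    · rw [Category.assoc, Iso.inv_hom_id_assoc, hc2]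
    · obtain ⟨i, hi⟩ := hc3 (e.hom x)
      exact ⟨i, (hmem i x).mpr hi⟩
    · rw [hmem, ← hc4 i j q]
      simp
  | blowUp _ p hp π hπ ih => exact ih.blowUp hp hπ

/-! ### Cyclic chains in a lattice -/

section Chain

variable {M : Type u} [AddCommGroup M] (B : M →+ M →+ ℤ)

/-- `A 0, …, A (n - 1)` is a cyclic chain with self-intersections `a`: consecutive elements (with
`A (n - 1)` and `A 0` counted as such) have product `1`, other distinct elements product `0`. -/
structure IsCyclicChain (n : ℕ) (a : ℕ → ℤ) (A : ℕ → M) : Prop where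
  self : ∀ i < n, B (A i) (A i) = a i
  of_lt : ∀ i j, i < j → j < n →
    B (A i) (A j) = if j = i + 1 ∨ (i = 0 ∧ j + 1 = n) then 1 else 0

/-- The group of pairs of the same integral combination of `A` and of `A'`. -/
def pairedSpan (n : ℕ) (A A' : ℕ → M) : AddSubgroup (M × M) :=
  AddSubgroup.closure ((fun i => (A i, A' i)) '' Set.Iio n)

variable {B} {n : ℕ} {a : ℕ → ℤ} {A A' : ℕ → M}

theorem mem_pairedSpan {i : ℕ} (hi : i < n) : (A i, A' i) ∈ pairedSpan n A A' :=
  AddSubgroup.subset_closure ⟨i, hi, rfl⟩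

theorem sum_mem_pairedSpan :
    (∑ i ∈ Finset.range n, A i, ∑ i ∈ Finset.range n, A' i) ∈ pairedSpan n A A' := by
  have h : (∑ i ∈ Finset.range n, A i, ∑ i ∈ Finset.range n, A' i) =
      ∑ i ∈ Finset.range n, (A i, A' i) := by
    rw [Prod.ext_iff, Prod.fst_sum, Prod.snd_sum]
    exact ⟨rfl, rfl⟩
  rw [h]
  exact sum_mem fun i hi => mem_pairedSpan (Finset.mem_range.mp hi)

theorem IsCyclicChain.form_eq (hB : ∀ x y, B x y = B y x) (hA : IsCyclicChain B n a A)
    (hA' : IsCyclicChain B n a A') {i j : ℕ} (hi : i < n) (hj : j < n) :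
    B (A i) (A j) = B (A' i) (A' j) := by
  rcases lt_trichotomy i j with h | rfl | h
  · rw [hA.of_lt i j h hj, hA'.of_lt i j h hj]
  · rw [hA.self i hi, hA'.self i hi]
  · rw [hB, hA.of_lt j i h hi, hB, hA'.of_lt j i h hi]

/-- The intersection numbers of integral combinations of a chain depend only on the
self-intersections of the chain. -/
theorem form_eq_of_mem_pairedSpan (hB : ∀ x y, B x y = B y x) (hA : IsCyclicChain B n a A)
    (hA' : IsCyclicChain B n a A') {x y : M × M} (hx : x ∈ pairedSpan n A A')
    (hy : y ∈ pairedSpan n A A') : B x.1 y.1 = B x.2 y.2 := by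
  induction hx using AddSubgroup.closure_induction with
  | mem x hx =>
    obtain ⟨i, hi, rfl⟩ := hx
    induction hy using AddSubgroup.closure_induction with
    | mem y hy =>
      obtain ⟨j, hj, rfl⟩ := hy
      exact hA.form_eq hB hA' hi hj
    | zero => simp
    | add y z _ _ h1 h2 => simp only [Prod.fst_add, Prod.snd_add, map_add, h1, h2]
    | neg y _ h1 => simp only [Prod.fst_neg, Prod.snd_neg, map_neg, h1]
  | zero => simp
  | add y z _ _ h1 h2 =>
    simp only [Prod.fst_add, Prod.snd_add, map_add, AddMonoidHom.add_apply, h1, h2]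
  | neg y _ h1 => simp only [Prod.fst_neg, Prod.snd_neg, map_neg, AddMonoidHom.neg_apply, h1]

theorem apply_eq_of_mem_pairedSpan {w : M →+ M} (hw : ∀ i < n, w (A i) = A' i) {x : M × M}
    (hx : x ∈ pairedSpan n A A') : w x.1 = x.2 := by
  induction hx using AddSubgroup.closure_induction with
  | mem x hx =>
    obtain ⟨i, hi, rfl⟩ := hx
    exact hw i hi
  | zero => simp
  | add y z _ _ h1 h2 => simp only [Prod.fst_add, Prod.snd_add, map_add, h1, h2]
  | neg y _ h1 => simp only [Prod.fst_neg, Prod.snd_neg, map_neg, h1]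

/-! ### Augmentations -/

/-- The position in the augmented chain of the old element with index `i`, when the new element
has index `p`. -/
def augIndex (p i : ℕ) : ℕ := if i < p then i else i + 1

/-- The old element with index `i` is a neighbour of the new element with index `p`. -/
def IsAugNeighbour (n p i : ℕ) : Prop :=
  i + 1 = p ∨ i = p ∨ (i + 1 = n ∧ p = 0) ∨ (i = 0 ∧ p = n)

instance (n p i : ℕ) : Decidable (IsAugNeighbour n p i) := by
  unfold IsAugNeighbour
  infer_instance

/-- `a'` arises from `a` by inserting `-1` at the index `p` and subtracting `1` from its two
neighbours. -/
structure IsAugmentation (n p : ℕ) (a a' : ℕ → ℤ) : Prop where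
  le : p ≤ n
  new : a' p = -1
  old : ∀ i < n, a i = a' (augIndex p i) + if IsAugNeighbour n p i then 1 else 0

/-- The chain obtained by contracting the element with index `p`. -/
def contractChain (n p : ℕ) (A : ℕ → M) (i : ℕ) : M :=
  A (augIndex p i) + if IsAugNeighbour n p i then A p else 0

theorem form_augIndex (hB : ∀ x y, B x y = B y x) {p : ℕ} (hp : p ≤ n)
    (hA : IsCyclicChain B (n + 1) a A) {i : ℕ} (hi : i < n) :
    B (A p) (A (augIndex p i)) = if IsAugNeighbour n p i then 1 else 0 := by
  unfold augIndex
  split_ifs with h1 h2 h2 <;> unfold IsAugNeighbour at h2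
  · rw [hB, hA.of_lt i p h1 (by omega), if_pos (by omega)]
  · rw [hB, hA.of_lt i p h1 (by omega), if_neg (by omega)]
  · rw [hA.of_lt p (i + 1) (by omega) (by omega), if_pos (by omega)]
  · rw [hA.of_lt p (i + 1) (by omega) (by omega), if_neg (by omega)]

theorem augIndex_lt {p i : ℕ} (hi : i < n) : augIndex p i < n + 1 := by
  unfold augIndex
  split_ifs <;> omega

/-- Contracting the element `A p` with square `-1`, that is, adding it to its two neighbours, gives
a chain again. Here `n ≥ 4` ensures that the two neighbours are not adjacent. -/
theorem IsCyclicChain.contract (hB : ∀ x y, B x y = B y x) {a' : ℕ → ℤ} {p : ℕ} (hn : 4 ≤ n)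
    (h : IsAugmentation n p a a') (hA : IsCyclicChain B (n + 1) a' A) :
    IsCyclicChain B n a (contractChain n p A) := by
  have hp := h.le
  have hpp : B (A p) (A p) = -1 := by rw [hA.self p (by omega), h.new]
  have hform : ∀ i j, i < n → j < n → B (contractChain n p A i) (contractChain n p A j) =
      B (A (augIndex p i)) (A (augIndex p j)) +
        if IsAugNeighbour n p i ∧ IsAugNeighbour n p j then 1 else 0 := by
    intro i j hi hj
    have h1 := form_augIndex hB hp hA hi
    have h2 := form_augIndex hB hp hA hj
    have h3 := hB (A (augIndex p i)) (A p)
    unfold contractChain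
    by_cases hi' : IsAugNeighbour n p i <;> by_cases hj' : IsAugNeighbour n p j <;>
      simp only [hi', hj', if_true, if_false, true_and, and_true, and_self,
        add_zero, map_add, AddMonoidHom.add_apply] at h1 h2 ⊢ <;> linarith
  refine ⟨fun i hi => ?_, fun i j hij hj => ?_⟩
  · rw [hform i i hi hi, hA.self _ (augIndex_lt hi), h.old i hi]
    simp only [and_self]
  · have hlt : augIndex p i < augIndex p j := by
      unfold augIndex
      split_ifs <;> omega
    rw [hform i j (by omega) hj, hA.of_lt _ _ hlt (augIndex_lt hj)]
    unfold augIndex IsAugNeighbour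
    split_ifs <;>
      first | rfl | (exfalso; omega) | (exfalso; simp only [false_and, or_false] at *; omega)

theorem sum_range_eq_add_sum_augIndex {N : Type*} [AddCommMonoid N] {p : ℕ} (hp : p ≤ n)
    (f : ℕ → N) : ∑ i ∈ Finset.range (n + 1), f i =
      f p + ∑ i ∈ Finset.range n, f (augIndex p i) := by
  rw [Finset.sum_range, Finset.sum_range, Fin.sum_univ_succAbove _ (⟨p, by omega⟩ : Fin (n + 1))]
  congr 1
  refine Finset.sum_congr rfl fun i _ => congrArg f ?_
  unfold augIndex Fin.succAbove
  simp only [Fin.lt_def, Fin.val_castSucc]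
  split_ifs <;> rfl

theorem sum_isAugNeighbour {p : ℕ} (hn : 4 ≤ n) (hp : p ≤ n) :
    ∑ i ∈ Finset.range n, (if IsAugNeighbour n p i then (1 : ℤ) else 0) = 2 := by
  rw [Finset.sum_boole]
  have h : (Finset.range n).filter (IsAugNeighbour n p) =
      {if p = 0 then n - 1 else p - 1, if p = n then 0 else p} := by
    ext i
    simp only [Finset.mem_filter, Finset.mem_range, Finset.mem_insert, Finset.mem_singleton]
    unfold IsAugNeighbour
    split_ifs <;> omega
  rw [h, Finset.card_pair (by split_ifs <;> omega)]
  rfl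

theorem form_sum_new (hB : ∀ x y, B x y = B y x) {a' : ℕ → ℤ} {p : ℕ} (hn : 4 ≤ n)
    (h : IsAugmentation n p a a') (hA : IsCyclicChain B (n + 1) a' A) :
    B (A p) (∑ i ∈ Finset.range (n + 1), A i) = 1 := by
  have hp := h.le
  rw [sum_range_eq_add_sum_augIndex h.le, map_add, map_sum, hA.self p (by omega), h.new,
    Finset.sum_congr rfl fun i hi => form_augIndex hB h.le hA (Finset.mem_range.mp hi),
    sum_isAugNeighbour hn h.le]
  norm_num

theorem form_contract_new (hB : ∀ x y, B x y = B y x) {a' : ℕ → ℤ} {p : ℕ}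
    (h : IsAugmentation n p a a') (hA : IsCyclicChain B (n + 1) a' A) {i : ℕ} (hi : i < n) :
    B (A p) (contractChain n p A i) = 0 := by
  have hp := h.le
  have hpp : B (A p) (A p) = -1 := by rw [hA.self p (by omega), h.new]
  unfold contractChain
  rw [map_add, form_augIndex hB h.le hA hi]
  split_ifs
  · rw [hpp]; rfl
  · simp

/-- Contraction changes the anticanonical class by the contracted element. -/
theorem sum_contractChain {p : ℕ} (hn : 4 ≤ n) (hp : p ≤ n) (A : ℕ → M) :
    ∑ i ∈ Finset.range n, contractChain n p A i = ∑ i ∈ Finset.range (n + 1), A i + A p := by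
  have h1 : ∑ i ∈ Finset.range n, (if IsAugNeighbour n p i then A p else 0) = (2 : ℤ) • A p := by
    rw [← sum_isAugNeighbour hn hp, Finset.sum_smul]
    refine Finset.sum_congr rfl fun i _ => ?_
    split_ifs <;> simp
  unfold contractChain
  rw [Finset.sum_add_distrib, h1, sum_range_eq_add_sum_augIndex hp, two_zsmul]
  abel

theorem pairedSpan_contract_le {p : ℕ} (hp : p ≤ n) :
    pairedSpan n (contractChain n p A) (contractChain n p A') ≤ pairedSpan (n + 1) A A' := by
  refine (AddSubgroup.closure_le _).mpr ?_
  rintro _ ⟨i, hi, rfl⟩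
  have h1 : (A (augIndex p i), A' (augIndex p i)) ∈ pairedSpan (n + 1) A A' :=
    mem_pairedSpan (augIndex_lt hi)
  have h2 : (A p, A' p) ∈ pairedSpan (n + 1) A A' := mem_pairedSpan (by omega)
  change (contractChain n p A i, contractChain n p A' i) ∈ pairedSpan (n + 1) A A'
  unfold contractChain
  split_ifs
  · exact add_mem h1 h2
  · simpa using h1

/-- The contracted element is orthogonal to all combinations of the contracted chain. -/
theorem form_new_of_mem (hB : ∀ x y, B x y = B y x) {a' : ℕ → ℤ} {p : ℕ}
    (h : IsAugmentation n p a a') (hA : IsCyclicChain B (n + 1) a' A) {x : M × M}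
    (hx : x ∈ pairedSpan n (contractChain n p A) A') : B x.1 (A p) = 0 := by
  rw [hB]
  induction hx using AddSubgroup.closure_induction with
  | mem x hx =>
    obtain ⟨i, hi, rfl⟩ := hx
    exact form_contract_new hB h hA hi
  | zero => simp
  | add y z _ _ h1 h2 => simp only [Prod.fst_add, map_add, h1, h2, add_zero]
  | neg y _ h1 => simp only [Prod.fst_neg, map_neg, h1, neg_zero]

end Chain

/-! ### Standard bases -/

section Bases

variable {M : Type u} [AddCommGroup M] (B : M →+ M →+ ℤ)

/-- `L, E 0, …, E (r - 1)` have the intersection numbers of the class of a line and of the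
exceptional curves on a blow-up of the plane with anticanonical class `κ`. -/
structure IsExceptionalBasis (κ : M) {r : ℕ} (L : M) (E : Fin r → M) : Prop where
  line : B L L = 1
  line_exc : ∀ j, B L (E j) = 0
  exc : ∀ i j, B (E i) (E j) = if i = j then -1 else 0
  line_deg : B L κ = 3
  exc_deg : ∀ j, B (E j) κ = 1

/-- `F, S` have the intersection numbers of the two rulings of a quadric with anticanonical
class `κ`. -/
structure IsRulingBasis (κ F S : M) : Prop where
  left : B F F = 0
  right : B S S = 0
  left_right : B F S = 1
  left_deg : B F κ = 2
  right_deg : B S κ = 2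

variable {B} {n : ℕ} {a : ℕ → ℤ}

/-- Every pair of chains with self-intersections `a` has corresponding standard bases, obtained
from the two chains as the same integral combinations. Only the first basis is required to be
standard, as the second then has the same intersection numbers. -/
def HasPairedBases (B : M →+ M →+ ℤ) (n : ℕ) (a : ℕ → ℤ) : Prop :=
  ∀ A A' : ℕ → M, IsCyclicChain B n a A → IsCyclicChain B n a A' →
    (∃ r, n = r + 3 ∧ ∃ (L L' : M) (E E' : Fin r → M), (L, L') ∈ pairedSpan n A A' ∧
      (∀ j, (E j, E' j) ∈ pairedSpan n A A') ∧
      IsExceptionalBasis B (∑ i ∈ Finset.range n, A i) L E) ∨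
    (n = 4 ∧ ∃ F F' S S' : M, (F, F') ∈ pairedSpan n A A' ∧ (S, S') ∈ pairedSpan n A A' ∧
      IsRulingBasis B (∑ i ∈ Finset.range n, A i) F S)

/-- The contracted element is a new exceptional class. Blowing up a point of the quadric gives the
plane blown up in two points: with the new class `e` and the rulings `F, S`, the standard basis is
`F + S - e`, `F - e`, `S - e`. -/
theorem HasPairedBases.augment (hB : ∀ x y, B x y = B y x) {a' : ℕ → ℤ} {p : ℕ} (hn : 4 ≤ n)
    (h : IsAugmentation n p a a') (ha : HasPairedBases B n a) : HasPairedBases B (n + 1) a' := by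
  intro A A' hA hA'
  have hp := h.le
  have hnew : (A p, A' p) ∈ pairedSpan (n + 1) A A' := mem_pairedSpan (by omega)
  have hpp : B (A p) (A p) = -1 := by rw [hA.self p (by omega), h.new]
  have hsum : ∀ x, B x (A p) = 0 → B x (∑ i ∈ Finset.range (n + 1), A i) =
      B x (∑ i ∈ Finset.range n, contractChain n p A i) := by
    intro x hx
    rw [sum_contractChain hn hp, map_add, hx, add_zero]
  have hdeg := form_sum_new hB hn h hA
  refine Or.inl ?_
  rcases ha _ _ (hA.contract hB hn h) (hA'.contract hB hn h) with
    ⟨r, rfl, L, L', E, E', hL, hE, hb⟩ | ⟨rfl, F, F', S, S', hF, hS, hb⟩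
  · have hL0 := form_new_of_mem hB h hA hL
    have hE0 := fun j => form_new_of_mem hB h hA (hE j)
    refine ⟨r + 1, rfl, L, L', Fin.snoc E (A p), Fin.snoc E' (A' p),
      pairedSpan_contract_le hp hL, fun j => ?_, hb.line, fun j => ?_, fun i j => ?_, ?_,
      fun j => ?_⟩
    · induction j using Fin.lastCases with
      | last => simpa using hnew
      | cast j => simpa using pairedSpan_contract_le hp (hE j)
    · induction j using Fin.lastCases with
      | last => simpa using hL0
      | cast j => simpa using hb.line_exc j
    · induction i using Fin.lastCases with
      | last =>
        induction j using Fin.lastCases with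
        | last => simpa using hpp
        | cast j =>
          rw [if_neg (Fin.castSucc_lt_last j).ne', hB]
          simpa using hE0 j
      | cast i =>
        induction j using Fin.lastCases with
        | last =>
          rw [if_neg (Fin.castSucc_lt_last i).ne]
          simpa using hE0 i
        | cast j => simpa using hb.exc i j
    · rw [hsum L hL0, hb.line_deg]
    · induction j using Fin.lastCases with
      | last => simpa using hdeg
      | cast j =>
        rw [Fin.snoc_castSucc, hsum _ (hE0 j), hb.exc_deg]
  · have hF0 : B F (A p) = 0 := form_new_of_mem hB h hA hF
    have hS0 : B S (A p) = 0 := form_new_of_mem hB h hA hS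
    have hF0' : B (A p) F = 0 := by rw [hB, hF0]
    have hS0' : B (A p) S = 0 := by rw [hB, hS0]
    have hSF : B S F = 1 := by rw [hB, hb.left_right]
    have hFd := (hsum F hF0).trans hb.left_deg
    have hSd := (hsum S hS0).trans hb.right_deg
    have hF1 := pairedSpan_contract_le hp hF
    have hS1 := pairedSpan_contract_le hp hS
    generalize ∑ i ∈ Finset.range (4 + 1), A i = κ at *
    have e1 := hb.left
    have e2 := hb.right
    have e3 := hb.left_right
    refine ⟨2, rfl, F + S - A p, F' + S' - A' p, ![F - A p, S - A p], ![F' - A' p, S' - A' p],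
      sub_mem (add_mem hF1 hS1) hnew, fun j => ?_, ?_, fun j => ?_, fun i j => ?_, ?_, fun j => ?_⟩
    · fin_cases j
      · exact sub_mem hF1 hnew
      · exact sub_mem hS1 hnew
    · simp [e1, e2, e3, hF0, hS0, hF0', hS0', hSF, hpp]
    · fin_cases j <;> simp [e1, e2, e3, hF0, hS0, hF0', hS0', hSF, hpp]
    · fin_cases i <;> fin_cases j <;> simp [e1, e2, e3, hF0, hS0, hF0', hS0', hSF, hpp]
    · simp [hFd, hSd, hdeg]
    · fin_cases j <;> simp [hFd, hSd, hdeg]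

/-- A hyperbolic pair `u, v` with `u² = 0`, `v² = c` gives a ruling basis if `c` is even and an
exceptional basis if `c` is odd, on replacing `v` by `v - b u` for a suitable `b`. -/
theorem exists_pairedBases_of_length_four {A A' : ℕ → M} (hB : ∀ x y, B x y = B y x) {c : ℤ}
    {u u' v v' κ : M} (hu : (u, u') ∈ pairedSpan 4 A A') (hv : (v, v') ∈ pairedSpan 4 A A')
    (h1 : B u u = 0) (h2 : B v v = c) (h3 : B u v = 1) (h4 : B u κ = 2) (h5 : B v κ = c + 2) :
    (∃ r, 4 = r + 3 ∧ ∃ (L L' : M) (E E' : Fin r → M), (L, L') ∈ pairedSpan 4 A A' ∧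
      (∀ j, (E j, E' j) ∈ pairedSpan 4 A A') ∧ IsExceptionalBasis B κ L E) ∨
    (4 = 4 ∧ ∃ F F' S S' : M, (F, F') ∈ pairedSpan 4 A A' ∧ (S, S') ∈ pairedSpan 4 A A' ∧
      IsRulingBasis B κ F S) := by
  have h3' : B v u = 1 := by rw [hB, h3]
  rcases Int.even_or_odd' c with ⟨b, rfl | rfl⟩
  · refine Or.inr ⟨rfl, u, u', v - b • u, v' - b • u', hu, sub_mem hv (zsmul_mem hu b), h1, ?_, ?_,
      h4, ?_⟩ <;> simp [h1, h2, h3, h3', h4, h5] <;> ring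
  · have hE : (v - (b + 1) • u, v' - (b + 1) • u') ∈ pairedSpan 4 A A' :=
      sub_mem hv (zsmul_mem hu (b + 1))
    refine Or.inl ⟨1, rfl, v - (b + 1) • u + u, v' - (b + 1) • u' + u', fun _ => v - (b + 1) • u,
      fun _ => v' - (b + 1) • u', add_mem hE hu, fun _ => hE, ?_, fun j => ?_, fun i j => ?_, ?_,
      fun j => ?_⟩
    · simp [h1, h2, h3, h3']; ring
    · simp [h1, h2, h3, h3']; ring
    · simp [h1, h2, h3, h3', Subsingleton.elim i j]; ring
    · simp [h4, h5]; ring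
    · simp [h4, h5]; ring

end Bases

/-! ### Admissible sequences -/

section Admissible

theorem getD_cons_eq_ite (x : ℤ) (l : List ℤ) (i : ℕ) :
    (x :: l).getD i 0 = if i = 0 then x else l.getD (i - 1) 0 := by
  cases i <;> simp

theorem getD_append_eq_ite (l l' : List ℤ) (i : ℕ) :
    (l ++ l').getD i 0 = if i < l.length then l.getD i 0 else l'.getD (i - l.length) 0 := by
  split_ifs with h
  · exact List.getD_append _ _ _ _ h
  · exact List.getD_append_right _ _ _ _ (by omega)

theorem isAugmentation_first (x : ℤ) (l : List ℤ) (y : ℤ) :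
    IsAugmentation (x :: l ++ [y]).length 0 (fun i => (x :: l ++ [y]).getD i 0)
      (fun i => (-1 :: (x - 1) :: l ++ [y - 1]).getD i 0) := by
  refine ⟨by simp, by simp, fun i hi => ?_⟩
  simp only [List.cons_append, List.length_cons, List.length_append, List.length_nil] at hi
  simp only [List.cons_append, List.length_cons, List.length_append, List.length_nil,
    getD_cons_eq_ite, getD_append_eq_ite, augIndex, IsAugNeighbour]
  grind

theorem isAugmentation_middle (l : List ℤ) (x y : ℤ) (r : List ℤ) :
    IsAugmentation (l ++ x :: y :: r).length (l.length + 1)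
      (fun i => (l ++ x :: y :: r).getD i 0)
      (fun i => (l ++ (x - 1) :: (-1) :: (y - 1) :: r).getD i 0) := by
  refine ⟨by simp, by simp, fun i hi => ?_⟩
  simp only [List.length_cons, List.length_append] at hi
  simp only [List.length_cons, List.length_append,
    getD_cons_eq_ite, getD_append_eq_ite, augIndex, IsAugNeighbour]
  grind

theorem isAugmentation_last (x : ℤ) (l : List ℤ) (y : ℤ) :
    IsAugmentation (x :: l ++ [y]).length (x :: l ++ [y]).length
      (fun i => (x :: l ++ [y]).getD i 0)
      (fun i => ((x - 1) :: l ++ [y - 1, -1]).getD i 0) := by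
  refine ⟨le_rfl, by simp, fun i hi => ?_⟩
  simp only [List.cons_append, List.length_cons, List.length_append, List.length_nil] at hi
  simp only [List.cons_append, List.length_cons, List.length_append, List.length_nil,
    getD_cons_eq_ite, getD_append_eq_ite, augIndex, IsAugNeighbour]
  grind

variable {M : Type u} [AddCommGroup M] {B : M →+ M →+ ℤ}

theorem hasPairedBases_base (hB : ∀ x y, B x y = B y x) (c : ℤ) :
    HasPairedBases B 4 (fun i => [0, c, 0, -c].getD i 0) := by
  intro A A' hA _
  have h0 : B (A 0) (A 0) = 0 := by simpa using hA.self 0 (by omega)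
  have h1 : B (A 1) (A 1) = c := by simpa using hA.self 1 (by omega)
  have h01 : B (A 0) (A 1) = 1 := by simpa using hA.of_lt 0 1 (by omega) (by omega)
  have h02 : B (A 0) (A 2) = 0 := by simpa using hA.of_lt 0 2 (by omega) (by omega)
  have h03 : B (A 0) (A 3) = 1 := by simpa using hA.of_lt 0 3 (by omega) (by omega)
  have h12 : B (A 1) (A 2) = 1 := by simpa using hA.of_lt 1 2 (by omega) (by omega)
  have h13 : B (A 1) (A 3) = 0 := by simpa using hA.of_lt 1 3 (by omega) (by omega)
  refine exists_pairedBases_of_length_four hB (mem_pairedSpan (i := 0) (by omega))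
    (mem_pairedSpan (i := 1) (by omega)) h0 h1 h01 ?_ ?_
  · simp only [Finset.sum_range_succ, Finset.sum_range_zero, map_add, map_zero]
    linarith
  · simp only [Finset.sum_range_succ, Finset.sum_range_zero, map_add, map_zero, hB (A 1) (A 0)]
    linarith

theorem hasPairedBases_base' (hB : ∀ x y, B x y = B y x) (c : ℤ) :
    HasPairedBases B 4 (fun i => [c, 0, -c, 0].getD i 0) := by
  intro A A' hA _
  have h0 : B (A 0) (A 0) = c := by simpa using hA.self 0 (by omega)
  have h1 : B (A 1) (A 1) = 0 := by simpa using hA.self 1 (by omega)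
  have h01 : B (A 0) (A 1) = 1 := by simpa using hA.of_lt 0 1 (by omega) (by omega)
  have h02 : B (A 0) (A 2) = 0 := by simpa using hA.of_lt 0 2 (by omega) (by omega)
  have h03 : B (A 0) (A 3) = 1 := by simpa using hA.of_lt 0 3 (by omega) (by omega)
  have h12 : B (A 1) (A 2) = 1 := by simpa using hA.of_lt 1 2 (by omega) (by omega)
  have h13 : B (A 1) (A 3) = 0 := by simpa using hA.of_lt 1 3 (by omega) (by omega)
  have h10 : B (A 1) (A 0) = 1 := by rw [hB, h01]
  refine exists_pairedBases_of_length_four hB (mem_pairedSpan (i := 1) (by omega))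
    (mem_pairedSpan (i := 0) (by omega)) h1 h0 h10 ?_ ?_
  all_goals
    simp only [Finset.sum_range_succ, Finset.sum_range_zero, map_add, map_zero]
    linarith

theorem IsAdmissible.hasPairedBases (hB : ∀ x y, B x y = B y x) {l : List ℤ}
    (h : IsAdmissible l) : 4 ≤ l.length ∧ HasPairedBases B l.length (fun i => l.getD i 0) := by
  induction h with
  | base c => exact ⟨le_rfl, hasPairedBases_base hB c⟩
  | base' c => exact ⟨le_rfl, hasPairedBases_base' hB c⟩
  | augmFirst x l y _ ih =>
    have h1 : (-1 :: (x - 1) :: l ++ [y - 1]).length = (x :: l ++ [y]).length + 1 := by simp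
    exact ⟨by omega, h1 ▸ ih.2.augment hB ih.1 (isAugmentation_first x l y)⟩
  | augmMiddle l x y r _ ih =>
    have h1 : (l ++ (x - 1) :: (-1) :: (y - 1) :: r).length = (l ++ x :: y :: r).length + 1 := by
      simp only [List.length_append, List.length_cons]
      omega
    exact ⟨by omega, h1 ▸ ih.2.augment hB ih.1 (isAugmentation_middle l x y r)⟩
  | augmLast x l y _ ih =>
    have h1 : ((x - 1) :: l ++ [y - 1, -1]).length = (x :: l ++ [y]).length + 1 := by simp
    exact ⟨by omega, h1 ▸ ih.2.augment hB ih.1 (isAugmentation_last x l y)⟩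

end Admissible

/-! ### The reflection group of a lattice with an anticanonical class -/

section Reflections

variable {M : Type u} [AddCommGroup M]

/-- The group generated by the reflections in the vectors `R` with `R² = -2` that are orthogonal
to `κ`. -/
def reflectionGroup (B : M →+ M →+ ℤ) (κ : M) : Subgroup (M ≃ₗ[ℤ] M) :=
  Subgroup.closure {w | ∃ R : M, (B R R = -2 ∧ B R κ = 0) ∧ ∀ D : M, w D = D + B D R • R}

variable {B : M →+ M →+ ℤ} {κ : M}

/-- The reflections that generate the group exist. -/
theorem exists_reflection {R : M} (h : B R R = -2) (hκ : B R κ = 0) :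
    ∃ w ∈ reflectionGroup B κ, ∀ D : M, w D = D + B D R • R := by
  have h2 : (-(B.flip R)).toIntLinearMap R = 2 := by simp [h]
  have key : ∀ D : M, Module.reflection h2 D = D + B D R • R := fun D => by
    rw [Module.reflection_apply]
    simp [sub_eq_add_neg]
  exact ⟨Module.reflection h2, Subgroup.subset_closure ⟨R, ⟨h, hκ⟩, key⟩, key⟩

theorem preserves_of_mem_reflectionGroup (hB : ∀ x y, B x y = B y x) {w : M ≃ₗ[ℤ] M}
    (hw : w ∈ reflectionGroup B κ) : w κ = κ ∧ ∀ x y, B (w x) (w y) = B x y := by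
  induction hw using Subgroup.closure_induction with
  | mem w hw =>
    obtain ⟨R, ⟨h1, h2⟩, h3⟩ := hw
    refine ⟨by rw [h3, hB, h2, zero_smul, add_zero], fun x y => ?_⟩
    simp only [h3, map_add, map_zsmul, AddMonoidHom.add_apply, AddMonoidHom.coe_smul,
      Pi.smul_apply, smul_eq_mul, hB R y, h1]
    ring
  | one => exact ⟨rfl, fun _ _ => rfl⟩
  | mul v w _ _ hv hw =>
    exact ⟨by rw [LinearEquiv.mul_apply, hw.1, hv.1],
      fun x y => by rw [LinearEquiv.mul_apply, LinearEquiv.mul_apply, hv.2, hw.2]⟩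
  | inv w _ hw =>
    have h : ∀ x, w (w⁻¹ x) = x := fun x => w.apply_symm_apply x
    refine ⟨w.injective (by rw [h, hw.1]), fun x y => ?_⟩
    rw [← hw.2, h, h]

theorem IsExceptionalBasis.map (hB : ∀ x y, B x y = B y x) {r : ℕ} {L : M} {E : Fin r → M}
    (h : IsExceptionalBasis B κ L E) {w : M ≃ₗ[ℤ] M} (hw : w ∈ reflectionGroup B κ) :
    IsExceptionalBasis B κ (w L) (fun j => w (E j)) := by
  obtain ⟨h1, h2⟩ := preserves_of_mem_reflectionGroup hB hw
  refine ⟨?_, fun j => ?_, fun i j => ?_, ?_, fun j => ?_⟩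
  · rw [h2, h.line]
  · rw [h2, h.line_exc]
  · rw [h2, h.exc]
  · rw [← h1, h2, h.line_deg]
  · rw [← h1, h2, h.exc_deg]

end Reflections

/-! ### Expansions in standard bases -/

section Expansion

variable {M : Type u} [AddCommGroup M] {B : M →+ M →+ ℤ} {κ : M}

/-- In a torsion-free group of rank `N`, a family of `N` elements that is dual to some other family
generates: an element orthogonal to the dual family would be independent of the given one. -/
theorem eq_sum_of_dual [Module.Finite ℤ M] [Module.IsTorsionFree ℤ M] {N : ℕ}
    (hN : N = Module.finrank ℤ M) {e d : Fin N → M}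
    (h : ∀ i j, B (e i) (d j) = if i = j then 1 else 0) (x : M) :
    x = ∑ j, B x (d j) • e j := by
  set y := x - ∑ j, B x (d j) • e j with hy
  have hyd : ∀ j, B y (d j) = 0 := fun j => by
    simp [hy, AddMonoidHom.finsetSum_apply, h]
  by_contra hne
  have hy0 : y ≠ 0 := sub_ne_zero.mpr hne
  have hli : LinearIndependent ℤ (Fin.cons y e : Fin (N + 1) → M) := by
    rw [Fintype.linearIndependent_iff]
    intro g hg
    rw [Fin.sum_univ_succ] at hg
    simp only [Fin.cons_zero, Fin.cons_succ] at hg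
    have h1 : ∀ j : Fin N, g j.succ = 0 := fun j => by
      have := congrArg (fun z => B z (d j)) hg
      simpa [AddMonoidHom.finsetSum_apply, h, hyd] using this
    have h0 : g 0 = 0 := by
      simp only [h1, zero_smul, Finset.sum_const_zero, add_zero] at hg
      exact (smul_eq_zero.mp hg).resolve_right hy0
    exact fun i => Fin.cases h0 h1 i
  have := hli.fintype_card_le_finrank
  rw [Fintype.card_fin] at this
  omega

theorem IsExceptionalBasis.expand [Module.Finite ℤ M] [Module.IsTorsionFree ℤ M]
    (hB : ∀ x y, B x y = B y x) {r : ℕ} (hr : r + 1 = Module.finrank ℤ M) {L : M} {E : Fin r → M}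
    (h : IsExceptionalBasis B κ L E) (x : M) : x = B x L • L - ∑ j, B x (E j) • E j := by
  have key := eq_sum_of_dual (B := B) hr (e := Fin.cons L E) (d := Fin.cons L (fun j => -E j))
    (fun i j => ?_) x
  · rw [Fin.sum_univ_succ] at key
    simpa [sub_eq_add_neg] using key
  · refine Fin.cases ?_ (fun i => ?_) i <;> refine Fin.cases ?_ (fun j => ?_) j
    · simp [h.line]
    · simp [h.line_exc, (Fin.succ_ne_zero _).symm]
    · simp [hB _ L, h.line_exc]
    · simp only [Fin.cons_succ, map_neg, h.exc, Fin.succ_inj]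
      split_ifs <;> simp

theorem IsRulingBasis.expand [Module.Finite ℤ M] [Module.IsTorsionFree ℤ M]
    (hB : ∀ x y, B x y = B y x) (hr : 2 = Module.finrank ℤ M) {F S : M}
    (h : IsRulingBasis B κ F S) (x : M) : x = B x S • F + B x F • S := by
  have h1 := h.left
  have h2 := h.right
  have h3 := h.left_right
  have h4 := hB S F
  have key := eq_sum_of_dual (B := B) hr (e := ![F, S]) (d := ![S, F])
    (fun i j => by fin_cases i <;> fin_cases j <;> simp [h1, h2, h3, h4]) x
  simpa [Fin.sum_univ_two] using key

theorem IsExceptionalBasis.form_eq [Module.Finite ℤ M] [Module.IsTorsionFree ℤ M]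
    (hB : ∀ x y, B x y = B y x) {r : ℕ} (hr : r + 1 = Module.finrank ℤ M) {L : M} {E : Fin r → M}
    (h : IsExceptionalBasis B κ L E) (x y : M) :
    B x y = B x L * B y L - ∑ j, B x (E j) * B y (E j) := by
  conv_lhs => rw [h.expand hB hr y]
  simp [mul_comm]

end Expansion

/-! ### Exceptional bases are conjugate -/

section Conjugate

/-- Noether's inequality: the three largest multiplicities of a homaloidal net of degree `d ≥ 2`
add up to more than `d`. -/
theorem exists_three_of_sum {r : ℕ} {m : Fin r → ℤ} {d : ℤ} (hd : 2 ≤ d) (h0 : ∀ j, 0 ≤ m j)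
    (h1 : ∑ j, m j = 3 * (d - 1)) (h2 : ∑ j, m j ^ 2 = d ^ 2 - 1) :
    ∃ i j k, i ≠ j ∧ i ≠ k ∧ j ≠ k ∧ d < m i + m j + m k := by
  have hlt : ∀ j, m j ≤ d - 1 := fun j => by
    have : m j ^ 2 ≤ ∑ j, m j ^ 2 :=
      Finset.single_le_sum (f := fun j => m j ^ 2) (fun i _ => sq_nonneg _) (Finset.mem_univ j)
    by_contra hc
    nlinarith
  have hne : (Finset.univ : Finset (Fin r)).Nonempty := by
    rw [Finset.nonempty_iff_ne_empty]
    intro h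
    rw [h, Finset.sum_empty] at h1
    omega
  obtain ⟨i, -, hi⟩ := Finset.exists_max_image Finset.univ m hne
  have s1 := Finset.add_sum_erase Finset.univ m (Finset.mem_univ i)
  have hne2 : (Finset.univ.erase i).Nonempty := by
    rw [Finset.nonempty_iff_ne_empty]
    intro h
    rw [h, Finset.sum_empty] at s1
    have := hlt i
    omega
  obtain ⟨j, hj, hj'⟩ := Finset.exists_max_image _ m hne2
  have s2 := Finset.add_sum_erase _ m hj
  have hne3 : ((Finset.univ.erase i).erase j).Nonempty := by
    rw [Finset.nonempty_iff_ne_empty]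
    intro h
    rw [h, Finset.sum_empty] at s2
    have := hlt i
    have := hlt j
    omega
  obtain ⟨k, hk, hk'⟩ := Finset.exists_max_image _ m hne3
  have hji : j ≠ i := Finset.ne_of_mem_erase hj
  have hkj : k ≠ j := Finset.ne_of_mem_erase hk
  have hki : k ≠ i := Finset.ne_of_mem_erase (Finset.mem_of_mem_erase hk)
  refine ⟨i, j, k, hji.symm, hki.symm, hkj.symm, ?_⟩
  by_contra hc
  -- otherwise compare `∑ m l (m l - m k) = (d - 1) (d + 1 - 3 m k)` with its two positive terms
  have hsum : ∑ l, m l * (m l - m k) = (d - 1) * (d + 1 - 3 * m k) := by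
    have : ∀ l, m l * (m l - m k) = m l ^ 2 - m l * m k := fun l => by ring
    simp only [this, Finset.sum_sub_distrib, ← Finset.sum_mul, h1, h2]
    ring
  have t1 := Finset.add_sum_erase Finset.univ (fun l => m l * (m l - m k)) (Finset.mem_univ i)
  have t2 := Finset.add_sum_erase _ (fun l => m l * (m l - m k)) hj
  have t3 : ∑ l ∈ (Finset.univ.erase i).erase j, m l * (m l - m k) ≤ 0 :=
    Finset.sum_nonpos fun l hl => mul_nonpos_of_nonneg_of_nonpos (h0 l) (by linarith [hk' l hl])
  have u1 := hi k (Finset.mem_univ k)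
  have u2 := hj' k (Finset.mem_of_mem_erase hk)
  have v1 := mul_le_mul_of_nonneg_right (hlt i) (sub_nonneg.mpr u1)
  have v2 := mul_le_mul_of_nonneg_right (hlt j) (sub_nonneg.mpr u2)
  nlinarith

variable {M : Type u} [AddCommGroup M] {B : M →+ M →+ ℤ} {κ : M} {r : ℕ} {L L' : M}
  {E E' : Fin r → M}

/-- Permutations of the exceptional classes are products of reflections in the `E i - E j`. -/
theorem IsExceptionalBasis.exists_perm (h : IsExceptionalBasis B κ L E) (σ : Equiv.Perm (Fin r)) :
    ∃ w ∈ reflectionGroup B κ, w L = L ∧ ∀ j, w (E j) = E (σ j) := by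
  induction σ using Equiv.Perm.swap_induction_on with
  | one => exact ⟨1, one_mem _, rfl, fun _ => rfl⟩
  | swap_mul σ x y hxy ih =>
    obtain ⟨w, hw, h1, h2⟩ := ih
    obtain ⟨v, hv, hv'⟩ := exists_reflection (B := B) (κ := κ) (R := E x - E y)
      (by simp [h.exc, hxy, hxy.symm]) (by simp [h.exc_deg])
    refine ⟨v * w, mul_mem hv hw, ?_, fun j => ?_⟩
    · rw [LinearEquiv.mul_apply, h1, hv']
      simp [h.line_exc]
    · rw [LinearEquiv.mul_apply, h2, hv', Equiv.Perm.mul_apply, Equiv.swap_apply_def]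
      simp only [map_sub, h.exc]
      split_ifs with h3 h4 h4 <;> simp_all

variable [Module.Finite ℤ M] [Module.IsTorsionFree ℤ M]

/-- The coefficients of `E' j` in terms of the `E i` have square sum and sum `1`, so only one of
them is nonzero. -/
theorem IsExceptionalBasis.exists_perm_of_line_eq (hB : ∀ x y, B x y = B y x)
    (hr : r + 1 = Module.finrank ℤ M) (h : IsExceptionalBasis B κ L E)
    (h' : IsExceptionalBasis B κ L E') : ∃ σ : Equiv.Perm (Fin r), ∀ j, E' j = E (σ j) := by
  have key : ∀ j, ∃ i, E' j = E i := by
    intro j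
    have e1 := h.form_eq hB hr (E' j) (E' j)
    have e2 := h.form_eq hB hr (E' j) κ
    have e0 : B (E' j) L = 0 := by rw [hB, h'.line_exc]
    have e3 : ∀ i, B κ (E i) = 1 := fun i => by rw [hB, h.exc_deg]
    rw [h'.exc, if_pos rfl, e0] at e1
    rw [h'.exc_deg, e0] at e2
    simp only [e3, mul_one, zero_mul, zero_sub] at e1 e2
    -- the numbers `c i = E' j · E i` satisfy `∑ c i² = 1 = -∑ c i`, and `c i² + c i ≥ 0`
    have hnn : ∀ i, 0 ≤ B (E' j) (E i) * B (E' j) (E i) + B (E' j) (E i) := fun i => by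
      rcases le_or_gt 0 (B (E' j) (E i)) with h | h <;> nlinarith
    have hz : ∑ i, (B (E' j) (E i) * B (E' j) (E i) + B (E' j) (E i)) = 0 := by
      rw [Finset.sum_add_distrib]
      linarith
    have hz' := (Finset.sum_eq_zero_iff_of_nonneg fun i _ => hnn i).mp hz
    have hc : ∀ i, B (E' j) (E i) = 0 ∨ B (E' j) (E i) = -1 := fun i => by
      have h1 := hz' i (Finset.mem_univ i)
      have h2 : B (E' j) (E i) * (B (E' j) (E i) + 1) = 0 := by linarith
      rcases mul_eq_zero.mp h2 with h3 | h3
      · exact Or.inl h3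
      · exact Or.inr (by linarith)
    obtain ⟨i, hi⟩ : ∃ i, B (E' j) (E i) = -1 := by
      by_contra hcon
      push Not at hcon
      rw [Finset.sum_eq_zero fun i _ => (hc i).resolve_right (hcon i)] at e2
      omega
    have hother : ∀ l, l ≠ i → B (E' j) (E l) = 0 := fun l hl => by
      refine (hc l).resolve_right fun hl' => ?_
      have t1 := Finset.add_sum_erase Finset.univ (fun l => B (E' j) (E l)) (Finset.mem_univ i)
      have t2 : B (E' j) (E l) ≥ ∑ l ∈ Finset.univ.erase i, B (E' j) (E l) := by
        rw [← Finset.add_sum_erase _ _ (Finset.mem_erase.mpr ⟨hl, Finset.mem_univ l⟩)]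
        have : ∑ x ∈ (Finset.univ.erase i).erase l, B (E' j) (E x) ≤ 0 :=
          Finset.sum_nonpos fun x _ => by rcases hc x with h | h <;> omega
        linarith
      linarith
    refine ⟨i, ?_⟩
    rw [h.expand hB hr (E' j), e0, Finset.sum_eq_single i (fun l _ hl => by
      rw [hother l hl, zero_smul]) (fun h => absurd (Finset.mem_univ i) h), hi]
    simp
  choose σ hσ using key
  have hinj : Function.Injective σ := by
    intro i j hij
    by_contra hne
    have h1 := h'.exc i j
    rw [if_neg hne, hσ i, hσ j, hij, h.exc, if_pos rfl] at h1
    omega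
  exact ⟨Equiv.ofBijective σ (Finite.injective_iff_bijective.mp hinj), hσ⟩

theorem IsExceptionalBasis.sum_form (hB : ∀ x y, B x y = B y x)
    (hr : r + 1 = Module.finrank ℤ M) (h : IsExceptionalBasis B κ L E) (x : M) :
    ∑ j, B x (E j) = 3 * B x L - B x κ := by
  have e2 := h.form_eq hB hr x κ
  have e3 : ∀ i, B κ (E i) = 1 := fun i => by rw [hB, h.exc_deg]
  have e4 : B κ L = 3 := by rw [hB, h.line_deg]
  simp only [e3, e4, mul_one] at e2
  linarith

theorem IsExceptionalBasis.sum_form_sq (hB : ∀ x y, B x y = B y x)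
    (hr : r + 1 = Module.finrank ℤ M) (h : IsExceptionalBasis B κ L E) (x : M) :
    ∑ j, B x (E j) ^ 2 = B x L ^ 2 - B x x := by
  have e2 := h.form_eq hB hr x x
  simp only [sq]
  linarith

/-- The Cauchy–Schwarz inequality for the coefficients of `x`; this is where `r ≤ 8` enters. -/
theorem IsExceptionalBasis.sq_le (hB : ∀ x y, B x y = B y x)
    (hr : r + 1 = Module.finrank ℤ M) (hr8 : r ≤ 8) (h : IsExceptionalBasis B κ L E) (x : M) :
    (3 * B x L - B x κ) ^ 2 ≤ 8 * (B x L ^ 2 - B x x) := by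
  rw [← h.sum_form hB hr, ← h.sum_form_sq hB hr]
  refine (sq_sum_le_card_mul_sum_sq (s := Finset.univ) (f := fun j => B x (E j))).trans ?_
  rw [Finset.card_univ, Fintype.card_fin]
  exact mul_le_mul_of_nonneg_right (by exact_mod_cast hr8)
    (Finset.sum_nonneg fun _ _ => sq_nonneg _)

theorem IsExceptionalBasis.one_le_form_line (hB : ∀ x y, B x y = B y x)
    (hr : r + 1 = Module.finrank ℤ M) (hr8 : r ≤ 8) (h : IsExceptionalBasis B κ L E)
    (h' : IsExceptionalBasis B κ L' E') : 1 ≤ B L' L := by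
  have := h.sq_le hB hr hr8 L'
  rw [h'.line_deg, h'.line] at this
  nlinarith

theorem IsExceptionalBasis.form_line_exc_nonneg (hB : ∀ x y, B x y = B y x)
    (hr : r + 1 = Module.finrank ℤ M) (hr8 : r ≤ 8) (h : IsExceptionalBasis B κ L E)
    (h' : IsExceptionalBasis B κ L' E') (j : Fin r) : 0 ≤ B L' (E j) := by
  have h1 := h'.sq_le hB hr hr8 (E j)
  have h2 := h'.sum_form hB hr (E j)
  have h3 := h'.sum_form_sq hB hr (E j)
  rw [h.exc_deg] at h1 h2
  rw [h.exc, if_pos rfl] at h1 h3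
  rw [hB L']
  generalize B (E j) L' = m at *
  by_contra hm
  -- `m² - 6 m - 7 ≤ 0`; and for `m = -1` the products of `E j` with the `E' i` would be integers
  -- with sum `-4` and square sum `2`
  obtain rfl : m = -1 := by nlinarith
  have h4 : 0 ≤ ∑ i, (B (E j) (E' i) ^ 2 + B (E j) (E' i)) := Finset.sum_nonneg fun i _ => by
    rcases le_or_gt 0 (B (E j) (E' i)) with h | h <;> nlinarith
  rw [Finset.sum_add_distrib, h2, h3] at h4
  norm_num at h4

/-- Any two exceptional bases are conjugate: reflections in `L - E i - E j - E k` lower the degree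
`L' · L` until `L' = L`, as in Noether's factorization of plane Cremona transformations. -/
theorem IsExceptionalBasis.exists_reflectionGroup_map (hB : ∀ x y, B x y = B y x)
    (hr : r + 1 = Module.finrank ℤ M) (hr8 : r ≤ 8) (h : IsExceptionalBasis B κ L E)
    (h' : IsExceptionalBasis B κ L' E') :
    ∃ w ∈ reflectionGroup B κ, w L = L' ∧ ∀ j, w (E j) = E' j := by
  obtain ⟨N, hN⟩ : ∃ N : ℕ, B L' L ≤ N := ⟨(B L' L).toNat, Int.self_le_toNat _⟩
  induction N generalizing L' E' with
  | zero =>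
    have := h.one_le_form_line hB hr hr8 h'
    norm_num at hN
    omega
  | succ N ih =>
    have hd := h.one_le_form_line hB hr hr8 h'
    have h0 := h.form_line_exc_nonneg hB hr hr8 h'
    have h1 := h.sum_form hB hr L'
    have h2 := h.sum_form_sq hB hr L'
    rw [h'.line_deg] at h1
    rw [h'.line] at h2
    rcases hd.eq_or_lt with hd | hd
    · rw [← hd] at h2
      have hz : ∀ j, B L' (E j) = 0 := fun j => by
        have := (Finset.sum_eq_zero_iff_of_nonneg fun i _ => sq_nonneg (B L' (E i))).mp
          (by rw [h2]; norm_num) j (Finset.mem_univ j)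
        exact pow_eq_zero_iff two_ne_zero |>.mp this
      obtain rfl : L' = L := by
        rw [h.expand hB hr L', ← hd]
        simp [hz]
      obtain ⟨σ, hσ⟩ := h.exists_perm_of_line_eq hB hr h'
      obtain ⟨w, hw, hw1, hw2⟩ := h.exists_perm σ
      exact ⟨w, hw, hw1, fun j => by rw [hw2, hσ]⟩
    · obtain ⟨i, j, k, hij, hik, hjk, hlt⟩ := exists_three_of_sum hd h0 (by linarith) h2
      have hEL : ∀ j, B (E j) L = 0 := fun j => by rw [hB, h.line_exc]
      obtain ⟨v, hv, hv'⟩ := exists_reflection (B := B) (κ := κ) (R := L - E i - E j - E k)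
        (by simp [h.exc, h.line, h.line_exc, hEL, hij, hij.symm, hik, hik.symm, hjk, hjk.symm])
        (by simp [h.exc_deg, h.line_deg])
      obtain ⟨w, hw, hw1, hw2⟩ := ih (h'.map hB hv) (by
        rw [hv']
        simp only [map_add, map_sub, map_zsmul, AddMonoidHom.add_apply, AddMonoidHom.sub_apply,
          AddMonoidHom.coe_smul, Pi.smul_apply, smul_eq_mul, h.line, hEL]
        push_cast at hN
        linarith)
      refine ⟨v⁻¹ * w, mul_mem (inv_mem hv) hw, ?_, fun j => ?_⟩
      · rw [LinearEquiv.mul_apply, hw1]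
        exact v.symm_apply_apply _
      · rw [LinearEquiv.mul_apply, hw2]
        exact v.symm_apply_apply _

theorem IsRulingBasis.exists_reflectionGroup_map (hB : ∀ x y, B x y = B y x)
    (hr : 2 = Module.finrank ℤ M) {F S F' S' : M} (h : IsRulingBasis B κ F S)
    (h' : IsRulingBasis B κ F' S') :
    ∃ w ∈ reflectionGroup B κ, w F = F' ∧ w S = S' := by
  have key : ∀ x, B x x = 0 → B x κ = 2 → x = F ∨ x = S := by
    intro x h1 h2
    have hx := h.expand hB hr x
    have e1 : B x x = 2 * (B x S * B x F) := by
      conv_lhs => rw [hx]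
      simp only [map_add, map_zsmul, AddMonoidHom.add_apply, AddMonoidHom.coe_smul,
        Pi.smul_apply, smul_eq_mul, h.left, h.right, h.left_right, hB S F]
      ring
    have e2 : B x κ = 2 * (B x S + B x F) := by
      conv_lhs => rw [hx]
      simp only [map_add, map_zsmul, AddMonoidHom.add_apply, AddMonoidHom.coe_smul,
        Pi.smul_apply, smul_eq_mul, h.left_deg, h.right_deg]
      ring
    rw [h1] at e1
    rw [h2] at e2
    have e3 : B x S * B x F = 0 := by linarith
    rcases mul_eq_zero.mp e3 with e | e
    · right
      have e' : B x F = 1 := by linarith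
      rw [hx, e, e']
      simp
    · left
      have e' : B x S = 1 := by linarith
      rw [hx, e, e']
      simp
  have hF := key F' h'.left h'.left_deg
  have hS := key S' h'.right h'.right_deg
  have h3 := h'.left_right
  have hSF : B S F = 1 := by rw [hB, h.left_right]
  rcases hF with rfl | rfl <;> rcases hS with rfl | rfl
  · rw [h.left] at h3
    omega
  · exact ⟨1, one_mem _, rfl, rfl⟩
  · obtain ⟨w, hw, hw'⟩ := exists_reflection (B := B) (κ := κ) (R := S' - F')
      (by simp [h.left, h.right, h.left_right, hSF]) (by simp [h.left_deg, h.right_deg])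
    refine ⟨w, hw, ?_, ?_⟩
    · rw [hw']
      simp [h.left, h.left_right]
    · rw [hw']
      simp [h.right, hSF]
  · rw [h.right] at h3
    omega

end Conjugate

/-! ### The action of the reflection group on chains -/

section Action

variable {M : Type u} [AddCommGroup M] [Module.Finite ℤ M] [Module.IsTorsionFree ℤ M]
  {B : M →+ M →+ ℤ} {n : ℕ} {a : ℕ → ℤ} {A A' : ℕ → M}

/-- An automorphism that fixes a chain fixes the standard basis obtained from it. -/
theorem eq_one_of_apply_chain_eq (hB : ∀ x y, B x y = B y x) (ha : HasPairedBases B n a)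
    (hn : n = Module.finrank ℤ M + 2)
    (hA : IsCyclicChain B n a A)
    {w : M ≃ₗ[ℤ] M} (hw : ∀ i < n, w (A i) = A i) : w = 1 := by
  have hfix : ∀ {x y : M}, (x, y) ∈ pairedSpan n A A → w x = x := fun {x y} hxy =>
    (apply_eq_of_mem_pairedSpan (w := (w : M →ₗ[ℤ] M).toAddMonoidHom) hw hxy).trans
      (apply_eq_of_mem_pairedSpan (w := AddMonoidHom.id M) (fun _ _ => rfl) hxy).symm
  refine LinearEquiv.ext fun x => ?_
  rw [LinearEquiv.coe_one, id_eq]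
  rcases ha A A hA hA with
    ⟨r, hr, L, L', E, E', hL, hE, hb⟩ | ⟨h4, F, F', S, S', hF, hS, hb⟩
  · rw [hb.expand hB (by omega) x]
    simp only [map_sub, map_sum, map_zsmul, hfix hL, hfix (hE _)]
  · rw [hb.expand hB (by omega) x]
    simp only [map_add, map_zsmul, hfix hF, hfix hS]

/-- The standard bases obtained from two chains with the same self-intersections are conjugate;
since the elements of the two chains have the same coefficients in these bases, the chains are
conjugate as well. -/
theorem exists_reflectionGroup_map_chain (hB : ∀ x y, B x y = B y x) (ha : HasPairedBases B n a)
    (hn : n = Module.finrank ℤ M + 2) (hrank : Module.finrank ℤ M ≤ 9) {κ : M}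
    (hA : IsCyclicChain B n a A)
    (hA' : IsCyclicChain B n a A')
    (hκ : ∑ i ∈ Finset.range n, A i = κ) (hκ' : ∑ i ∈ Finset.range n, A' i = κ) :
    ∃ w ∈ reflectionGroup B κ, ∀ i < n, w (A i) = A' i := by
  have hform : ∀ {x x' y y' : M}, (x, x') ∈ pairedSpan n A A' →
      (y, y') ∈ pairedSpan n A A' → B x y = B x' y' :=
    fun hx hy => form_eq_of_mem_pairedSpan hB hA hA' hx hy
  have hκκ : (κ, κ) ∈ pairedSpan n A A' := by
    have h := sum_mem_pairedSpan (n := n) (A := A) (A' := A')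
    rwa [hκ, hκ'] at h
  have hmem : ∀ i < n, (A i, A' i) ∈ pairedSpan n A A' :=
    fun i hi => mem_pairedSpan hi
  rcases ha A A' hA hA' with
    ⟨r, hr, L, L', E, E', hL, hE, hb⟩ | ⟨h4, F, F', S, S', hF, hS, hb⟩
  · rw [hκ] at hb
    have hb' : IsExceptionalBasis B κ L' E' :=
      ⟨by rw [← hform hL hL, hb.line], fun j => by rw [← hform hL (hE j), hb.line_exc],
        fun i j => by rw [← hform (hE i) (hE j), hb.exc], by rw [← hform hL hκκ, hb.line_deg],
        fun j => by rw [← hform (hE j) hκκ, hb.exc_deg]⟩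
    obtain ⟨w, hw, hw1, hw2⟩ :=
      hb.exists_reflectionGroup_map hB (by omega) (by omega) hb'
    refine ⟨w, hw, fun i hi => ?_⟩
    rw [hb.expand hB (by omega) (A i), hb'.expand hB (by omega) (A' i)]
    simp only [map_sub, map_sum, map_zsmul, hw1, hw2, hform (hmem i hi) hL,
      hform (hmem i hi) (hE _)]
  · rw [hκ] at hb
    have hb' : IsRulingBasis B κ F' S' :=
      ⟨by rw [← hform hF hF, hb.left], by rw [← hform hS hS, hb.right],
        by rw [← hform hF hS, hb.left_right], by rw [← hform hF hκκ, hb.left_deg],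
        by rw [← hform hS hκκ, hb.right_deg]⟩
    obtain ⟨w, hw, hw1, hw2⟩ := hb.exists_reflectionGroup_map hB (by omega) hb'
    refine ⟨w, hw, fun i hi => ?_⟩
    rw [hb.expand hB (by omega) (A i), hb'.expand hB (by omega) (A' i)]
    simp only [map_add, map_zsmul, hw1, hw2, hform (hmem i hi) hF, hform (hmem i hi) hS]

end Action

/-! ### Toric systems as chains -/

section Toric

variable {k : Type u} [Field k] {X : Scheme.{u}} [IsIntegral X] [IsLocallyNoetherian X]

/-- Symmetry is the only property of the intersection form that is needed, and it also holds for
the default value `0`. -/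
theorem intersectionForm_comm (D E : Pic X) : intersectionForm X D E = intersectionForm X E D := by
  unfold intersectionForm
  split_ifs with h
  · exact h.choose_spec.1 D E
  · rfl

/-- For classes with `R² = -2` the condition `R² + R · K = -2` says that `R` is orthogonal
to `K`. -/
theorem weylGroup_eq_reflectionGroup (f : X ⟶ Spec (.of k)) :
    weylGroup f = reflectionGroup (intersectionForm X) (-canonicalClass f) := by
  unfold weylGroup reflectionGroup
  congr 1
  ext w
  refine exists_congr fun R => and_congr_left fun _ => ?_
  unfold IsRClass
  rw [map_neg]
  constructor <;> rintro ⟨h1, h2⟩ <;> constructor <;> linarith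

/-- A family indexed by `Fin n`, extended by zero to all indices. -/
def extendFin {M : Type*} [Zero M] {n : ℕ} (A : Fin n → M) (i : ℕ) : M :=
  if h : i < n then A ⟨i, h⟩ else 0

theorem extendFin_of_lt {M : Type*} [Zero M] {n : ℕ} (A : Fin n → M) {i : ℕ} (h : i < n) :
    extendFin A i = A ⟨i, h⟩ := dif_pos h

theorem sum_range_extendFin {M : Type*} [AddCommMonoid M] {n : ℕ} (A : Fin n → M) :
    ∑ i ∈ Finset.range n, extendFin A i = ∑ i, A i := by
  rw [Finset.sum_range]
  exact Finset.sum_congr rfl fun i _ => extendFin_of_lt A i.2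

theorem isCyclicChain_extendFin {f : X ⟶ Spec (.of k)} {n : ℕ} [NeZero n]
    {a : Fin n → ℤ} {A : Fin n → Pic X} (hA : A ∈ toricSystems f a) :
    IsCyclicChain (intersectionForm X) n (fun i => (List.ofFn a).getD i 0) (extendFin A) := by
  have hval : ∀ x : Fin n, ((x + 1 : Fin n) : ℕ) = (x + 1) % n := fun x => by
    rw [Fin.val_add, Fin.val_one', Nat.add_mod_mod]
  refine ⟨fun i hi => ?_, fun i j hij hj => ?_⟩
  · rw [extendFin_of_lt A hi, hA.2]
    simp [hi]
  · have hi := hij.trans hj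
    rw [extendFin_of_lt A hi, extendFin_of_lt A hj]
    split_ifs with h
    · rcases h with rfl | ⟨rfl, h⟩
      · have h1 : (⟨i + 1, hj⟩ : Fin n) = ⟨i, hi⟩ + 1 :=
          Fin.ext (by rw [hval, Nat.mod_eq_of_lt hj])
        rw [h1, hA.1.adjacent]
      · have h1 : (⟨0, hi⟩ : Fin n) = ⟨j, hj⟩ + 1 :=
          Fin.ext (by rw [hval, h, Nat.mod_self])
        rw [h1, intersectionForm_comm, hA.1.adjacent]
    · refine hA.1.not_adjacent _ _ (fun h1 => ?_) (fun h1 => ?_) (fun h1 => ?_)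
      · have := Fin.val_eq_of_eq h1
        simp only at this
        omega
      · have := Fin.val_eq_of_eq h1
        rw [hval, Nat.mod_eq_of_lt (show i + 1 < n by omega)] at this
        exact h (Or.inl this)
      · have h2 : (⟨j, hj⟩ : Fin n) + 1 = ⟨i, hi⟩ := by rw [h1, sub_add_cancel]
        have := Fin.val_eq_of_eq h2
        rw [hval] at this
        simp only at this
        rcases eq_or_ne (j + 1) n with h3 | h3
        · rw [h3, Nat.mod_self] at this
          exact h (Or.inr ⟨this.symm, h3⟩)
        · rw [Nat.mod_eq_of_lt (by omega)] at this
          omega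

theorem IsClassGroupBounded.isTorsionFree_pic {r : ℕ} (h : IsClassGroupBounded r X) :
    Module.IsTorsionFree ℤ (Pic X) := by
  rw [Module.isTorsionFree_iff_smul_eq_zero]
  intro m x
  induction x using QuotientAddGroup.induction_on with
  | H D =>
    refine fun h1 => or_iff_not_imp_left.mpr fun hm => ?_
    exact (QuotientAddGroup.eq_zero_iff D).mpr
      (h.torsionFree m D hm ((QuotientAddGroup.eq_zero_iff (m • D)).mp h1))

theorem IsClassGroupBounded.exists_span_eq_top {r : ℕ} (h : IsClassGroupBounded r X) :
    ∃ c : Fin r → Pic X, Submodule.span ℤ (Set.range c) = ⊤ := by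
  obtain ⟨c, hc⟩ := h.generators
  refine ⟨fun i => Pic.mk (c i), eq_top_iff.mpr fun x _ => ?_⟩
  induction x using QuotientAddGroup.induction_on with
  | H D =>
    obtain ⟨z, hz⟩ := hc D
    rw [← QuotientAddGroup.eq_zero_iff, QuotientAddGroup.mk_sub, sub_eq_zero] at hz
    rw [hz]
    have h1 : (QuotientAddGroup.mk (∑ i, z i • c i) : Pic X) = ∑ i, z i • Pic.mk (c i) :=
      map_sum (QuotientAddGroup.mk' (principalDivisors X)) _ _
    rw [h1]
    exact sum_mem fun i _ => Submodule.smul_mem _ _ (Submodule.subset_span ⟨i, rfl⟩)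

theorem map_mem_toricSystems {f : X ⟶ Spec (.of k)} {n : ℕ} [NeZero n] {a : Fin n → ℤ}
    {w : Pic X ≃ₗ[ℤ] Pic X} (hw : w ∈ weylGroup f) {A : Fin n → Pic X}
    (hA : A ∈ toricSystems f a) : (fun i => w (A i)) ∈ toricSystems f a := by
  rw [weylGroup_eq_reflectionGroup] at hw
  obtain ⟨h1, h2⟩ := preserves_of_mem_reflectionGroup intersectionForm_comm hw
  refine ⟨⟨hA.1.length_eq, fun i => ?_, fun i j hi hj hk => ?_, ?_⟩, fun i => ?_⟩
  · rw [h2, hA.1.adjacent]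
  · rw [h2, hA.1.not_adjacent i j hi hj hk]
  · rw [← map_sum, hA.1.sum_eq, h1]
  · rw [h2, hA.2]

end Toric

end RationalSurface

end

theorem mainTheorem12 {k : Type u} [Field k] [IsAlgClosed k] [CharZero k]
    {X : Scheme.{u}} [IsIntegral X] [IsLocallyNoetherian X] (f : X ⟶ Spec (.of k))
    (s : ℕ) (hs : s ≤ 8) (hX : RationalSurface.IsIteratedBlowUp k s X f)
    {n : ℕ} [NeZero n] (a : Fin n → ℤ) (ha : RationalSurface.IsAdmissible (List.ofFn a)) :
    -- the Weyl group acts on the set of toric systems with self-intersections `a`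
    (∀ w ∈ RationalSurface.weylGroup f, ∀ A ∈ RationalSurface.toricSystems f a,
      (fun i => w (A i)) ∈ RationalSurface.toricSystems f a) ∧
    -- the action is free
    (∀ w ∈ RationalSurface.weylGroup f, ∀ A ∈ RationalSurface.toricSystems f a,
      (fun i => w (A i)) = A → w = 1) ∧
    -- the action is transitive
    (∀ A ∈ RationalSurface.toricSystems f a, ∀ B ∈ RationalSurface.toricSystems f a,
      ∃ w ∈ RationalSurface.weylGroup f, (fun i => w (A i)) = B) := by
  have hfree := (hX.isNormalSurface.classGroup).isTorsionFree_pic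
  obtain ⟨c, hc⟩ := (hX.isNormalSurface.classGroup).exists_span_eq_top
  have hfin : Module.Finite ℤ (RationalSurface.Pic X) :=
    ⟨⟨(Set.finite_range c).toFinset, by rw [Set.Finite.coe_toFinset, hc]⟩⟩
  have hrank : Module.finrank ℤ (RationalSurface.Pic X) ≤ 9 := by
    have h := finrank_le_of_span_eq_top hc
    rw [Fintype.card_fin] at h
    omega
  have hbases : RationalSurface.HasPairedBases (RationalSurface.intersectionForm X) n
      (fun i => (List.ofFn a).getD i 0) := by
    have h := (ha.hasPairedBases (RationalSurface.intersectionForm_comm (X := X))).2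
    rwa [List.length_ofFn] at h
  refine ⟨fun w hw A hA => RationalSurface.map_mem_toricSystems hw hA, fun w hw A hA hwA => ?_,
    fun A hA B hB => ?_⟩
  · refine RationalSurface.eq_one_of_apply_chain_eq RationalSurface.intersectionForm_comm hbases
      hA.1.length_eq (RationalSurface.isCyclicChain_extendFin hA) fun i hi => ?_
    rw [RationalSurface.extendFin_of_lt A hi]
    exact congrFun hwA ⟨i, hi⟩
  · rw [RationalSurface.weylGroup_eq_reflectionGroup]
    obtain ⟨w, hw, hwA⟩ := RationalSurface.exists_reflectionGroup_map_chain
      RationalSurface.intersectionForm_comm hbases hA.1.length_eq hrank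
      (RationalSurface.isCyclicChain_extendFin hA) (RationalSurface.isCyclicChain_extendFin hB)
      ((RationalSurface.sum_range_extendFin A).trans hA.1.sum_eq)
      ((RationalSurface.sum_range_extendFin B).trans hB.1.sum_eq)
    refine ⟨w, hw, funext fun i => ?_⟩
    have h := hwA i i.2
    rwa [RationalSurface.extendFin_of_lt A i.2, RationalSurface.extendFin_of_lt B i.2] at h
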